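/- Let $\mathbb F$ be a field of characteristic $p>3$, let $n\ge 3$ be an integer and let $\underline t=(t_1,\dots,t_n)$ be an $n$-tuple of positive integers. Put $Y_0=\{1,\dots,n\}$, $Y_1=\{n+1,\dots,2n\}$, $Y=Y_0\cup Y_1$; for $i\in Y$ let $\mu(i)=\bar 0$ if $i\in Y_0$ and $\mu(i)=\bar 1$ if $i\in Y_1$, and let $i'=i+n$ if $i\in Y_0$ and $i'=i-n$ if $i\in Y_1$. Let $\mathcal O(n,n)=\mathcal O(n)\otimes\Lambda(n)$ be the tensor product of the divided power algebra $\mathcal O(n)$, with basis $x^{(\alpha)}$ ($\alpha\in\mathbb N_0^n$) and product $x^{(\alpha)}x^{(\beta)}=\binom{\alpha+\beta}{\alpha}x^{(\alpha+\beta)}$, and the exterior algebra $\Lambda(n)$ in the odd variables $x_{n+1},\dots,x_{2n}$. It has the basis $x^{(\alpha)}x^u$, where $u$ runs over the subsets of $Y_1$ and $x^u$ is the product of the $x_k$, $k\in u$, in increasing order; write $\mathrm p(a)\in\mathbb Z_2$ for the parity of a homogeneous element $a$. For $r\in Y_0$ let $\partial_r$ be the derivation $x^{(\alpha)}x^u\mapsto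 x^{(\alpha-\varepsilon_r)}x^u$ (zero if $\alpha_r=0$), and for $r\in Y_1$ let $\partial_r$ be the odd superderivation $x^{(\alpha)}x^u\mapsto x^{(\alpha)}\,\partial x^u/\partial x_r$. Let $\mathcal O(n,n;\underline t)$ be the subalgebra spanned by the $x^{(\alpha)}x^u$ with $\alpha_i\le p^{t_i}-1$ for all $i\in Y_0$, and let $$W(n,n;\underline t)=\Big\{\sum_{r\in Y}f_r\partial_r\ \Big|\ f_r\in\mathcal O(n,n;\underline t)\Big\}$$ be the generalized Witt superalgebra, where $f\partial_r$ has parity $\mathrm p(f)+\mu(r)$. Let $\mathrm{T_H}:\mathcal O(n,n;\underline t)\to W(n,n;\underline t)$ be the linear map with $\mathrm{T_H}(a)=\sum_{i\in Y}(-1)^{\mu(i)\mathrm p(a)}\partial_i(a)\partial_{i'}$ for homogeneous $a$, and let $HO(n,n;\underline t)=\mathrm{T_H}(\mathcal O(n,n;\underline t))$ be the odd Hamiltonian superalgebra. Let the Lie algebras $\mathcal W$ and $\mathcal{HO}\subseteq\mathcal W$ be the even parts of $W(n,n;\underline t)$ and $HO(n,n;\underline t)$. Let $\mathrm{Der}(\mathcal{HO},\mathcal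 W)$ be the space of all linear maps $D:\mathcal{HO}\to\mathcal W$ with $D([x,y])=[x,D(y)]-[y,D(x)]$ for all $x,y\in\mathcal{HO}$. For $w\in\mathcal W$ let $\mathrm{ad}\,w$ be the map $x\mapsto[w,x]$, and regard it and its powers as linear maps from $\mathcal{HO}$ to $\mathcal W$ by restriction. Then $$\mathrm{Der}(\mathcal{HO},\mathcal W)=\mathrm{ad}\,\mathcal W+\mathrm{span}_{\mathbb F}\big\{(\mathrm{ad}\,\partial_i)^{p^{k_i}}\ \big|\ i\in Y_0,\ 1\le k_i<t_i\big\}.$$ -/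

import Mathlib

namespace OddHamiltonian

attribute [local instance] LieRing.ofAssociativeRing

/-- The index set `Y = Y₀ ∪ Y₁`: `Sum.inl i` is `i ∈ Y₀ = {1, …, n}` and `Sum.inr i` is
`i' = n + i ∈ Y₁ = {n + 1, …, 2n}`. -/
abbrev Idx (n : ℕ) : Type := Fin n ⊕ Fin n

/-- The parity `μ(i)` of an index, as one of the integers `0`, `1`. -/
def mu {n : ℕ} : Idx n → ℕ
  | Sum.inl _ => 0
  | Sum.inr _ => 1

/-- The involution `i ↦ i'` exchanging `Y₀` and `Y₁`. -/
abbrev prime {n : ℕ} (i : Idx n) : Idx n := i.swap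

/-- The monomials `x^(α) x^u`: a multi-exponent `α` and a subset `u` of `Y₁`, the latter standing
for the increasing product of its variables. -/
abbrev Mono (n : ℕ) : Type := (Fin n → ℕ) × Finset (Fin n)

/-- The superalgebra `𝒪(n,n) = 𝒪(n) ⊗ Λ(n)`, the tensor product of the divided power algebra in
`n` variables and the exterior algebra in `n` variables, as the vector space with basis the
monomials `x^(α) x^u`. Its product is `mul`. -/
def O (F : Type*) [Field F] (n : ℕ) : Type _ := Mono n →₀ F

noncomputable instance (F : Type*) [Field F] (n : ℕ) : AddCommGroup (O F n) :=
  inferInstanceAs (AddCommGroup (Mono n →₀ F))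

noncomputable instance (F : Type*) [Field F] (n : ℕ) : Module F (O F n) :=
  inferInstanceAs (Module F (Mono n →₀ F))

variable (F : Type*) [Field F] {n : ℕ}

/-- The basis of monomials of `𝒪(n,n)`. -/
noncomputable def monoBasis (n : ℕ) : Module.Basis (Mono n) F (O F n) :=
  Finsupp.basisSingleOne

/-- The monomial `x^(α) x^u`. -/
noncomputable def mono (a : Mono n) : O F n := monoBasis F n a

/-- `∏ᵢ binom(αᵢ + βᵢ, αᵢ)`. -/
def binom (α β : Fin n → ℕ) : ℕ := ∏ i, (α i + β i).choose (α i)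

/-- The number of pairs `(k, l) ∈ u × v` with `l < k`; reordering `x^u x^v` into an increasing
product costs the sign `(-1) ^ inv u v`. -/
def inv (u v : Finset (Fin n)) : ℕ := ∑ k ∈ u, (v.filter (· < k)).card

/-- The product of two monomials. -/
noncomputable def mulMono (a b : Mono n) : O F n :=
  if Disjoint a.2 b.2 then
    ((-1) ^ inv a.2 b.2 * (binom a.1 b.1 : F)) • mono F (a.1 + b.1, a.2 ∪ b.2)
  else 0

/-- The product of `𝒪(n,n)`. -/
noncomputable def mul : O F n →ₗ[F] O F n →ₗ[F] O F n :=
  (monoBasis F n).constr F fun a => (monoBasis F n).constr F fun b => mulMono F a b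

/-- `∂_r` on monomials; for `r ∈ Y₁` it is the left derivative of the exterior algebra. -/
noncomputable def partialMono : Idx n → Mono n → O F n
  | Sum.inl i, (α, u) => if α i = 0 then 0 else mono F (α - Pi.single i 1, u)
  | Sum.inr k, (α, u) =>
      if k ∈ u then ((-1) ^ (u.filter (· < k)).card : F) • mono F (α, u.erase k) else 0

/-- The superderivation `∂_r` of `𝒪(n,n)`. -/
noncomputable def pd (r : Idx n) : Module.End F (O F n) :=
  (monoBasis F n).constr F (partialMono F r)

/-- The linear map `a ↦ (-1)^(μ(r) p(a)) a` (for homogeneous `a`). -/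
noncomputable def twist (r : Idx n) : Module.End F (O F n) :=
  (monoBasis F n).constr F fun a => ((-1) ^ (mu r * a.2.card) : F) • mono F a

/-- The homogeneous component of `𝒪(n,n)` of parity `θ`. -/
noncomputable def parityPart (θ : ZMod 2) : Submodule F (O F n) :=
  Submodule.span F (mono F '' {a : Mono n | (a.2.card : ZMod 2) = θ})

/-- The subspace `𝒪(n,n;t)` spanned by the `x^(α) x^u` with `αᵢ ≤ πᵢ = p ^ tᵢ - 1`. -/
noncomputable def trunc (p : ℕ) (t : Fin n → ℕ) : Submodule F (O F n) :=
  Submodule.span F (mono F '' {a : Mono n | ∀ i, a.1 i ≤ p ^ t i - 1})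

/-- The operator `∑_r f_r ∂_r` on `𝒪(n,n)`. -/
noncomputable def vectorField : (Idx n → O F n) →ₗ[F] Module.End F (O F n) :=
  ∑ r, (LinearMap.lcomp F (O F n) (pd F r)) ∘ₗ mul F ∘ₗ LinearMap.proj r

/-- `T_H(a) = ∑_i (-1)^(μ(i) p(a)) ∂_i(a) ∂_{i'}`, here indexed by `r = i'`. -/
noncomputable def TH : O F n →ₗ[F] Module.End F (O F n) :=
  vectorField F ∘ₗ LinearMap.pi fun r => pd F (prime r) ∘ₗ twist F (prime r)

/-- The component of parity `θ` of the generalized Witt superalgebra `W(n,n;t)`: all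
`∑_r f_r ∂_r` with `f_r ∈ 𝒪(n,n;t)` of parity `θ + μ(r)`. -/
noncomputable def wittPart (p : ℕ) (t : Fin n → ℕ) (θ : ZMod 2) : Submodule F (Module.End F (O F n)) :=
  (Submodule.pi Set.univ fun r => trunc F p t ⊓ parityPart F (θ + mu r)).map (vectorField F)

/-- The odd Hamiltonian superalgebra `HO(n,n;t) = T_H(𝒪(n,n;t))`. -/
noncomputable def hoSuper (p : ℕ) (t : Fin n → ℕ) : Submodule F (Module.End F (O F n)) :=
  (trunc F p t).map (TH F)

section

variable {F}

theorem mono_induction {P : O F n → Prop} (hadd : ∀ f g, P f → P g → P (f + g))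
    (hsmul : ∀ (c : F) f, P f → P (c • f)) (hmono : ∀ a, P (mono F a)) (f : O F n) : P f := by
  refine Submodule.span_induction (p := fun f _ => P f) ?_ ?_ (fun f g _ _ => hadd f g)
    (fun c f _ => hsmul c f) ((monoBasis F n).mem_span f)
  · rintro _ ⟨a, rfl⟩; exact hmono a
  · simpa using hsmul 0 _ (hmono (0, ∅))

@[simp] theorem mul_mono (a b : Mono n) : mul F (mono F a) (mono F b) = mulMono F a b := by
  simp [mul, mono]

@[simp] theorem pd_mono (r : Idx n) (a : Mono n) : pd F r (mono F a) = partialMono F r a := by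
  simp [pd, mono]

@[simp] theorem twist_mono (r : Idx n) (a : Mono n) :
    twist F r (mono F a) = ((-1) ^ (mu r * a.2.card) : F) • mono F a := by
  simp [twist, mono]

theorem inv_union_left {u v w : Finset (Fin n)} (h : Disjoint u v) :
    inv (u ∪ v) w = inv u w + inv v w := Finset.sum_union h

theorem inv_union_right {u v w : Finset (Fin n)} (h : Disjoint v w) :
    inv u (v ∪ w) = inv u v + inv u w := by
  simp only [inv, ← Finset.sum_add_distrib]
  refine Finset.sum_congr rfl fun k _ => ?_
  rw [Finset.filter_union, Finset.card_union_of_disjoint (Finset.disjoint_filter_filter h)]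

theorem binom_assoc (α β γ : Fin n → ℕ) :
    binom α β * binom (α + β) γ = binom β γ * binom α (β + γ) := by
  simp only [binom, ← Finset.prod_mul_distrib]
  refine Finset.prod_congr rfl fun i _ => ?_
  have h := Nat.add_choose_mul_factorial_mul_factorial (β i) (α i)
  have h2 := Nat.add_choose_mul_factorial_mul_factorial (γ i) (α i + β i)
  have h3 := Nat.add_choose_mul_factorial_mul_factorial (γ i) (β i)
  have h4 := Nat.add_choose_mul_factorial_mul_factorial (β i + γ i) (α i)
  rw [add_comm (β i)] at h
  rw [add_comm (γ i)] at h2 h3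
  rw [add_comm _ (α i), ← add_assoc] at h4
  have : 0 < (α i).factorial * (β i).factorial * (γ i).factorial := by positivity
  apply Nat.eq_of_mul_eq_mul_right this
  simp only [Pi.add_apply, ← add_assoc]
  rw [← h] at h2
  rw [← h3] at h4
  linear_combination h2 - h4

theorem mulMono_of_disjoint {a b : Mono n} (h : Disjoint a.2 b.2) : mulMono F a b =
    ((-1) ^ inv a.2 b.2 * (binom a.1 b.1 : F)) • mono F (a.1 + b.1, a.2 ∪ b.2) := if_pos h

theorem mulMono_pair {u v : Finset (Fin n)} (h : Disjoint u v) (α β : Fin n → ℕ) :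
    mulMono F (α, u) (β, v) =
      ((-1) ^ inv u v * (binom α β : F)) • mono F (α + β, u ∪ v) := if_pos h

theorem mulMono_of_not_disjoint {a b : Mono n} (h : ¬ Disjoint a.2 b.2) : mulMono F a b = 0 :=
  if_neg h

theorem mul_assoc' (f g h : O F n) : mul F (mul F f g) h = mul F f (mul F g h) := by
  induction f using mono_induction with
  | hadd f₁ f₂ h₁ h₂ => simp only [map_add, LinearMap.add_apply, h₁, h₂]
  | hsmul c f h => simp only [map_smul, LinearMap.smul_apply, h]
  | hmono a =>
  induction g using mono_induction with
  | hadd f₁ f₂ h₁ h₂ => simp only [map_add, LinearMap.add_apply, h₁, h₂]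
  | hsmul c f h => simp only [map_smul, LinearMap.smul_apply, h]
  | hmono b =>
  induction h using mono_induction with
  | hadd f₁ f₂ h₁ h₂ => simp only [map_add, h₁, h₂]
  | hsmul c f h => simp only [map_smul, h]
  | hmono c =>
  by_cases hab : Disjoint a.2 b.2
  · by_cases hbc : Disjoint b.2 c.2
    · rw [mul_mono, mul_mono, mulMono_of_disjoint hab, mulMono_of_disjoint hbc]
      simp only [map_smul, LinearMap.smul_apply, mul_mono]
      by_cases hac : Disjoint a.2 c.2
      · rw [mulMono_of_disjoint (by simp [hbc, hac]), mulMono_of_disjoint (by simp [hab, hac])]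
        simp only [smul_smul, add_assoc, Finset.union_assoc]
        rw [inv_union_left hab, inv_union_right hbc]
        congr 1
        have := congrArg (Nat.cast (R := F)) (binom_assoc a.1 b.1 c.1)
        push_cast at this
        simp only [pow_add]
        linear_combination (-1) ^ inv a.2 b.2 * (-1) ^ inv b.2 c.2 * (-1) ^ inv a.2 c.2 * this
      · rw [mulMono_of_not_disjoint (by simp [hac]), mulMono_of_not_disjoint (by simp [hac])]
        simp
    · rw [mul_mono, mul_mono, mulMono_of_disjoint hab, mulMono_of_not_disjoint hbc]
      simp only [map_smul, LinearMap.smul_apply, mul_mono]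
      rw [mulMono_of_not_disjoint (by simp [hbc])]
      simp
  · rw [mul_mono, mul_mono, mulMono_of_not_disjoint hab]
    by_cases hbc : Disjoint b.2 c.2
    · rw [mulMono_of_disjoint hbc]
      simp only [map_smul, mul_mono]
      rw [mulMono_of_not_disjoint (by simp [hab])]
      simp
    · rw [mulMono_of_not_disjoint hbc]
      simp

theorem inv_add_inv {u v : Finset (Fin n)} (h : Disjoint u v) :
    inv u v + inv v u = u.card * v.card := by
  have : inv v u = ∑ k ∈ u, (v.filter (k < ·)).card := by
    simp only [inv, Finset.card_filter]
    exact Finset.sum_comm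
  rw [this, inv, ← Finset.sum_add_distrib, ← smul_eq_mul, ← Finset.sum_const]
  refine Finset.sum_congr rfl fun k hk => ?_
  rw [← Finset.card_union_of_disjoint, ← Finset.filter_or]
  · congr 1
    refine Finset.filter_true_of_mem fun j hj => ?_
    exact lt_or_gt_of_ne fun e => Finset.disjoint_left.1 h hk (e ▸ hj)
  · rw [Finset.disjoint_filter]
    intro j _ h1
    exact h1.le.not_gt

theorem mulMono_comm (a b : Mono n) :
    mulMono F a b = ((-1) ^ (a.2.card * b.2.card) : F) • mulMono F b a := by
  by_cases h : Disjoint a.2 b.2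
  · rw [mulMono_of_disjoint h, mulMono_of_disjoint h.symm, ← inv_add_inv h, add_comm a.1,
      Finset.union_comm, smul_smul]
    have : binom a.1 b.1 = binom b.1 a.1 := by
      refine Finset.prod_congr rfl fun i _ => ?_
      rw [add_comm, Nat.choose_symm_add]
    rw [this, ← mul_assoc, ← pow_add]
    congr 2
    rw [add_assoc, pow_add, Even.neg_one_pow ⟨_, rfl⟩, mul_one]
  · rw [mulMono_of_not_disjoint h, mulMono_of_not_disjoint fun h' => h h'.symm, smul_zero]

theorem filter_lt_add_filter_gt {u : Finset (Fin n)} (k : Fin n) :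
    (u.filter (· < k)).card + (u.filter (k < ·)).card = (u.erase k).card := by
  rw [← Finset.card_union_of_disjoint, ← Finset.filter_or]
  · congr 1
    ext j
    simp [and_comm]
  · rw [Finset.disjoint_filter]
    intro j _ h1
    exact h1.le.not_gt

theorem inv_erase_left {u v : Finset (Fin n)} {k : Fin n} (h : k ∈ u) :
    inv u v = inv (u.erase k) v + (v.filter (· < k)).card := by
  rw [inv, inv, Finset.sum_erase_add _ _ h]

theorem inv_erase_right {u v : Finset (Fin n)} {k : Fin n} (h : k ∈ v) :
    inv u v = inv u (v.erase k) + (u.filter (k < ·)).card := by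
  have e : (u.filter (k < ·)).card = ∑ j ∈ u, if k < j then 1 else 0 := by
    rw [Finset.card_filter]
  rw [e, inv, inv, ← Finset.sum_add_distrib]
  refine Finset.sum_congr rfl fun j _ => ?_
  simp only [Finset.card_filter]
  rw [Finset.sum_erase_add _ _ h]

theorem binom_pd (α β : Fin n → ℕ) (i : Fin n) :
    (if (α + β) i = 0 then 0 else binom α β) =
      (if α i = 0 then 0 else binom (α - Pi.single i 1) β) +
      (if β i = 0 then 0 else binom α (β - Pi.single i 1)) := by
  have key : ∀ γ δ : Fin n → ℕ, (∀ j, j ≠ i → γ j = α j) → (∀ j, j ≠ i → δ j = β j) →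
      binom γ δ = (γ i + δ i).choose (γ i) *
        ∏ j ∈ Finset.univ.erase i, (α j + β j).choose (α j) := by
    intro γ δ h1 h2
    rw [binom, ← Finset.mul_prod_erase _ _ (Finset.mem_univ i)]
    congr 1
    refine Finset.prod_congr rfl fun j hj => ?_
    rw [h1 j (Finset.ne_of_mem_erase hj), h2 j (Finset.ne_of_mem_erase hj)]
  rw [key α β (fun _ _ => rfl) (fun _ _ => rfl),
    key (α - Pi.single i 1) β (fun j hj => by simp [hj]) (fun _ _ => rfl),
    key α (β - Pi.single i 1) (fun _ _ => rfl) (fun j hj => by simp [hj])]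
  simp only [Pi.add_apply, Pi.sub_apply, Pi.single_eq_same]
  have aux : ∀ a b R : ℕ, (if a + b = 0 then 0 else (a + b).choose a * R) =
      (if a = 0 then 0 else (a - 1 + b).choose (a - 1) * R) +
      (if b = 0 then 0 else (a + (b - 1)).choose a * R) := by
    intro a b R
    rcases a with _ | a <;> rcases b with _ | b <;> simp
    rw [← add_mul, show a + 1 + (b + 1) = (a + 1 + b) + 1 by ring, Nat.choose_succ_succ,
      show a + 1 + b = a + (b + 1) by ring]
  exact aux (α i) (β i) _

theorem leibMono_inl (i : Fin n) (a b : Mono n) :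
    pd F (Sum.inl i) (mulMono F a b) = mul F (partialMono F (Sum.inl i) a) (mono F b) +
      mul F (mono F a) (partialMono F (Sum.inl i) b) := by
  obtain ⟨α, u⟩ := a
  obtain ⟨β, v⟩ := b
  have hb := congrArg (Nat.cast (R := F)) (binom_pd α β i)
  have e1 : α i ≠ 0 → α - Pi.single i 1 + β = α + β - Pi.single i 1 := by
    intro h
    ext j
    by_cases hj : j = i
    · subst hj; simp; omega
    · simp [hj]
  have e2 : β i ≠ 0 → α + (β - Pi.single i 1) = α + β - Pi.single i 1 := by
    intro h
    ext j
    by_cases hj : j = i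
    · subst hj; simp; omega
    · simp [hj]
  by_cases h : Disjoint u v
  · rw [mulMono_of_disjoint h, map_smul, pd_mono]
    simp only [partialMono]
    by_cases ha : α i = 0 <;> by_cases hb' : β i = 0 <;>
      simp [ha, hb', mulMono_of_disjoint, h] at hb e1 e2 ⊢
    · rw [e2, hb]
    · rw [e1, hb]
    · rw [e1, e2, hb, ← add_smul, mul_add]
  · rw [mulMono_of_not_disjoint h]
    simp only [partialMono]
    split_ifs <;> simp [mulMono_of_not_disjoint, h]

theorem leibMono_inr (k : Fin n) (a b : Mono n) :
    pd F (Sum.inr k) (mulMono F a b) = mul F (partialMono F (Sum.inr k) a) (mono F b) +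
      ((-1) ^ a.2.card : F) • mul F (mono F a) (partialMono F (Sum.inr k) b) := by
  obtain ⟨α, u⟩ := a
  obtain ⟨β, v⟩ := b
  by_cases hu : k ∈ u <;> by_cases hv : k ∈ v
  · have h : ¬ Disjoint u v := Finset.not_disjoint_iff.2 ⟨k, hu, hv⟩
    rw [mulMono_of_not_disjoint h]
    simp only [partialMono, hu, hv, if_true, map_zero]
    by_cases h' : Disjoint (u.erase k) (v.erase k)
    · have h1 : Disjoint (u.erase k) v := by
        rw [Finset.disjoint_left] at h' ⊢
        intro j hj hjv
        exact h' hj (Finset.mem_erase.2 ⟨(Finset.mem_erase.1 hj).1, hjv⟩)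
      have h2 : Disjoint u (v.erase k) := by
        rw [Finset.disjoint_left] at h' ⊢
        intro j hj hjv
        exact h' (Finset.mem_erase.2 ⟨(Finset.mem_erase.1 hjv).1, hj⟩) hjv
      have e : u ∪ v.erase k = u.erase k ∪ v := by
        ext j; by_cases hj : j = k <;> simp [hj, hu, hv]
      simp only [map_smul, LinearMap.smul_apply, mul_mono, mulMono_pair h1, mulMono_pair h2, e,
        smul_smul, ← add_smul]
      symm
      convert zero_smul F _ using 2
      rw [inv_erase_left hu, inv_erase_right hv]
      have e3 : (u.erase k).filter (k < ·) = u.filter (k < ·) := by ext j; simp; grind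
      have e4 : (v.erase k).filter (· < k) = v.filter (· < k) := by ext j; simp; grind
      rw [e3, e4, ← Finset.card_erase_add_one hu, ← filter_lt_add_filter_gt k]
      simp only [pow_add, pow_one]
      have : ((-1 : F) ^ (v.filter (· < k)).card) * (-1 : F) ^ (v.filter (· < k)).card = 1 := by
        rw [← pow_add, Even.neg_one_pow ⟨_, rfl⟩]
      linear_combination (-(-1 : F) ^ (u.filter (· < k)).card * (-1 : F) ^ (u.filter (k < ·)).card *
        (-1) ^ inv (u.erase k) (v.erase k) * binom α β) * this
    · have h1 : ¬ Disjoint (u.erase k) v := fun hd => h' (hd.mono_right (Finset.erase_subset _ _))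
      have h2 : ¬ Disjoint u (v.erase k) := fun hd => h' (hd.mono_left (Finset.erase_subset _ _))
      simp [mulMono_of_not_disjoint, h1, h2]
  · have h1 : Disjoint (u.erase k) v ↔ Disjoint u v := by
      simp only [Finset.disjoint_left]; grind
    by_cases h : Disjoint u v
    · have e : (u ∪ v).erase k = u.erase k ∪ v := by
        ext j; by_cases hj : j = k <;> simp [hj, hv]
      simp only [partialMono, hu, hv, if_true, if_false, mul_mono, mulMono_pair h,
        mulMono_pair (h1.2 h), map_smul, pd_mono, Finset.mem_union, true_or, map_zero, smul_zero,
        add_zero, smul_smul, map_smul, LinearMap.smul_apply, e]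
      congr 1
      rw [inv_erase_left hu, Finset.filter_union,
        Finset.card_union_of_disjoint (Finset.disjoint_filter_filter h)]
      have : ((-1 : F) ^ (v.filter (· < k)).card) * (-1 : F) ^ (v.filter (· < k)).card = 1 := by
        rw [← pow_add, Even.neg_one_pow ⟨_, rfl⟩]
      simp only [pow_add]
      linear_combination ((-1 : F) ^ (u.filter (· < k)).card * (-1) ^ inv (u.erase k) v *
        binom α β) * this
    · simp [partialMono, hu, hv, mulMono_of_not_disjoint, h, h1]
  · have h1 : Disjoint u (v.erase k) ↔ Disjoint u v := by
      simp only [Finset.disjoint_left]; grind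
    by_cases h : Disjoint u v
    · have e : (u ∪ v).erase k = u ∪ v.erase k := by
        ext j; by_cases hj : j = k <;> simp [hj, hu]
      simp only [partialMono, hu, hv, if_true, if_false, mul_mono, mulMono_pair h,
        mulMono_pair (h1.2 h), map_smul, pd_mono, Finset.mem_union, or_true, map_zero,
        zero_add, smul_smul, map_smul, e, LinearMap.zero_apply]
      congr 1
      rw [inv_erase_right hv, Finset.filter_union,
        Finset.card_union_of_disjoint (Finset.disjoint_filter_filter h)]
      have hc : u.card = (u.filter (· < k)).card + (u.filter (k < ·)).card := by
        rw [filter_lt_add_filter_gt, Finset.erase_eq_of_notMem hu]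
      rw [hc]
      simp only [pow_add]
      ring
    · simp [partialMono, hu, hv, mulMono_of_not_disjoint, h, h1]
  · by_cases h : Disjoint u v <;>
      simp [partialMono, hu, hv, mulMono_of_not_disjoint, mulMono_of_disjoint, h]

theorem pd_mul (r : Idx n) (f g : O F n) :
    pd F r (mul F f g) = mul F (pd F r f) g + mul F (twist F r f) (pd F r g) := by
  induction f using mono_induction with
  | hadd f₁ f₂ h₁ h₂ => simp only [map_add, LinearMap.add_apply, h₁, h₂]; abel
  | hsmul c f h => simp only [map_smul, LinearMap.smul_apply, h, smul_add]
  | hmono a =>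
  induction g using mono_induction with
  | hadd f₁ f₂ h₁ h₂ => simp only [map_add, h₁, h₂]; abel
  | hsmul c f h => simp only [map_smul, h, smul_add]
  | hmono b =>
  rcases r with i | k
  · simp [leibMono_inl, mu]
  · simp [leibMono_inr, mu]

theorem pd_comm (r s : Idx n) (f : O F n) :
    pd F r (pd F s f) = ((-1) ^ (mu r * mu s) : F) • pd F s (pd F r f) := by
  induction f using mono_induction with
  | hadd f₁ f₂ h₁ h₂ => simp only [map_add, h₁, h₂, smul_add]
  | hsmul c f h => simp only [map_smul, h, smul_comm c]
  | hmono a =>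
  obtain ⟨α, u⟩ := a
  simp only [pd_mono]
  rcases r with i | k <;> rcases s with j | l
  · by_cases hij : i = j
    · subst hij; simp [mu]
    · have hji : j ≠ i := fun h => hij h.symm
      have e : α - Pi.single i 1 - Pi.single j 1 = α - Pi.single j 1 - Pi.single i 1 := by
        ext m; simp [Nat.sub_right_comm]
      by_cases hi : α i = 0 <;> by_cases hj : α j = 0 <;>
        simp [partialMono, mu, hi, hj, hij, hji, e]
  · by_cases hi : α i = 0 <;> by_cases hl : l ∈ u <;> simp [partialMono, mu, hi, hl]
  · by_cases hi : α j = 0 <;> by_cases hk : k ∈ u <;> simp [partialMono, mu, hi, hk]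
  · by_cases hkl : k = l
    · subst hkl; by_cases hk : k ∈ u <;> simp [partialMono, mu, hk]
    · have hlk : l ≠ k := fun h => hkl h.symm
      by_cases hk : k ∈ u <;> by_cases hl : l ∈ u <;>
        simp [partialMono, mu, hk, hl, hkl, hlk]
      rw [Finset.erase_right_comm, smul_smul, smul_smul, ← neg_smul]
      congr 1
      have key : ∀ a b : Fin n, a < b → a ∈ u →
          (u.filter (· < b)).card = ((u.erase a).filter (· < b)).card + 1 ∧
          ((u.erase b).filter (· < a)) = u.filter (· < a) := by
        intro a b hab ha
        constructor
        · rw [Finset.filter_erase, Finset.card_erase_add_one (by simp [ha, hab])]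
        · ext j; simp; intro h _ hj; subst hj; exact absurd h hab.le.not_gt
      rcases lt_or_gt_of_ne hkl with h | h
      · obtain ⟨e1, e2⟩ := key k l h hk
        rw [e1, e2]; ring
      · obtain ⟨e1, e2⟩ := key l k h hl
        rw [e1, e2]; ring

theorem mem_parityPart_induction {θ : ZMod 2} (P : O F n → Prop) {f : O F n}
    (hf : f ∈ parityPart F θ) (h0 : P 0) (hadd : ∀ f g, P f → P g → P (f + g))
    (hsmul : ∀ (c : F) f, P f → P (c • f))
    (hs : ∀ a : Mono n, (a.2.card : ZMod 2) = θ → P (mono F a)) : P f := by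
  refine Submodule.span_induction (p := fun f _ => P f) ?_ h0 (fun f g _ _ => hadd f g)
    (fun c f _ => hsmul c f) hf
  rintro _ ⟨a, ha, rfl⟩
  exact hs a ha

theorem mono_mem_parityPart {θ : ZMod 2} {a : Mono n} (h : (a.2.card : ZMod 2) = θ) :
    mono F a ∈ parityPart F θ := Submodule.subset_span ⟨a, h, rfl⟩

theorem pd_mem_parityPart {θ : ZMod 2} {f : O F n} (r : Idx n) (hf : f ∈ parityPart F θ) :
    pd F r f ∈ parityPart F (θ + mu r) := by
  refine mem_parityPart_induction (fun f => pd F r f ∈ parityPart F (θ + mu r)) hf (by simp)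
    (fun f g h1 h2 => ?_) (fun c f h => ?_) fun a ha => ?_
  · rw [map_add]; exact add_mem h1 h2
  · rw [map_smul]; exact Submodule.smul_mem _ _ h
  · rw [pd_mono]
    subst ha
    obtain ⟨α, u⟩ := a
    rcases r with i | k <;> simp only [partialMono] <;> split_ifs with h
    · exact zero_mem _
    · exact mono_mem_parityPart (by simp [mu])
    · refine Submodule.smul_mem _ _ (mono_mem_parityPart ?_)
      simp only [mu]
      rw [← Finset.card_erase_add_one h]
      push_cast
      rw [add_assoc]
      exact (add_zero _).symm
    · exact zero_mem _

theorem mul_mem_parityPart {θ η : ZMod 2} {f g : O F n} (hf : f ∈ parityPart F θ)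
    (hg : g ∈ parityPart F η) : mul F f g ∈ parityPart F (θ + η) := by
  refine mem_parityPart_induction (fun f => mul F f g ∈ parityPart F (θ + η)) hf (by simp)
    (fun f g h1 h2 => ?_) (fun c f h => ?_) fun a ha => ?_
  · rw [map_add]; exact add_mem h1 h2
  · rw [map_smul]; exact Submodule.smul_mem _ _ h
  refine mem_parityPart_induction (fun f => mul F (mono F a) f ∈ parityPart F (θ + η)) hg (by simp)
    (fun f g h1 h2 => ?_) (fun c f h => ?_) fun b hb => ?_
  · rw [map_add]; exact add_mem h1 h2
  · rw [map_smul]; exact Submodule.smul_mem _ _ h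
  rw [mul_mono]
  by_cases h : Disjoint a.2 b.2
  · rw [mulMono_of_disjoint h]
    refine Submodule.smul_mem _ _ (mono_mem_parityPart ?_)
    rw [Finset.card_union_of_disjoint h, Nat.cast_add, ha, hb]
  · rw [mulMono_of_not_disjoint h]; exact zero_mem _

theorem neg_one_pow_congr {a b c : ℕ} (h : (a : ZMod 2) = b) : (-1 : F) ^ (c * a) = (-1) ^ (c * b) := by
  rw [mul_comm c, mul_comm c, pow_mul, pow_mul, neg_one_pow_eq_pow_mod_two (n := a),
    neg_one_pow_eq_pow_mod_two (n := b), (ZMod.natCast_eq_natCast_iff' a b 2).1 h]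

theorem twist_of_mem {m : ℕ} {f : O F n} (r : Idx n) (hf : f ∈ parityPart F (m : ZMod 2)) :
    twist F r f = ((-1) ^ (mu r * m) : F) • f := by
  refine mem_parityPart_induction (fun f => twist F r f = ((-1) ^ (mu r * m) : F) • f) hf (by simp)
    (fun f g h1 h2 => ?_) (fun c f h => ?_) fun a ha => ?_
  · rw [map_add, h1, h2, smul_add]
  · rw [map_smul, h, smul_comm]
  · rw [twist_mono, neg_one_pow_congr ha]

theorem mul_twist {r : Idx n} {f : O F n} (hf : f ∈ parityPart F (mu r : ZMod 2)) (g : O F n) :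
    mul F f (twist F r g) = mul F g f := by
  refine mem_parityPart_induction (fun f => mul F f (twist F r g) = mul F g f) hf (by simp)
    (fun f g h1 h2 => ?_) (fun c f h => ?_) fun a ha => ?_
  · simp only [map_add, LinearMap.add_apply, h1, h2]
  · simp only [map_smul, LinearMap.smul_apply, h]
  induction g using mono_induction with
  | hadd f₁ f₂ h₁ h₂ => simp only [map_add, LinearMap.add_apply, h₁, h₂]
  | hsmul c f h => simp only [map_smul, LinearMap.smul_apply, h]
  | hmono b =>
  rw [twist_mono, map_smul, mul_mono, mul_mono, mulMono_comm b a, mul_comm (mu r),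
    neg_one_pow_congr ha]

theorem mul_comm_of_mem {r s : Idx n} {f g : O F n} (hf : f ∈ parityPart F (mu r : ZMod 2))
    (hg : g ∈ parityPart F (mu s : ZMod 2)) :
    mul F g f = ((-1) ^ (mu r * mu s) : F) • mul F f g := by
  rw [← mul_twist hf, twist_of_mem r hg, map_smul]

theorem vectorField_apply (f : Idx n → O F n) (g : O F n) :
    vectorField F f g = ∑ r, mul F (f r) (pd F r g) := by
  simp [vectorField, LinearMap.sum_apply]

theorem vectorField_mul {f : Idx n → O F n} (hf : ∀ r, f r ∈ parityPart F (mu r : ZMod 2))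
    (g h : O F n) : vectorField F f (mul F g h) =
      mul F (vectorField F f g) h + mul F g (vectorField F f h) := by
  simp only [vectorField_apply, map_sum, LinearMap.sum_apply, ← Finset.sum_add_distrib]
  refine Finset.sum_congr rfl fun r _ => ?_
  rw [pd_mul, map_add, mul_assoc', ← mul_assoc' (f r) (twist F r g), mul_twist (hf r),
    mul_assoc']

theorem lie_vectorField {f g : Idx n → O F n} (hf : ∀ r, f r ∈ parityPart F (mu r : ZMod 2))
    (hg : ∀ r, g r ∈ parityPart F (mu r : ZMod 2)) :
    ⁅vectorField F f, vectorField F g⁆ =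
      vectorField F fun s => vectorField F f (g s) - vectorField F g (f s) := by
  refine LinearMap.ext fun h => ?_
  rw [LieRing.of_associative_ring_bracket, LinearMap.sub_apply, Module.End.mul_apply,
    Module.End.mul_apply, vectorField_apply g h, vectorField_apply f h, vectorField_apply _ h]
  simp only [map_sum, vectorField_mul hf, vectorField_mul hg, map_sub, LinearMap.sub_apply,
    Finset.sum_add_distrib, Finset.sum_sub_distrib]
  have : ∑ s, mul F (g s) (vectorField F f (pd F s h)) =
      ∑ r, mul F (f r) (vectorField F g (pd F r h)) := by
    simp only [vectorField_apply, map_sum]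
    rw [Finset.sum_comm]
    refine Finset.sum_congr rfl fun r _ => Finset.sum_congr rfl fun s _ => ?_
    rw [← mul_assoc', ← mul_assoc', mul_comm_of_mem (hf r) (hg s), pd_comm r s, map_smul,
      map_smul, LinearMap.smul_apply, smul_smul, ← pow_add, Even.neg_one_pow ⟨_, rfl⟩, one_smul]
  rw [this]
  abel

/-- The variables `x_r`, `r ∈ Y`. -/
def gen : Idx n → Mono n
  | Sum.inl i => (Pi.single i 1, ∅)
  | Sum.inr k => (0, {k})

theorem mul_one' (f : O F n) : mul F f (mono F (0, ∅)) = f := by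
  induction f using mono_induction with
  | hadd f₁ f₂ h₁ h₂ => simp only [map_add, LinearMap.add_apply, h₁, h₂]
  | hsmul c f h => simp only [map_smul, LinearMap.smul_apply, h]
  | hmono a => simp [mulMono_of_disjoint, inv, binom]

theorem one_mul' (f : O F n) : mul F (mono F (0, ∅)) f = f := by
  induction f using mono_induction with
  | hadd f₁ f₂ h₁ h₂ => simp only [map_add, h₁, h₂]
  | hsmul c f h => simp only [map_smul, h]
  | hmono a => simp [mulMono_of_disjoint, inv, binom]

theorem pd_gen (r s : Idx n) : pd F r (mono F (gen s)) =
    if r = s then mono F (0, ∅) else 0 := by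
  rw [pd_mono]
  rcases r with i | k <;> rcases s with j | l
  · by_cases h : i = j
    · subst h; simp [gen, partialMono]
    · simp [gen, partialMono, h]
  · simp [gen, partialMono]
  · simp [gen, partialMono]
  · by_cases h : k = l
    · subst h; simp [gen, partialMono, Finset.filter_singleton]
    · simp [gen, partialMono, h]

theorem vectorField_gen (f : Idx n → O F n) (r : Idx n) :
    vectorField F f (mono F (gen r)) = f r := by
  rw [vectorField_apply, Finset.sum_eq_single r]
  · rw [pd_gen, if_pos rfl, mul_one']
  · intro s _ hs; rw [pd_gen, if_neg hs, map_zero]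
  · simp

theorem vectorField_injective : Function.Injective (vectorField F (n := n)) := by
  intro f g h
  funext r
  rw [← vectorField_gen f, h, vectorField_gen]

theorem TH_eq {m : ℕ} {a : O F n} (ha : a ∈ parityPart F (m : ZMod 2)) :
    TH F a = vectorField F fun r => ((-1) ^ (mu (prime r) * m) : F) • pd F (prime r) a := by
  simp only [TH, LinearMap.comp_apply]
  congr 1
  funext r
  simp [twist_of_mem _ ha]

theorem mu_prime (r : Idx n) : mu (prime r) = 1 - mu r := by
  rcases r with i | k <;> simp [mu]

theorem mu_prime_add (r : Idx n) : (mu (prime r) : ZMod 2) = 1 + mu r := by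
  rcases r with i | k <;> simp [mu]; rfl

theorem TH_coeff_mem {θ : ZMod 2} {a : O F n} (ha : a ∈ parityPart F θ) (c : F) (r : Idx n) :
    c • pd F (prime r) a ∈ parityPart F (θ + 1 + mu r) := by
  have := pd_mem_parityPart (prime r) ha
  rw [mu_prime_add, ← add_assoc] at this
  exact Submodule.smul_mem _ _ this

theorem lie_TH {a b : O F n} (ha : a ∈ parityPart F 1) (hb : b ∈ parityPart F 1) :
    ⁅TH F a, TH F b⁆ = TH F (TH F a b) := by
  have ha' : a ∈ parityPart F ((1 : ℕ) : ZMod 2) := by simpa using ha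
  have hb' : b ∈ parityPart F ((1 : ℕ) : ZMod 2) := by simpa using hb
  have h2 : ∀ x : ZMod 2, 1 + 1 + x = x := by decide
  have hfa := fun r => h2 (mu r) ▸ TH_coeff_mem ha ((-1) ^ (mu (prime r) * 1)) r
  have hfb := fun r => h2 (mu r) ▸ TH_coeff_mem hb ((-1) ^ (mu (prime r) * 1)) r
  have hc : TH F a b ∈ parityPart F ((1 : ℕ) : ZMod 2) := by
    rw [TH_eq ha', vectorField_apply]
    refine sum_mem fun r _ => ?_
    have := mul_mem_parityPart (hfa r) (pd_mem_parityPart r hb)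
    have e : (mu r : ZMod 2) + (1 + mu r) = ((1 : ℕ) : ZMod 2) := by
      generalize (mu r : ZMod 2) = x
      revert x; decide
    rwa [e] at this
  rw [TH_eq hc, TH_eq ha', TH_eq hb', lie_vectorField hfa hfb]
  congr 1
  funext s
  generalize hj : prime s = j
  simp only [map_smul, ← smul_sub]
  congr 1
  simp only [vectorField_apply, map_sum]
  rw [← Equiv.sum_comp (Equiv.sumComm (Fin n) (Fin n)) 
    (fun x => mul F ((-1) ^ (mu (prime x) * 1) • pd F (prime x) b) (pd F x (pd F j a))),
    ← Finset.sum_sub_distrib]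
  refine Finset.sum_congr rfl fun r _ => ?_
  have e0 : (Equiv.sumComm (Fin n) (Fin n)) r = prime r := rfl
  have e1 : prime (prime r) = r := Sum.swap_swap r
  rw [e0, e1]
  have hA : pd F (prime r) a ∈ parityPart F (mu r : ZMod 2) := by
    simpa [h2] using TH_coeff_mem ha (1 : F) r
  have hB : pd F r b ∈ parityPart F (mu (prime r) : ZMod 2) := by
    rw [mu_prime_add]; exact pd_mem_parityPart r hb
  have hA' : pd F j (pd F (prime r) a) ∈ parityPart F ((mu r + mu j : ℕ) : ZMod 2) := by
    rw [Nat.cast_add]; exact pd_mem_parityPart j hA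
  have h3 : mul F (pd F j (pd F (prime r) a)) (pd F r b) =
      mul F (pd F r b) (pd F (prime r) (pd F j a)) := by
    rw [← mul_twist hB, twist_of_mem _ hA', pd_comm j (prime r), smul_smul, ← pow_add]
    rw [Even.neg_one_pow, one_smul]
    rcases r with i | k <;> rcases j with i | k <;> simp [mu]
  have h4 : mul F (twist F j (pd F (prime r) a)) (pd F j (pd F r b)) =
      mul F (pd F (prime r) a) (pd F r (pd F j b)) := by
    rw [twist_of_mem _ hA, pd_comm j r, map_smul, map_smul, LinearMap.smul_apply, smul_smul,
      ← pow_add, Even.neg_one_pow ⟨_, rfl⟩, one_smul]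
  simp only [map_smul, LinearMap.smul_apply, pd_mul, h3, h4]
  rcases r with i | k <;> simp [mu] <;> abel

theorem mono_mem_trunc {p : ℕ} {t : Fin n → ℕ} {a : Mono n} (h : ∀ i, a.1 i ≤ p ^ t i - 1) :
    mono F a ∈ trunc F p t := Submodule.subset_span ⟨a, h, rfl⟩

theorem mem_trunc_induction {p : ℕ} {t : Fin n → ℕ} (P : O F n → Prop) {f : O F n}
    (hf : f ∈ trunc F p t) (h0 : P 0) (hadd : ∀ f g, P f → P g → P (f + g))
    (hsmul : ∀ (c : F) f, P f → P (c • f))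
    (hs : ∀ a : Mono n, (∀ i, a.1 i ≤ p ^ t i - 1) → P (mono F a)) : P f := by
  refine Submodule.span_induction (p := fun f _ => P f) ?_ h0 (fun f g _ _ => hadd f g)
    (fun c f _ => hsmul c f) hf
  rintro _ ⟨a, ha, rfl⟩
  exact hs a ha

theorem pd_mem_trunc {p : ℕ} {t : Fin n → ℕ} {f : O F n} (r : Idx n) (hf : f ∈ trunc F p t) :
    pd F r f ∈ trunc F p t := by
  refine mem_trunc_induction (fun f => pd F r f ∈ trunc F p t) hf (by simp)
    (fun f g h1 h2 => ?_) (fun c f h => ?_) fun a ha => ?_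
  · rw [map_add]; exact add_mem h1 h2
  · rw [map_smul]; exact Submodule.smul_mem _ _ h
  · rw [pd_mono]
    obtain ⟨α, u⟩ := a
    rcases r with i | k <;> simp only [partialMono] <;> split_ifs with h
    · exact zero_mem _
    · exact mono_mem_trunc (fun j => (Nat.sub_le _ _).trans (ha j))
    · exact Submodule.smul_mem _ _ (mono_mem_trunc ha)
    · exact zero_mem _

theorem choose_cast_eq_zero (p : ℕ) [Fact p.Prime] [CharP F p] {t a b : ℕ}
    (ha : a ≤ p ^ t - 1) (hb : b ≤ p ^ t - 1) (h : ¬ a + b ≤ p ^ t - 1) :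
    ((a + b).choose a : F) = 0 := by
  have hp : 0 < p ^ t := pow_pos (Fact.out : p.Prime).pos t
  obtain ⟨c, hc⟩ : ∃ c, a + b = p ^ t + c := ⟨a + b - p ^ t, by omega⟩
  rw [← Polynomial.coeff_X_add_one_pow, hc, pow_add, add_pow_char_pow, one_pow, add_mul, one_mul,
    Polynomial.coeff_add, Polynomial.coeff_X_pow_mul', if_neg (by omega),
    Polynomial.coeff_X_add_one_pow, Nat.choose_eq_zero_of_lt (by omega)]
  simp

theorem mul_mem_trunc {p : ℕ} [Fact p.Prime] [CharP F p] {t : Fin n → ℕ} {f g : O F n}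
    (hf : f ∈ trunc F p t) (hg : g ∈ trunc F p t) : mul F f g ∈ trunc F p t := by
  refine mem_trunc_induction (fun f => mul F f g ∈ trunc F p t) hf (by simp)
    (fun f g h1 h2 => ?_) (fun c f h => ?_) fun a ha => ?_
  · rw [map_add]; exact add_mem h1 h2
  · rw [map_smul]; exact Submodule.smul_mem _ _ h
  refine mem_trunc_induction (fun f => mul F (mono F a) f ∈ trunc F p t) hg (by simp)
    (fun f g h1 h2 => ?_) (fun c f h => ?_) fun b hb => ?_
  · rw [map_add]; exact add_mem h1 h2
  · rw [map_smul]; exact Submodule.smul_mem _ _ h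
  rw [mul_mono]
  by_cases h : Disjoint a.2 b.2
  · rw [mulMono_of_disjoint h]
    by_cases hab : ∀ i, a.1 i + b.1 i ≤ p ^ t i - 1
    · exact Submodule.smul_mem _ _ (mono_mem_trunc hab)
    · push Not at hab
      obtain ⟨i, hi⟩ := hab
      have : (binom a.1 b.1 : F) = 0 := by
        rw [binom, Nat.cast_prod]
        exact Finset.prod_eq_zero (Finset.mem_univ i)
          (choose_cast_eq_zero p (ha i) (hb i) hi.not_ge)
      simp [this]
  · rw [mulMono_of_not_disjoint h]; exact zero_mem _

theorem vectorField_mem_trunc {p : ℕ} [Fact p.Prime] [CharP F p] {t : Fin n → ℕ}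
    {f : Idx n → O F n} {g : O F n} (hf : ∀ r, f r ∈ trunc F p t) (hg : g ∈ trunc F p t) :
    vectorField F f g ∈ trunc F p t := by
  rw [vectorField_apply]
  exact sum_mem fun r _ => mul_mem_trunc (hf r) (pd_mem_trunc r hg)

theorem mem_wittPart {p : ℕ} {t : Fin n → ℕ} {θ : ZMod 2} {D : Module.End F (O F n)} :
    D ∈ wittPart F p t θ ↔ ∃ f : Idx n → O F n,
      (∀ r, f r ∈ trunc F p t ∧ f r ∈ parityPart F (θ + mu r)) ∧ vectorField F f = D := by
  simp [wittPart, Submodule.mem_pi]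

theorem lie_mem_wittPart {p : ℕ} [Fact p.Prime] [CharP F p] {t : Fin n → ℕ}
    {D E : Module.End F (O F n)} (hD : D ∈ wittPart F p t 0) (hE : E ∈ wittPart F p t 0) :
    ⁅D, E⁆ ∈ wittPart F p t 0 := by
  obtain ⟨f, hf, rfl⟩ := mem_wittPart.1 hD
  obtain ⟨g, hg, rfl⟩ := mem_wittPart.1 hE
  simp only [zero_add] at hf hg
  rw [lie_vectorField (fun r => (hf r).2) fun r => (hg r).2]
  have key : ∀ f g : Idx n → O F n, (∀ r, f r ∈ parityPart F (mu r : ZMod 2)) →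
      (∀ r, g r ∈ parityPart F (mu r : ZMod 2)) → ∀ s,
      vectorField F f (g s) ∈ parityPart F (mu s : ZMod 2) := by
    intro f g hf hg s
    rw [vectorField_apply]
    refine sum_mem fun r _ => ?_
    have := mul_mem_parityPart (hf r) (pd_mem_parityPart r (hg s))
    have e : ∀ x y : ZMod 2, x + (y + x) = y := by decide
    rwa [e] at this
  refine mem_wittPart.2 ⟨_, fun s => ⟨?_, ?_⟩, rfl⟩
  · exact sub_mem (vectorField_mem_trunc (fun r => (hf r).1) (hg s).1)
      (vectorField_mem_trunc (fun r => (hg r).1) (hf s).1)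
  · rw [zero_add]
    exact sub_mem (key f g (fun r => (hf r).2) (fun r => (hg r).2) s)
      (key g f (fun r => (hg r).2) (fun r => (hf r).2) s)

theorem TH_mem_wittPart {p : ℕ} {t : Fin n → ℕ} {θ : ZMod 2} {a : O F n}
    (ht : a ∈ trunc F p t) (ha : a ∈ parityPart F θ) : TH F a ∈ wittPart F p t (θ + 1) := by
  have ha' : a ∈ parityPart F ((θ.val : ℕ) : ZMod 2) := by simpa using ha
  rw [TH_eq ha']
  exact mem_wittPart.2 ⟨_, fun r => ⟨Submodule.smul_mem _ _ (pd_mem_trunc _ ht),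
    TH_coeff_mem ha _ r⟩, rfl⟩

theorem wittPart_disjoint {p : ℕ} {t : Fin n → ℕ} {D : Module.End F (O F n)}
    (h0 : D ∈ wittPart F p t 0) (h1 : D ∈ wittPart F p t 1) : D = 0 := by
  obtain ⟨f, hf, rfl⟩ := mem_wittPart.1 h0
  obtain ⟨g, hg, e⟩ := mem_wittPart.1 h1
  rw [← vectorField_injective e.symm] at hg
  have : f = 0 := by
    funext r
    refine Submodule.disjoint_def.1 ((monoBasis F n).linearIndependent.disjoint_span_image
      (Set.disjoint_left.2 fun a ha hb => ?_)) _ (hf r).2 (hg r).2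
    have h2 := ha.symm.trans hb
    generalize (mu r : ZMod 2) = x at h2
    revert x; decide
  rw [this, map_zero]

theorem exists_parity {p : ℕ} {t : Fin n → ℕ} {a : O F n} (h : a ∈ trunc F p t) :
    ∃ b c : O F n, a = b + c ∧ b ∈ trunc F p t ∧ c ∈ trunc F p t ∧
      b ∈ parityPart F 0 ∧ c ∈ parityPart F 1 := by
  refine mem_trunc_induction (fun a => ∃ b c : O F n, a = b + c ∧ b ∈ trunc F p t ∧
    c ∈ trunc F p t ∧ b ∈ parityPart F 0 ∧ c ∈ parityPart F 1) h ?_ ?_ ?_ ?_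
  · exact ⟨0, 0, by simp, zero_mem _, zero_mem _, zero_mem _, zero_mem _⟩
  · rintro _ _ ⟨b, c, rfl, h1, h2, h3, h4⟩ ⟨b', c', rfl, h1', h2', h3', h4'⟩
    exact ⟨b + b', c + c', by abel, add_mem h1 h1', add_mem h2 h2', add_mem h3 h3', add_mem h4 h4'⟩
  · rintro x _ ⟨b, c, rfl, h1, h2, h3, h4⟩
    exact ⟨x • b, x • c, smul_add _ _ _, Submodule.smul_mem _ _ h1, Submodule.smul_mem _ _ h2,
      Submodule.smul_mem _ _ h3, Submodule.smul_mem _ _ h4⟩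
  · intro m hm
    have : ∀ x : ZMod 2, x = 0 ∨ x = 1 := by decide
    rcases this (m.2.card : ZMod 2) with h | h
    · exact ⟨_, 0, (add_zero _).symm, mono_mem_trunc hm, zero_mem _, mono_mem_parityPart h,
        zero_mem _⟩
    · exact ⟨0, _, (zero_add _).symm, zero_mem _, mono_mem_trunc hm, zero_mem _,
        mono_mem_parityPart h⟩

theorem exists_odd_of_mem {p : ℕ} {t : Fin n → ℕ} {D : Module.End F (O F n)}
    (h : D ∈ hoSuper F p t) (h0 : D ∈ wittPart F p t 0) :
    ∃ a ∈ trunc F p t, a ∈ parityPart F 1 ∧ TH F a = D := by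
  obtain ⟨a, ha, rfl⟩ := h
  obtain ⟨b, c, rfl, hb, hc, hb', hc'⟩ := exists_parity ha
  refine ⟨c, hc, hc', ?_⟩
  have h1 := TH_mem_wittPart hc hc'
  have h2 := TH_mem_wittPart hb hb'
  rw [map_add] at h0 ⊢
  have h4 : TH F b ∈ wittPart F p t 0 := (Submodule.add_mem_iff_left _ h1).1 h0
  rw [wittPart_disjoint h4 (by simpa using h2), zero_add]

theorem lie_mem_hoSuper {p : ℕ} [Fact p.Prime] [CharP F p] {t : Fin n → ℕ}
    {D E : Module.End F (O F n)} (hD : D ∈ hoSuper F p t) (hD0 : D ∈ wittPart F p t 0)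
    (hE : E ∈ hoSuper F p t) (hE0 : E ∈ wittPart F p t 0) : ⁅D, E⁆ ∈ hoSuper F p t := by
  obtain ⟨a, ha, ha1, rfl⟩ := exists_odd_of_mem hD hD0
  obtain ⟨b, hb, hb1, rfl⟩ := exists_odd_of_mem hE hE0
  rw [lie_TH ha1 hb1]
  refine ⟨_, ?_, rfl⟩
  obtain ⟨f, hf, e⟩ := mem_wittPart.1 (TH_mem_wittPart ha ha1)
  rw [← e]
  exact vectorField_mem_trunc (fun r => (hf r).1) hb

theorem pd_mem_wittPart (p : ℕ) (t : Fin n → ℕ) (i : Fin n) :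
    pd F (Sum.inl i) ∈ wittPart F p t 0 := by
  refine mem_wittPart.2 ⟨Pi.single (Sum.inl i) (mono F (0, ∅)), fun r => ?_, ?_⟩
  · by_cases h : r = Sum.inl i
    · subst h
      rw [Pi.single_eq_same]
      exact ⟨mono_mem_trunc (fun j => Nat.zero_le _), mono_mem_parityPart (by simp [mu])⟩
    · rw [Pi.single_eq_of_ne h]
      exact ⟨zero_mem _, zero_mem _⟩
  · refine LinearMap.ext fun g => ?_
    rw [vectorField_apply, Finset.sum_eq_single (Sum.inl i)]
    · rw [Pi.single_eq_same, one_mul']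
    · intro s _ hs; rw [Pi.single_eq_of_ne hs]; simp
    · simp

end

/-- The Lie algebra `𝒲`, the even part of `W(n,n;t)`; on even operators the superbracket is the
commutator. -/
noncomputable def W (p : ℕ) [Fact p.Prime] [CharP F p] (t : Fin n → ℕ) :
    LieSubalgebra F (Module.End F (O F n)) where
  toSubmodule := wittPart F p t 0
  lie_mem' := lie_mem_wittPart

/-- The Lie algebra `ℋ𝒪`, the even part of `HO(n,n;t)`, as a subalgebra of `𝒲`. -/
noncomputable def HO (p : ℕ) [Fact p.Prime] [CharP F p] (t : Fin n → ℕ) : LieSubalgebra F (W F p t) where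
  toSubmodule := (hoSuper F p t).comap (W F p t).toSubmodule.subtype
  lie_mem' := fun {D E} hD hE => lie_mem_hoSuper hD D.2 hE E.2

/-- `∂_i`, `i ∈ Y₀`, as an element of `𝒲`. -/
noncomputable def partialW (p : ℕ) [Fact p.Prime] [CharP F p] (t : Fin n → ℕ) (i : Fin n) :
    W F p t :=
  ⟨pd F (Sum.inl i), pd_mem_wittPart p t i⟩

/-- The derivation space `Der(L, M)` of a Lie algebra `L` into an `L`-module `M`, as a subspace of
`Hom(L, M)`. -/
def derSpace (R L M : Type*) [CommRing R] [LieRing L] [LieAlgebra R L] [AddCommGroup M]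
    [Module R M] [LieRingModule L M] [LieModule R L M] : Submodule R (L →ₗ[R] M) where
  carrier := Set.range fun D : LieDerivation R L M => (D : L →ₗ[R] M)
  zero_mem' := ⟨0, rfl⟩
  add_mem' := by rintro _ _ ⟨D, rfl⟩ ⟨E, rfl⟩; exact ⟨D + E, rfl⟩
  smul_mem' := by rintro c _ ⟨D, rfl⟩; exact ⟨c • D, rfl⟩

/-- The restriction to a subalgebra `H` of a linear endomorphism of the Lie algebra `L`. -/
def restrictTo {R L : Type*} [CommRing R] [LieRing L] [LieAlgebra R L] (H : LieSubalgebra R L) :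
    Module.End R L →ₗ[R] (H →ₗ[R] L) :=
  LinearMap.lcomp R L H.toSubmodule.subtype

/-- The space `ad L` of the maps `ad w : H → L`, `x ↦ ⁅w, x⁆`, with `w ∈ L`. -/
def adSpace {R L : Type*} [CommRing R] [LieRing L] [LieAlgebra R L] (H : LieSubalgebra R L) :
    Submodule R (H →ₗ[R] L) :=
  LinearMap.range (restrictTo H ∘ₗ (LieAlgebra.ad R L : L →ₗ[R] Module.End R L))

end OddHamiltonian

/-!
An odd function `a` is identified with the even field `T_H(a)`, so a derivation of `ℋ𝒪` into `𝒲`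
becomes a linear map `D` on odd functions that takes the odd Poisson bracket to the commutator of
fields. Subtracting derivations of the listed types normalizes `D` in stages. Its values on the
`x_{i'}` are the partial derivatives of a single field by the divided power Poincaré lemma, so an
inner derivation kills them. The weights of the torus spanned by the `T_H(x_i x_{i'})`, together
with Euler fields in the odd variables, then allow inner derivations to kill the `x_i x_{j'}` and
the cubic monomials `x^u`, and a combination of the `(ad ∂_i)^{p^k}` accounts for what remains on
the elements `x_i^{(p^k)} x_{i'}`.

A normalized derivation vanishes by induction on the degree: a monomial of higher degree is a
bracket of monomials of lower degree, unless its coefficient there vanishes modulo `p`, and in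
those cases the torus weights leave no room for a nonzero image. Finally, the field of the inner
derivation found in this way is truncated at `t`, because `(ad ∂_j)^{p^{t_j}}` maps it to a field
that centralizes `ℋ𝒪`, hence to zero.
-/

namespace OddHamiltonian
attribute [local instance] LieRing.ofAssociativeRing
variable {F : Type*} [Field F] {n : ℕ}

theorem eq_of_intCast_eq {R : Type*} [AddGroupWithOne R] {p : ℕ} [CharP R p] {x y : ℤ}
    (h : (x : R) = y) (hxy : |x - y| < p) : x = y :=
  sub_eq_zero.1 <| Int.eq_zero_of_abs_lt_dvd
    ((CharP.intCast_eq_intCast R p).1 h).symm.dvd hxy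

theorem two_ne_zero_of_three_lt {R : Type*} [NonAssocSemiring R] [Nontrivial R] {p : ℕ} [CharP R p]
    (hp : 3 < p) : (2 : R) ≠ 0 :=
  Ring.two_ne_zero (by rw [ringChar.eq R p]; omega)

theorem two_mul_cast_choose_two {R : Type*} [CommRing R] (a : ℕ) :
    2 * (a.choose 2 : R) = a * (a - 1) := by
  induction a with
  | zero => simp
  | succ a ih =>
    rw [Nat.choose_succ_succ' a 1, Nat.choose_one_right]
    push_cast
    linear_combination ih

theorem exists_not_dvd_choose {p a : ℕ} [Fact p.Prime] (ha : a ≠ 0) (hpow : ∀ k, a ≠ p ^ k) :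
    ∃ b, 0 < b ∧ b < a ∧ ¬ p ∣ a.choose b ∧ (p ∣ a → p ∣ b) := by
  have hp : p.Prime := Fact.out
  obtain ⟨k, m, hm, rfl⟩ := Nat.exists_eq_pow_mul_and_not_dvd ha p hp.ne_one
  have hm₂ : 2 ≤ m := by
    have hm₀ : m ≠ 0 := by rintro rfl; simp at hm
    have hm₁ : m ≠ 1 := by rintro rfl; exact hpow k (mul_one _)
    lia
  have hk : 0 < p ^ k := pow_pos hp.pos k
  refine ⟨p ^ k, hk, by nlinarith, fun hdvd => hm ?_, fun hdvd => ?_⟩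
  · have hmod : (p ^ k * m).choose (p ^ k * 1) ≡ m.choose 1 [MOD p] :=
      Choose.choose_pow_mul_pow_mul_modEq_choose_nat
    rw [mul_one, Nat.choose_one_right] at hmod
    exact (hmod.dvd_iff dvd_rfl).1 hdvd
  · exact (hp.dvd_mul.1 hdvd).resolve_right hm

theorem iterate_prime_pow_apply_lie {R L : Type*} [CommRing R] [LieRing L] [LieAlgebra R L]
    (p : ℕ) [Fact p.Prime] [CharP R p] (D : LieDerivation R L L) (k : ℕ) (x y : L) :
    D^[p ^ k] ⁅x, y⁆ = ⁅D^[p ^ k] x, y⁆ + ⁅x, D^[p ^ k] y⁆ := by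
  have hp : p.Prime := Fact.out
  rw [D.iterate_apply_lie, Finset.sum_eq_add_of_mem (p ^ k, 0) (0, p ^ k) (by simp) (by simp)
    (by simp [hp.ne_zero])]
  · simp
  · rintro ⟨i, j⟩ hij hne
    replace hij : i + j = p ^ k := Finset.HasAntidiagonal.mem_antidiagonal.1 hij
    have hdvd : p ∣ (p ^ k).choose i := by
      refine hp.dvd_choose_pow ?_ ?_ <;> rintro rfl <;> grind
    rw [← Nat.cast_smul_eq_nsmul R, (CharP.cast_eq_zero_iff R p _).2 hdvd, zero_smul]

theorem exchange_induction {ι : Type*} [DecidableEq ι] {P : Finset ι → Prop} {u₀ : Finset ι}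
    (base : P u₀)
    (step : ∀ u, u.card = u₀.card → ∀ r ∈ u, ∀ s ∉ u, P u → P (insert s (u.erase r)))
    (u : Finset ι) (hu : u.card = u₀.card) : P u := by
  induction hm : (u \ u₀).card generalizing u with
  | zero =>
    rw [Finset.card_eq_zero, Finset.sdiff_eq_empty_iff_subset] at hm
    rwa [Finset.eq_of_subset_of_card_le hm hu.ge]
  | succ m ih =>
    obtain ⟨r, hr⟩ : (u \ u₀).Nonempty := by rw [← Finset.card_pos]; lia
    obtain ⟨s, hs⟩ : (u₀ \ u).Nonempty := by
      rw [← Finset.card_pos, Finset.card_sdiff_comm hu.symm]; lia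
    have hr' := Finset.mem_sdiff.1 hr
    have hs' := Finset.mem_sdiff.1 hs
    have hcard : (insert s (u.erase r)).card = u₀.card := by
      rw [Finset.card_insert_of_notMem (by simp [hs'.2]), Finset.card_erase_add_one hr'.1, hu]
    have hsdiff : insert s (u.erase r) \ u₀ = (u \ u₀).erase r := by
      clear ih step; grind
    have hswap : insert r ((insert s (u.erase r)).erase s) = u := by
      rw [Finset.erase_insert (by simp [hs'.2]), Finset.insert_erase hr'.1]
    rw [← hswap]
    refine step _ hcard s (by simp) r (by clear ih step; grind) (ih _ hcard ?_)
    rw [hsdiff, Finset.card_erase_of_mem hr, hm, Nat.add_sub_cancel]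

theorem exists_common_primitive {R M ι : Type*} [Ring R] [AddCommGroup M] [Module R M]
    {d σ : ι → Module.End R M} (hd : ∀ i j x, d i (d j x) = d j (d i x))
    (hσ : ∀ i x, d i (σ i x) = x) (hdσ : ∀ i j x, i ≠ j → d i (σ j x) = σ j (d i x))
    {S : Submodule R M} (hdS : ∀ i, ∀ x ∈ S, d i x ∈ S) (hσS : ∀ i, ∀ x ∈ S, σ i x ∈ S)
    {f : ι → M} (hf : ∀ i, f i ∈ S) (hclosed : ∀ i j, d i (f j) = d j (f i)) (s : Finset ι) :
    ∃ g ∈ S, ∀ i ∈ s, d i g = f i := by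
  classical
  induction s using Finset.induction_on with
  | empty => exact ⟨0, zero_mem S, by simp⟩
  | insert j s hj ih =>
    obtain ⟨g, hg, hgf⟩ := ih
    refine ⟨g + σ j (f j - d j g), add_mem hg (hσS j _ (sub_mem (hf j) (hdS j g hg))), ?_⟩
    intro i hi
    rcases eq_or_ne i j with rfl | hij
    · rw [map_add, hσ, add_sub_cancel]
    · have hi' := hgf i (Finset.mem_of_mem_insert_of_ne hi hij)
      rw [map_add, hdσ i j _ hij, map_sub, hclosed, hd, hi', sub_self, map_zero, add_zero]

/-! ### Coefficients -/

/-- The coefficient of the monomial `a`. -/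
noncomputable def coeff (a : Mono n) : O F n →ₗ[F] F := (monoBasis F n).coord a

theorem coeff_mono (a b : Mono n) : coeff a (mono F b) = if b = a then 1 else 0 := by
  classical
  simp [coeff, mono, Finsupp.single_apply]

theorem coeff_ext {f g : O F n} (h : ∀ a, coeff a f = coeff a g) : f = g :=
  (monoBasis F n).ext_elem h

theorem eq_coeff_smul_mono {f : O F n} {a : Mono n} (h : ∀ b, coeff b f ≠ 0 → b = a) :
    f = coeff a f • mono F a := by
  refine coeff_ext fun b => ?_
  rw [map_smul, coeff_mono, smul_eq_mul]
  split_ifs with hb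
  · rw [hb, mul_one]
  · rw [mul_zero]
    exact not_not.1 fun hne => hb (h b hne).symm

theorem mem_span_mono_iff {S : Set (Mono n)} {f : O F n} :
    f ∈ Submodule.span F (mono F '' S) ↔ ∀ a, coeff a f ≠ 0 → a ∈ S := by
  change f ∈ Submodule.span F (monoBasis F n '' S) ↔ _
  rw [Module.Basis.mem_span_image]
  exact ⟨fun h a ha => h (Finsupp.mem_support_iff.2 ha),
    fun h a ha => h a (Finsupp.mem_support_iff.1 ha)⟩

theorem mem_parityPart_iff {θ : ZMod 2} {f : O F n} :
    f ∈ parityPart F θ ↔ ∀ a, coeff a f ≠ 0 → (a.2.card : ZMod 2) = θ := mem_span_mono_iff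

theorem mem_trunc_iff {p : ℕ} {t : Fin n → ℕ} {f : O F n} :
    f ∈ trunc F p t ↔ ∀ a, coeff a f ≠ 0 → ∀ i, a.1 i ≤ p ^ t i - 1 := mem_span_mono_iff

theorem exists_eq_add_single {α : Fin n → ℕ} {i : Fin n} {c : ℕ} (h : c ≤ α i) :
    ∃ β : Fin n → ℕ, α = β + Pi.single i c := by
  obtain ⟨β, hβ⟩ := exists_add_of_le (a := Pi.single i c) (b := α) fun j => by
    obtain rfl | hj := eq_or_ne j i
    · simpa
    · simp [hj]
  exact ⟨β, hβ.trans (add_comm _ _)⟩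

theorem pd_inl_mono_of_apply_eq_zero {i : Fin n} {α : Fin n → ℕ} (h : α i = 0)
    (u : Finset (Fin n)) : pd F (Sum.inl i) (mono F (α, u)) = 0 := by
  rw [pd_mono]
  exact if_pos h

theorem pd_inl_mono_add_single (i : Fin n) (α : Fin n → ℕ) (c : ℕ) (u : Finset (Fin n)) :
    pd F (Sum.inl i) (mono F (α + Pi.single i (c + 1), u)) =
      mono F (α + Pi.single i c, u) := by
  rw [pd_mono]
  refine (if_neg (by simp)).trans ?_
  simp only [Pi.single_add, ← add_assoc, add_tsub_cancel_right]

theorem pd_inl_mono_add_single_one (i : Fin n) (α : Fin n → ℕ) (u : Finset (Fin n)) :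
    pd F (Sum.inl i) (mono F (α + Pi.single i 1, u)) = mono F (α, u) := by
  simpa using pd_inl_mono_add_single (F := F) i α 0 u

theorem coeff_pd_inl (i : Fin n) (α : Fin n → ℕ) (u : Finset (Fin n)) (f : O F n) :
    coeff (α, u) (pd F (Sum.inl i) f) = coeff (α + Pi.single i 1, u) f := by
  induction f using mono_induction with
  | hadd f g hf hg => simp only [map_add, hf, hg]
  | hsmul c f h => simp only [map_smul, h]
  | hmono a =>
    obtain ⟨β, v⟩ := a
    obtain hβ | hβ := Nat.eq_zero_or_pos (β i)
    · rw [pd_inl_mono_of_apply_eq_zero hβ, map_zero, coeff_mono, if_neg]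
      rintro ⟨⟩
      simp at hβ
    · obtain ⟨γ, rfl⟩ := exists_eq_add_single (c := 1) hβ
      simp only [pd_inl_mono_add_single_one, coeff_mono, Prod.mk.injEq, add_left_inj]

theorem coeff_pd_inl_pow (i : Fin n) (k : ℕ) (α : Fin n → ℕ) (u : Finset (Fin n)) (f : O F n) :
    coeff (α, u) ((pd F (Sum.inl i) ^ k) f) = coeff (α + Pi.single i k, u) f := by
  induction k generalizing f with
  | zero => simp
  | succ k ih => rw [pow_succ, Module.End.mul_apply, ih, coeff_pd_inl, add_assoc, ← Pi.single_add]

theorem coeff_eq_zero_of_pd_inl {f : O F n} {i : Fin n} (h : pd F (Sum.inl i) f = 0) {a : Mono n}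
    (ha : a.1 i ≠ 0) : coeff a f = 0 := by
  obtain ⟨α, u⟩ := a
  obtain ⟨β, rfl⟩ := exists_eq_add_single (Nat.one_le_iff_ne_zero.2 ha)
  rw [← coeff_pd_inl, h, map_zero]

/-- The operator multiplying the monomial `a` by the scalar `c a`. -/
noncomputable def diagonal (c : Mono n → F) : Module.End F (O F n) :=
  (monoBasis F n).constr F fun a => c a • mono F a

theorem diagonal_mono (c : Mono n → F) (a : Mono n) :
    diagonal c (mono F a) = c a • mono F a :=
  (monoBasis F n).constr_basis F _ a

theorem coeff_diagonal (c : Mono n → F) (a : Mono n) (f : O F n) :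
    coeff a (diagonal c f) = c a * coeff a f := by
  induction f using mono_induction with
  | hadd f g hf hg => simp only [map_add, hf, hg, mul_add]
  | hsmul k f h => simp only [map_smul, h, smul_eq_mul, mul_left_comm]
  | hmono b =>
    rw [diagonal_mono, map_smul, coeff_mono, smul_eq_mul]
    split_ifs with hb
    · rw [hb]
    · simp only [mul_zero]

/-- Formal integration `x^(α) x^u ↦ x^(α + ε_i) x^u`, a right inverse of `∂_i`. -/
noncomputable def integral (i : Fin n) : Module.End F (O F n) :=
  (monoBasis F n).constr F fun a => mono F (a.1 + Pi.single i 1, a.2)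

theorem integral_mono (i : Fin n) (a : Mono n) :
    integral i (mono F a) = mono F (a.1 + Pi.single i 1, a.2) := by
  rw [integral, mono, Module.Basis.constr_basis]

theorem pd_integral_self (i : Fin n) (f : O F n) : pd F (Sum.inl i) (integral i f) = f := by
  induction f using mono_induction with
  | hadd f g hf hg => simp only [map_add, hf, hg]
  | hsmul c f h => simp only [map_smul, h]
  | hmono a => rw [integral_mono, pd_inl_mono_add_single_one]

theorem pd_integral_of_ne {i j : Fin n} (hij : i ≠ j) (f : O F n) :
    pd F (Sum.inl i) (integral j f) = integral j (pd F (Sum.inl i) f) := by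
  induction f using mono_induction with
  | hadd f g hf hg => simp only [map_add, hf, hg]
  | hsmul c f h => simp only [map_smul, h]
  | hmono a =>
    obtain ⟨α, u⟩ := a
    rw [integral_mono]
    obtain hα | hα := Nat.eq_zero_or_pos (α i)
    · rw [pd_inl_mono_of_apply_eq_zero hα, map_zero,
        pd_inl_mono_of_apply_eq_zero (by simp [hα, hij])]
    · obtain ⟨β, rfl⟩ := exists_eq_add_single (c := 1) hα
      rw [add_right_comm, pd_inl_mono_add_single_one, pd_inl_mono_add_single_one, integral_mono]

theorem integral_mem_parityPart {θ : ZMod 2} {f : O F n} (i : Fin n) (hf : f ∈ parityPart F θ) :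
    integral i f ∈ parityPart F θ := by
  induction hf using Submodule.span_induction with
  | mem _ h =>
    obtain ⟨a, ha, rfl⟩ := h
    rw [integral_mono]
    exact mono_mem_parityPart ha
  | zero => rw [map_zero]; exact zero_mem _
  | add _ _ _ _ hf hg => rw [map_add]; exact add_mem hf hg
  | smul c _ _ h => rw [map_smul]; exact Submodule.smul_mem _ c h

/-- The largest exponent `π = (p^(t_1) - 1, …, p^(t_n) - 1)` of a monomial of `𝒪(n,n;t)`. -/
def maxExp (p : ℕ) (t : Fin n → ℕ) : Fin n → ℕ := fun i => p ^ t i - 1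

/-- The monomials spanning the odd part of `𝒪(n,n;t)`. -/
def oddMonos (p : ℕ) (t : Fin n → ℕ) : Set (Mono n) := {a | a.1 ≤ maxExp p t ∧ Odd a.2.card}

/-- The odd part of `𝒪(n,n;t)`. -/
noncomputable def oddTrunc (F : Type*) [Field F] {n : ℕ} (p : ℕ) (t : Fin n → ℕ) :
    Submodule F (O F n) := trunc F p t ⊓ parityPart F 1

theorem mono_mem_oddTrunc {p : ℕ} {t : Fin n → ℕ} {a : Mono n} (h : a ∈ oddMonos p t) :
    mono F a ∈ oddTrunc F p t :=
  ⟨mono_mem_trunc h.1, mono_mem_parityPart (ZMod.natCast_eq_one_iff_odd.2 h.2)⟩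

theorem oddTrunc_eq_span (p : ℕ) (t : Fin n → ℕ) :
    oddTrunc F p t = Submodule.span F (mono F '' oddMonos p t) := by
  refine le_antisymm (fun f hf => ?_) ?_
  · exact mem_span_mono_iff.2 fun a ha => ⟨mem_trunc_iff.1 hf.1 a ha,
      ZMod.natCast_eq_one_iff_odd.1 (mem_parityPart_iff.1 hf.2 a ha)⟩
  · exact Submodule.span_le.2 (Set.image_subset_iff.2 fun a ha => mono_mem_oddTrunc ha)

/-! ### Even vector fields -/

/-- The coefficient vectors `(f_r)` of the even vector fields `∑ r, f_r ∂_r`, with arbitrary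
exponents: the even part of `W(n,n)` rather than of `W(n,n;t)`. -/
noncomputable def evenFields (F : Type*) [Field F] (n : ℕ) : Submodule F (Idx n → O F n) :=
  Submodule.pi Set.univ fun r => parityPart F (mu r : ZMod 2)

theorem mem_evenFields {f : Idx n → O F n} :
    f ∈ evenFields F n ↔ ∀ r, f r ∈ parityPart F (mu r : ZMod 2) := by
  simp [evenFields, Submodule.mem_pi]

/-- The commutator of vector fields in terms of their coefficient vectors. -/
noncomputable def bracket : (Idx n → O F n) →ₗ[F] (Idx n → O F n) →ₗ[F] (Idx n → O F n) :=
  LinearMap.mk₂ F (fun f g s => vectorField F f (g s) - vectorField F g (f s))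
    (fun f f' g => by ext s : 1; simp; abel) (fun c f g => by ext s : 1; simp [smul_sub])
    (fun f f' g => by ext s : 1; simp; abel) (fun c f g => by ext s : 1; simp [smul_sub])

theorem bracket_apply (f g : Idx n → O F n) (s : Idx n) :
    bracket f g s = vectorField F f (g s) - vectorField F g (f s) := rfl

theorem bracket_swap (f g : Idx n → O F n) : bracket f g = -bracket g f := by
  ext s : 1
  simp [bracket_apply]

theorem vectorField_bracket {f g : Idx n → O F n} (hf : f ∈ evenFields F n)
    (hg : g ∈ evenFields F n) :
    vectorField F (bracket f g) = ⁅vectorField F f, vectorField F g⁆ :=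
  (lie_vectorField (mem_evenFields.1 hf) (mem_evenFields.1 hg)).symm

theorem vectorField_mem_parityPart {f : Idx n → O F n} (hf : f ∈ evenFields F n) {θ : ZMod 2}
    {g : O F n} (hg : g ∈ parityPart F θ) : vectorField F f g ∈ parityPart F θ := by
  rw [vectorField_apply]
  refine sum_mem fun r _ => ?_
  have hmul := mul_mem_parityPart (mem_evenFields.1 hf r) (pd_mem_parityPart r hg)
  rwa [add_left_comm, CharTwo.add_self_eq_zero, add_zero] at hmul

theorem bracket_mem {f g : Idx n → O F n} (hf : f ∈ evenFields F n) (hg : g ∈ evenFields F n) :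
    bracket f g ∈ evenFields F n :=
  mem_evenFields.2 fun s => sub_mem (vectorField_mem_parityPart hf (mem_evenFields.1 hg s))
    (vectorField_mem_parityPart hg (mem_evenFields.1 hf s))

theorem bracket_bracket {f g h : Idx n → O F n} (hf : f ∈ evenFields F n)
    (hg : g ∈ evenFields F n) (hh : h ∈ evenFields F n) :
    bracket f (bracket g h) = bracket (bracket f g) h + bracket g (bracket f h) := by
  apply vectorField_injective
  rw [map_add, vectorField_bracket hf (bracket_mem hg hh),
    vectorField_bracket (bracket_mem hf hg) hh, vectorField_bracket hg (bracket_mem hf hh),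
    vectorField_bracket hf hg, vectorField_bracket hg hh, vectorField_bracket hf hh, leibniz_lie]

/-- The coefficient vector of `T_H(a)` for odd `a`. -/
noncomputable def ham : O F n →ₗ[F] (Idx n → O F n) :=
  LinearMap.pi (Sum.elim (fun i => -pd F (Sum.inr i)) fun i => pd F (Sum.inl i))

@[simp] theorem ham_inl (a : O F n) (i : Fin n) : ham a (Sum.inl i) = -pd F (Sum.inr i) a := rfl

@[simp] theorem ham_inr (a : O F n) (i : Fin n) : ham a (Sum.inr i) = pd F (Sum.inl i) a := rfl

theorem TH_eq_vectorField_ham {a : O F n} (ha : a ∈ parityPart F 1) :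
    TH F a = vectorField F (ham a) := by
  rw [TH_eq (m := 1) (by simpa using ha)]
  congr 1
  funext r
  rcases r with i | i <;> simp [mu]

theorem ham_mem {a : O F n} (ha : a ∈ parityPart F 1) : ham a ∈ evenFields F n := by
  refine mem_evenFields.2 fun r => ?_
  have hr : (1 + 1 + mu r : ZMod 2) = mu r := by
    rw [CharTwo.add_self_eq_zero, zero_add]
  rw [← hr]
  rcases r with i | i
  · simpa using TH_coeff_mem ha (-1) (Sum.inl i)
  · simpa using TH_coeff_mem ha 1 (Sum.inr i)

/-- The bracket `{a, b}` of odd elements of `𝒪(n,n)`, for which `T_H` is a homomorphism. -/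
noncomputable def poisson : O F n →ₗ[F] O F n →ₗ[F] O F n := vectorField F ∘ₗ ham

theorem poisson_apply (a b : O F n) : poisson a b = vectorField F (ham a) b := rfl

theorem poisson_mem_parityPart {a b : O F n} (ha : a ∈ parityPart F 1) (hb : b ∈ parityPart F 1) :
    poisson a b ∈ parityPart F 1 := vectorField_mem_parityPart (ham_mem ha) hb

theorem ham_poisson {a b : O F n} (ha : a ∈ parityPart F 1) (hb : b ∈ parityPart F 1) :
    ham (poisson a b) = bracket (ham a) (ham b) := by
  apply vectorField_injective
  rw [vectorField_bracket (ham_mem ha) (ham_mem hb), ← TH_eq_vectorField_ham ha,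
    ← TH_eq_vectorField_ham hb, lie_TH ha hb,
    ← TH_eq_vectorField_ham (poisson_mem_parityPart ha hb), poisson_apply,
    TH_eq_vectorField_ham ha]

theorem ham_mem_trunc {p : ℕ} {t : Fin n → ℕ} {a : O F n} (ha : a ∈ trunc F p t) (r : Idx n) :
    ham a r ∈ trunc F p t := by
  rcases r with i | i
  · exact neg_mem (pd_mem_trunc _ ha)
  · exact pd_mem_trunc _ ha

theorem poisson_mem {p : ℕ} [Fact p.Prime] [CharP F p] {t : Fin n → ℕ} {a b : O F n}
    (ha : a ∈ oddTrunc F p t) (hb : b ∈ oddTrunc F p t) : poisson a b ∈ oddTrunc F p t :=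
  ⟨vectorField_mem_trunc (ham_mem_trunc ha.1) hb.1, poisson_mem_parityPart ha.2 hb.2⟩

/-- `∂_i`, `i ∈ Y₀`, applied to every coefficient of a vector field: this is `ad ∂_i`. -/
noncomputable def pdField (i : Fin n) : Module.End F (Idx n → O F n) :=
  (pd F (Sum.inl i)).compLeft (Idx n)

theorem pdField_apply (i : Fin n) (f : Idx n → O F n) (r : Idx n) :
    pdField i f r = pd F (Sum.inl i) (f r) := rfl

theorem pdField_pow_apply (i : Fin n) (k : ℕ) (f : Idx n → O F n) (r : Idx n) :
    (pdField i ^ k) f r = (pd F (Sum.inl i) ^ k) (f r) := by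
  induction k generalizing f with
  | zero => simp
  | succ k ih =>
    rw [pow_succ, Module.End.mul_apply, ih, pow_succ, Module.End.mul_apply, pdField_apply]

theorem pd_inl_mem_parityPart {θ : ZMod 2} {f : O F n} (i : Fin n) (hf : f ∈ parityPart F θ) :
    pd F (Sum.inl i) f ∈ parityPart F θ := by
  simpa [mu] using pd_mem_parityPart (Sum.inl i) hf

theorem pdField_mem (i : Fin n) {f : Idx n → O F n} (hf : f ∈ evenFields F n) :
    pdField i f ∈ evenFields F n :=
  mem_evenFields.2 fun r => pd_inl_mem_parityPart i (mem_evenFields.1 hf r)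

theorem pdField_pow_mem (i : Fin n) (k : ℕ) {f : Idx n → O F n} (hf : f ∈ evenFields F n) :
    (pdField i ^ k) f ∈ evenFields F n := by
  induction k generalizing f with
  | zero => simpa
  | succ k ih => rw [pow_succ]; exact ih (pdField_mem i hf)

theorem pdField_pow_mem_trunc {p : ℕ} {t : Fin n → ℕ} (i : Fin n) (k : ℕ) {f : Idx n → O F n}
    (hf : ∀ r, f r ∈ trunc F p t) (r : Idx n) : (pdField i ^ k) f r ∈ trunc F p t := by
  induction k generalizing f with
  | zero => simpa using hf r
  | succ k ih => rw [pow_succ]; exact ih fun r => pd_mem_trunc _ (hf r)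

theorem pd_inl_comm (i : Fin n) (r : Idx n) (f : O F n) :
    pd F (Sum.inl i) (pd F r f) = pd F r (pd F (Sum.inl i) f) := by
  simp [pd_comm (Sum.inl i) r, mu]

theorem pdField_ham (i : Fin n) (a : O F n) : pdField i (ham a) = ham (pd F (Sum.inl i) a) := by
  ext r : 1
  rw [pdField_apply]
  rcases r with j | j
  · rw [ham_inl, ham_inl, map_neg, pd_inl_comm]
  · exact pd_inl_comm i _ a

theorem pdField_pow_ham (i : Fin n) (k : ℕ) (a : O F n) :
    (pdField i ^ k) (ham a) = ham ((pd F (Sum.inl i) ^ k) a) := by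
  induction k generalizing a with
  | zero => simp
  | succ k ih =>
    rw [pow_succ, Module.End.mul_apply, pdField_ham, ih, pow_succ, Module.End.mul_apply]

theorem vectorField_single (i : Fin n) :
    vectorField F (Pi.single (Sum.inl i) (mono F (0, ∅))) = pd F (Sum.inl i) := by
  refine LinearMap.ext fun g => ?_
  rw [vectorField_apply, Finset.sum_eq_single (Sum.inl i)]
  · rw [Pi.single_eq_same, one_mul']
  · intro s _ hs
    rw [Pi.single_eq_of_ne hs, map_zero, LinearMap.zero_apply]
  · exact fun h => absurd (Finset.mem_univ _) h

theorem vectorField_one (f : Idx n → O F n) : vectorField F f (mono F (0, ∅)) = 0 := by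
  rw [vectorField_apply]
  refine Finset.sum_eq_zero fun r _ => ?_
  rw [pd_mono]
  rcases r with i | i <;> simp [partialMono]

theorem bracket_single (i : Fin n) (f : Idx n → O F n) :
    bracket (Pi.single (Sum.inl i) (mono F (0, ∅))) f = pdField i f := by
  ext s : 1
  rw [bracket_apply, vectorField_single, pdField_apply]
  refine (congrArg _ ?_).trans (sub_zero _)
  obtain rfl | hs := eq_or_ne s (Sum.inl i)
  · rw [Pi.single_eq_same, vectorField_one]
  · rw [Pi.single_eq_of_ne hs, map_zero]

theorem single_mem_evenFields (i : Fin n) :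
    Pi.single (Sum.inl i) (mono F (0, ∅)) ∈ evenFields F n := by
  refine mem_evenFields.2 fun r => ?_
  obtain rfl | hr := eq_or_ne r (Sum.inl i)
  · rw [Pi.single_eq_same]
    exact mono_mem_parityPart (by simp [mu])
  · rw [Pi.single_eq_of_ne hr]
    exact zero_mem _

theorem vectorField_pdField_pow (i : Fin n) (k : ℕ) {f : Idx n → O F n}
    (hf : f ∈ evenFields F n) : vectorField F ((pdField i ^ k) f) =
      (LieDerivation.ad F (Module.End F (O F n)) (pd F (Sum.inl i)))^[k] (vectorField F f) := by
  induction k generalizing f with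
  | zero => simp
  | succ k ih =>
    rw [pow_succ, Module.End.mul_apply, ih (pdField_mem i hf), Function.iterate_succ_apply,
      LieDerivation.ad_apply_apply, ← bracket_single,
      vectorField_bracket (single_mem_evenFields i) hf, vectorField_single]

theorem pdField_pow_bracket (p : ℕ) [Fact p.Prime] [CharP F p] (i : Fin n) (k : ℕ)
    {f g : Idx n → O F n} (hf : f ∈ evenFields F n) (hg : g ∈ evenFields F n) :
    (pdField i ^ p ^ k) (bracket f g) =
      bracket ((pdField i ^ p ^ k) f) g + bracket f ((pdField i ^ p ^ k) g) := by
  apply vectorField_injective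
  rw [map_add, vectorField_pdField_pow i _ (bracket_mem hf hg),
    vectorField_bracket (pdField_pow_mem i _ hf) hg,
    vectorField_bracket hf (pdField_pow_mem i _ hg), vectorField_pdField_pow i _ hf,
    vectorField_pdField_pow i _ hg, vectorField_bracket hf hg, iterate_prime_pow_apply_lie]

theorem exists_pdField_eq (f : Fin n → Idx n → O F n) (hf : ∀ i, f i ∈ evenFields F n)
    (hclosed : ∀ i j, pdField i (f j) = pdField j (f i)) :
    ∃ w ∈ evenFields F n, ∀ i, pdField i w = f i := by
  have hcomponent (r : Idx n) : ∃ g ∈ parityPart F (mu r : ZMod 2),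
      ∀ i ∈ Finset.univ, pd F (Sum.inl i) g = f i r :=
    exists_common_primitive (fun i j => pd_inl_comm i (Sum.inl j)) pd_integral_self
      (fun _ _ x hij => pd_integral_of_ne hij x) (fun i _ => pd_inl_mem_parityPart i)
      (fun i _ => integral_mem_parityPart i) (fun i => mem_evenFields.1 (hf i) r)
      (fun i j => congrFun (hclosed i j) r) Finset.univ
  choose w hw hpd using hcomponent
  exact ⟨w, mem_evenFields.2 hw, fun i => funext fun r => hpd r i (Finset.mem_univ i)⟩

theorem binom_zero_left (β : Fin n → ℕ) : binom 0 β = 1 := by simp [binom]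

theorem binom_zero_right (α : Fin n → ℕ) : binom α 0 = 1 := by simp [binom]

theorem binom_single_left (i : Fin n) (c : ℕ) (β : Fin n → ℕ) :
    binom (Pi.single i c) β = (c + β i).choose c := by
  rw [binom, Finset.prod_eq_single i]
  · rw [Pi.single_eq_same]
  · intro j _ hj
    rw [Pi.single_eq_of_ne hj, Nat.choose_zero_right]
  · exact fun h => absurd (Finset.mem_univ _) h

theorem binom_single_right (i : Fin n) (c : ℕ) (α : Fin n → ℕ) :
    binom α (Pi.single i c) = (α i + c).choose c := by
  rw [binom, Finset.prod_eq_single i]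
  · rw [Pi.single_eq_same, Nat.choose_symm_add]
  · intro j _ hj
    rw [Pi.single_eq_of_ne hj, add_zero, Nat.choose_self]
  · exact fun h => absurd (Finset.mem_univ _) h

theorem mul_mono_empty_left (α β : Fin n → ℕ) (u : Finset (Fin n)) :
    mul F (mono F (α, ∅)) (mono F (β, u)) = (binom α β : F) • mono F (α + β, u) := by
  rw [mul_mono, mulMono_pair (Finset.disjoint_empty_left u), Finset.empty_union]
  simp [inv]

theorem mul_mono_empty_right (α β : Fin n → ℕ) (u : Finset (Fin n)) :
    mul F (mono F (α, u)) (mono F (β, ∅)) = (binom α β : F) • mono F (α + β, u) := by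
  rw [mul_mono, mulMono_pair (Finset.disjoint_empty_right u), Finset.union_empty]
  simp [inv]

theorem pd_inr_mono_of_mem {i : Fin n} {u : Finset (Fin n)} (h : i ∈ u) (α : Fin n → ℕ) :
    pd F (Sum.inr i) (mono F (α, u)) =
      ((-1) ^ (u.filter (· < i)).card : F) • mono F (α, u.erase i) := by
  rw [pd_mono]
  exact if_pos h

theorem pd_inr_mono_of_notMem {i : Fin n} {u : Finset (Fin n)} (h : i ∉ u) (α : Fin n → ℕ) :
    pd F (Sum.inr i) (mono F (α, u)) = 0 := by
  rw [pd_mono]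
  exact if_neg h

theorem pd_inr_mono_singleton (i : Fin n) (α : Fin n → ℕ) :
    pd F (Sum.inr i) (mono F (α, {i})) = mono F (α, ∅) := by
  rw [pd_inr_mono_of_mem (Finset.mem_singleton_self i), Finset.filter_singleton,
    if_neg (lt_irrefl i), Finset.card_empty, pow_zero, one_smul, Finset.erase_singleton]

theorem pd_inr_mono_singleton_of_ne {i j : Fin n} (h : i ≠ j) (α : Fin n → ℕ) :
    pd F (Sum.inr i) (mono F (α, {j})) = 0 :=
  pd_inr_mono_of_notMem (by simpa) α

theorem mul_singleton_pd_inr {i : Fin n} {u : Finset (Fin n)} (h : i ∈ u) (α β : Fin n → ℕ) :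
    mul F (mono F (α, {i})) (pd F (Sum.inr i) (mono F (β, u))) =
      (binom α β : F) • mono F (α + β, u) := by
  have hinv : inv {i} (u.erase i) = (u.filter (· < i)).card := by
    rw [inv, Finset.sum_singleton, Finset.filter_erase, Finset.erase_eq_of_notMem (by simp)]
  rw [pd_inr_mono_of_mem h, map_smul, mul_mono, mulMono_pair (by simp), smul_smul, hinv,
    ← Finset.insert_eq, Finset.insert_erase h, ← mul_assoc, ← pow_add,
    Even.neg_one_pow ⟨_, rfl⟩, one_mul]

theorem mul_singleton_pd_inr_of_ne {i j : Fin n} {u : Finset (Fin n)} (hj : j ∈ u) (hij : i ≠ j)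
    (α β : Fin n → ℕ) : mul F (mono F (α, {j})) (pd F (Sum.inr i) (mono F (β, u))) = 0 := by
  by_cases hi : i ∈ u
  · rw [pd_inr_mono_of_mem hi, map_smul, mul_mono,
      mulMono_of_not_disjoint (by simp [hj, hij.symm]), smul_zero]
  · rw [pd_inr_mono_of_notMem hi, map_zero]

theorem mul_single_succ_pd_inl (i : Fin n) (c : ℕ) (β : Fin n → ℕ) (u : Finset (Fin n)) :
    mul F (mono F (Pi.single i (c + 1), ∅)) (pd F (Sum.inl i) (mono F (β, u))) =
      ((β i + c).choose (c + 1) : F) • mono F (β + Pi.single i c, u) := by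
  obtain hβ | hβ := Nat.eq_zero_or_pos (β i)
  · rw [pd_inl_mono_of_apply_eq_zero hβ, map_zero, hβ, Nat.choose_eq_zero_of_lt (by omega),
      Nat.cast_zero, zero_smul]
  · obtain ⟨γ, rfl⟩ := exists_eq_add_single (c := 1) hβ
    rw [pd_inl_mono_add_single_one, mul_mono_empty_left, binom_single_left, Pi.add_apply,
      Pi.single_eq_same, add_assoc γ, ← Pi.single_add, add_comm 1 c, add_comm γ,
      show γ i + 1 + c = c + 1 + γ i by omega]

theorem mul_single_pd_inl (i : Fin n) (β : Fin n → ℕ) (u : Finset (Fin n)) :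
    mul F (mono F (Pi.single i 1, ∅)) (pd F (Sum.inl i) (mono F (β, u))) =
      (β i : F) • mono F (β, u) := by
  simpa using mul_single_succ_pd_inl i 0 β u

theorem poisson_eq_sum (a b : O F n) : poisson a b = ∑ i, (mul F (pd F (Sum.inl i) a)
    (pd F (Sum.inr i) b) - mul F (pd F (Sum.inr i) a) (pd F (Sum.inl i) b)) := by
  rw [poisson_apply, vectorField_apply, Fintype.sum_sum_type, Finset.sum_sub_distrib]
  simp [sub_eq_add_neg, add_comm]

theorem poisson_mono_singleton (α : Fin n → ℕ) (j : Fin n) (g : O F n) :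
    poisson (mono F (α, {j})) g =
      ∑ i, mul F (pd F (Sum.inl i) (mono F (α, {j}))) (pd F (Sum.inr i) g) -
        mul F (mono F (α, ∅)) (pd F (Sum.inl j) g) := by
  rw [poisson_eq_sum, Finset.sum_sub_distrib, sub_right_inj, Finset.sum_eq_single j]
  · rw [pd_inr_mono_singleton]
  · intro i _ hi
    rw [pd_inr_mono_singleton_of_ne hi, map_zero, LinearMap.zero_apply]
  · exact fun h => absurd (Finset.mem_univ _) h

theorem poisson_singleton_singleton (α β : Fin n → ℕ) (j l : Fin n) :
    poisson (mono F (α, {j})) (mono F (β, {l})) =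
      mul F (pd F (Sum.inl l) (mono F (α, {j}))) (mono F (β, ∅)) -
        mul F (mono F (α, ∅)) (pd F (Sum.inl j) (mono F (β, {l}))) := by
  rw [poisson_mono_singleton, Finset.sum_eq_single l, pd_inr_mono_singleton]
  · intro i _ hi
    rw [pd_inr_mono_singleton_of_ne hi, map_zero]
  · exact fun h => absurd (Finset.mem_univ _) h

theorem poisson_singleton_of_mem {j : Fin n} {u : Finset (Fin n)} (hj : j ∈ u)
    (α β : Fin n → ℕ) : poisson (mono F (α, {j})) (mono F (β, u)) =
      mul F (pd F (Sum.inl j) (mono F (α, ∅))) (mono F (β, u)) -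
        mul F (mono F (α, ∅)) (pd F (Sum.inl j) (mono F (β, u))) := by
  rw [poisson_mono_singleton, sub_left_inj, Finset.sum_eq_single j]
  · obtain hα | hα := Nat.eq_zero_or_pos (α j)
    · rw [pd_inl_mono_of_apply_eq_zero hα, pd_inl_mono_of_apply_eq_zero hα, map_zero,
        LinearMap.zero_apply, LinearMap.zero_apply]
    · obtain ⟨γ, rfl⟩ := exists_eq_add_single (c := 1) hα
      rw [pd_inl_mono_add_single_one, pd_inl_mono_add_single_one, mul_singleton_pd_inr hj,
        mul_mono_empty_left]
  · intro i _ hi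
    obtain hα | hα := Nat.eq_zero_or_pos (α i)
    · rw [pd_inl_mono_of_apply_eq_zero hα, map_zero, LinearMap.zero_apply]
    · obtain ⟨γ, rfl⟩ := exists_eq_add_single (c := 1) hα
      rw [pd_inl_mono_add_single_one, mul_singleton_pd_inr_of_ne hj hi]
  · exact fun h => absurd (Finset.mem_univ _) h

theorem poisson_const (j : Fin n) (g : O F n) :
    poisson (mono F (0, {j})) g = -pd F (Sum.inl j) g := by
  rw [poisson_mono_singleton, one_mul', Finset.sum_eq_zero, zero_sub]
  intro i _
  rw [pd_inl_mono_of_apply_eq_zero rfl, map_zero, LinearMap.zero_apply]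

theorem ham_const (j : Fin n) :
    ham (mono F ((0 : Fin n → ℕ), {j})) = -Pi.single (Sum.inl j) (mono F (0, ∅)) := by
  ext r : 1
  rcases r with i | i
  · rw [ham_inl, Pi.neg_apply]
    obtain rfl | hi := eq_or_ne i j
    · rw [pd_inr_mono_singleton, Pi.single_eq_same]
    · rw [pd_inr_mono_singleton_of_ne hi, Pi.single_eq_of_ne (by simpa)]
  · rw [ham_inr, pd_inl_mono_of_apply_eq_zero rfl, Pi.neg_apply, Pi.single_eq_of_ne (by simp),
      neg_zero]

theorem bracket_ham_const (j : Fin n) (f : Idx n → O F n) :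
    bracket (ham (mono F ((0 : Fin n → ℕ), {j}))) f = -pdField j f := by
  rw [ham_const, map_neg, LinearMap.neg_apply, bracket_single]

/-- The monomial `x_i x_{j'}`; together they span the part of degree zero. -/
abbrev elem (i j : Fin n) : Mono n := (Pi.single i 1, {j})

theorem pd_inl_elem (i j : Fin n) : pd F (Sum.inl i) (mono F (elem i j)) = mono F (0, {j}) := by
  simpa using pd_inl_mono_add_single_one (F := F) i 0 {j}

theorem pd_inl_elem_of_ne {i k : Fin n} (h : k ≠ i) (j : Fin n) :
    pd F (Sum.inl k) (mono F (elem i j)) = 0 :=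
  pd_inl_mono_of_apply_eq_zero (Pi.single_eq_of_ne h _) _

theorem poisson_elem (i j : Fin n) (g : O F n) :
    poisson (mono F (elem i j)) g = mul F (mono F (0, {j})) (pd F (Sum.inr i) g) -
      mul F (mono F (Pi.single i 1, ∅)) (pd F (Sum.inl j) g) := by
  rw [poisson_mono_singleton, Finset.sum_eq_single i, pd_inl_elem]
  · intro k _ hk
    rw [pd_inl_elem_of_ne hk, map_zero, LinearMap.zero_apply]
  · exact fun h => absurd (Finset.mem_univ _) h

theorem exists_poisson_single_const {i : Fin n} {v w : Finset (Fin n)} (hi : i ∈ w)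
    (hv : Disjoint v (w.erase i)) : ∃ ε : F, ε ≠ 0 ∧
      poisson (mono F (Pi.single i 1, v)) (mono F (0, w)) = ε • mono F (0, v ∪ w.erase i) := by
  refine ⟨(-1) ^ (w.filter (· < i)).card * (-1) ^ inv v (w.erase i),
    mul_ne_zero (pow_ne_zero _ (by simp)) (pow_ne_zero _ (by simp)), ?_⟩
  have hpd : pd F (Sum.inl i) (mono F (Pi.single i 1, v)) = mono F (0, v) := by
    simpa using pd_inl_mono_add_single_one (F := F) i 0 v
  rw [poisson_eq_sum, Finset.sum_eq_single i]
  · rw [pd_inl_mono_of_apply_eq_zero (α := 0) rfl, map_zero, sub_zero, hpd, pd_inr_mono_of_mem hi,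
      map_smul, mul_mono, mulMono_pair hv, smul_smul, binom_zero_left, Nat.cast_one, mul_one,
      add_zero]
  · intro l _ hl
    rw [pd_inl_mono_of_apply_eq_zero (Pi.single_eq_of_ne hl _),
      pd_inl_mono_of_apply_eq_zero (α := 0) rfl, map_zero, map_zero, LinearMap.zero_apply,
      sub_zero]
  · exact fun h => absurd (Finset.mem_univ _) h

theorem poisson_single_of_mem {j : Fin n} {u : Finset (Fin n)} (hj : j ∈ u) (c : ℕ)
    (β : Fin n → ℕ) : poisson (mono F (Pi.single j (c + 1), {j})) (mono F (β, u)) =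
      (((β j + c).choose c : F) - (β j + c).choose (c + 1)) • mono F (β + Pi.single j c, u) := by
  have hpd : pd F (Sum.inl j) (mono F (Pi.single j (c + 1), ∅)) = mono F (Pi.single j c, ∅) := by
    simpa using pd_inl_mono_add_single (F := F) j 0 c ∅
  rw [poisson_singleton_of_mem hj, hpd, mul_mono_empty_left, binom_single_left,
    mul_single_succ_pd_inl, sub_smul, add_comm c, add_comm _ β]

theorem poisson_single_add_single {i j : Fin n} (hij : i ≠ j) (l : Fin n) (c : ℕ)
    (β : Fin n → ℕ) :
    poisson (mono F (Pi.single i c, {l})) (mono F (β + Pi.single l 1, {j})) =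
      (-(β i + c).choose c : F) • mono F (β + Pi.single i c, {j}) := by
  rw [poisson_singleton_singleton, pd_inl_mono_of_apply_eq_zero (Pi.single_eq_of_ne hij.symm _),
    map_zero, LinearMap.zero_apply, pd_inl_mono_add_single_one, mul_mono_empty_left,
    binom_single_left, zero_sub, neg_smul, add_comm c, add_comm _ β]

/-! ### Torus weights -/

/-- The weight of a monomial under the torus spanned by the `T_H(x_i x_{i'})`, lifted from the
prime field to `ℤ`. -/
def monoWeight (a : Mono n) : Fin n → ℤ := fun i => (if i ∈ a.2 then 1 else 0) - a.1 i

/-- The weight of `∂_r` under the torus spanned by the `T_H(x_i x_{i'})`. -/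
def partialWeight : Idx n → Fin n → ℤ :=
  Sum.elim (fun j => Pi.single j 1) fun j => -Pi.single j 1

/-- The weight of `a ∂_r`, for a monomial `a`, under the torus spanned by the `T_H(x_i x_{i'})`. -/
def fieldWeight (a : Mono n) (r : Idx n) : Fin n → ℤ := monoWeight a + partialWeight r

theorem poisson_toral (i : Fin n) :
    poisson (mono F (elem i i)) = diagonal fun a => (monoWeight a i : F) := by
  refine LinearMap.ext fun f => ?_
  induction f using mono_induction with
  | hadd f₁ f₂ h₁ h₂ => rw [map_add, map_add, h₁, h₂]
  | hsmul c f h => rw [map_smul, map_smul, h]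
  | hmono a =>
    obtain ⟨β, u⟩ := a
    rw [poisson_elem, mul_single_pd_inl, diagonal_mono]
    by_cases h : i ∈ u
    · rw [mul_singleton_pd_inr h, binom_zero_left, zero_add, ← sub_smul]
      simp [monoWeight, h]
    · rw [pd_inr_mono_of_notMem h, map_zero, zero_sub, ← neg_smul]
      simp [monoWeight, h]

theorem ham_toral (i : Fin n) (r : Idx n) :
    ham (mono F (elem i i)) r = -(partialWeight r i : F) • mono F (gen r) := by
  rcases r with j | j
  · rw [ham_inl]
    obtain rfl | h := eq_or_ne j i
    · rw [pd_inr_mono_singleton]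
      simp [partialWeight, gen]
    · rw [pd_inr_mono_singleton_of_ne h]
      simp [partialWeight, h.symm]
  · rw [ham_inr]
    obtain rfl | h := eq_or_ne j i
    · rw [pd_inl_elem]
      simp [partialWeight, gen]
    · rw [pd_inl_elem_of_ne h]
      simp [partialWeight, h.symm]

theorem coeff_bracket_toral (i : Fin n) (f : Idx n → O F n) (r : Idx n) (a : Mono n) :
    coeff a (bracket (ham (mono F (elem i i))) f r) = (fieldWeight a r i : F) * coeff a (f r) := by
  rw [bracket_apply, ham_toral, map_smul, vectorField_gen, ← poisson_apply, map_sub, poisson_toral,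
    coeff_diagonal, map_smul, smul_eq_mul, fieldWeight, Pi.add_apply, Int.cast_add]
  ring

theorem diagonal_mem_parityPart (c : Mono n → F) {θ : ZMod 2} {f : O F n}
    (hf : f ∈ parityPart F θ) : diagonal c f ∈ parityPart F θ :=
  mem_parityPart_iff.2 fun a ha => mem_parityPart_iff.1 hf a fun h => ha <| by
    rw [coeff_diagonal, h, mul_zero]

theorem exists_weight_primitive {ι : Type*} [Fintype ι] (ω : ι → F) : ∃ c : ι → F,
    ∀ z : ι → F, (∀ i j, ω i * z j = ω j * z i) →
      ∀ i j, ω j * (z i + ω i * ∑ k, c k * z k) = 0 := by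
  classical
  by_cases hω : ∃ k, ω k ≠ 0
  · obtain ⟨k, hk⟩ := hω
    refine ⟨-Pi.single k (ω k)⁻¹, fun z hz i j => ?_⟩
    have hsum : ∑ l, (-Pi.single k (ω k)⁻¹ : ι → F) l * z l = -((ω k)⁻¹ * z k) := by
      simp [Pi.single_apply]
    rw [hsum, mul_neg, mul_left_comm, hz i k, inv_mul_cancel_left₀ hk, add_neg_cancel, mul_zero]
  · push Not at hω
    exact ⟨0, fun z _ i j => by rw [hω j, zero_mul]⟩

/-- A `1`-cocycle on a torus is cohomologous to a torus invariant one. -/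
theorem exists_toral_primitive {z : Fin n → Idx n → O F n} (hz : ∀ i, z i ∈ evenFields F n)
    (hcomm : ∀ i j, bracket (ham (mono F (elem i i))) (z j) =
      bracket (ham (mono F (elem j j))) (z i)) :
    ∃ w ∈ evenFields F n, (∀ r a, (∀ j, coeff a (z j r) = 0) → coeff a (w r) = 0) ∧
      ∀ i j, bracket (ham (mono F (elem j j))) (z i + bracket (ham (mono F (elem i i))) w) = 0 := by
  choose c hc using fun (r : Idx n) (a : Mono n) =>
    exists_weight_primitive fun i => (fieldWeight a r i : F)
  let w : Idx n → O F n := fun r => ∑ k, diagonal (fun a => c r a k) (z k r)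
  have hw : ∀ r a, coeff a (w r) = ∑ k, c r a k * coeff a (z k r) := fun r a => by
    simp only [w, map_sum, coeff_diagonal]
  refine ⟨w, mem_evenFields.2 fun r => sum_mem fun k _ =>
    diagonal_mem_parityPart _ (mem_evenFields.1 (hz k) r), fun r a h => ?_,
    fun i j => funext fun r => coeff_ext fun a => ?_⟩
  · simp [hw, h]
  · rw [coeff_bracket_toral, Pi.add_apply, map_add, coeff_bracket_toral, hw, Pi.zero_apply,
      map_zero]
    refine hc r a (fun k => coeff a (z k r)) (fun i j => ?_) i j
    rw [← coeff_bracket_toral, hcomm, coeff_bracket_toral]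

theorem fieldWeight_inl (v : Finset (Fin n)) (k i : Fin n) : fieldWeight (0, v) (Sum.inl k) i =
    (if i ∈ v then 1 else 0) + (if i = k then 1 else 0) := by
  simp [fieldWeight, monoWeight, partialWeight, Pi.single_apply]

theorem fieldWeight_inr (v : Finset (Fin n)) (k i : Fin n) : fieldWeight (0, v) (Sum.inr k) i =
    (if i ∈ v then 1 else 0) - (if i = k then 1 else 0) := by
  simp [fieldWeight, monoWeight, partialWeight, Pi.single_apply, sub_eq_add_neg]

theorem five_le_of_prime {p : ℕ} [Fact p.Prime] (hp : 3 < p) : 5 ≤ p :=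
  (Fact.out : p.Prime).five_le_of_ne_two_of_ne_three (by omega) (by omega)

theorem fieldWeight_const_bounds (v : Finset (Fin n)) (r : Idx n) (i : Fin n) :
    -1 ≤ fieldWeight (0, v) r i ∧ fieldWeight (0, v) r i ≤ 2 := by
  rcases r with k | k
  · rw [fieldWeight_inl]
    split_ifs <;> simp
  · rw [fieldWeight_inr]
    split_ifs <;> simp

theorem fieldWeight_const_eq_of_cast {p : ℕ} [Fact p.Prime] [CharP F p] (hp : 3 < p)
    {v : Finset (Fin n)} {r : Idx n} {i : Fin n} {x : ℤ} (hx : |x| ≤ 2)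
    (h : (fieldWeight (0, v) r i : F) = x) : fieldWeight (0, v) r i = x := by
  have hp5 := five_le_of_prime hp
  have hbounds := fieldWeight_const_bounds v r i
  rw [abs_le] at hx
  exact eq_of_intCast_eq h (abs_lt.2 ⟨by omega, by omega⟩)

theorem eq_inr_of_fieldWeight_eq_zero {v : Finset (Fin n)} {r : Idx n}
    (h : fieldWeight (0, v) r = 0) : ∃ k, r = Sum.inr k ∧ v = {k} := by
  rcases r with k | k
  · have hk := congrFun h k
    rw [fieldWeight_inl, Pi.zero_apply] at hk
    grind
  · refine ⟨k, rfl, Finset.ext fun i => ?_⟩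
    have hi := congrFun h i
    rw [fieldWeight_inr, Pi.zero_apply] at hi
    grind

theorem eq_inr_of_fieldWeight_eq_elem {v : Finset (Fin n)} {r : Idx n} {i j : Fin n} (hij : i ≠ j)
    (h : fieldWeight (0, v) r = monoWeight (elem i j)) : r = Sum.inr i ∧ v = {j} := by
  have hw : ∀ k, monoWeight (elem i j) k = (if k = j then 1 else 0) - (if k = i then 1 else 0) :=
    fun k => by simp [monoWeight, Pi.single_apply]
  rcases r with k | k
  · have hi := congrFun h i
    rw [hw, fieldWeight_inl] at hi
    grind
  · obtain rfl : k = i := by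
      have hi := congrFun h i
      rw [hw, fieldWeight_inr] at hi
      grind
    refine ⟨rfl, Finset.ext fun l => ?_⟩
    have hl := congrFun h l
    rw [hw, fieldWeight_inr] at hl
    grind

theorem eq_inl_of_fieldWeight_eq_const {v u : Finset (Fin n)} {r : Idx n} (hu : Odd u.card)
    (hv : (v.card : ZMod 2) = mu r) (h : fieldWeight (0, v) r = monoWeight (0, u)) :
    ∃ k ∈ u, r = Sum.inl k ∧ v = u.erase k := by
  have hw : ∀ k, monoWeight (0, u) k = if k ∈ u then 1 else 0 := fun k => by simp [monoWeight]
  rcases r with k | k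
  · refine ⟨k, ?_, rfl, Finset.ext fun l => ?_⟩
    · have hk := congrFun h k
      rw [hw, fieldWeight_inl] at hk
      grind
    · have hl := congrFun h l
      rw [hw, fieldWeight_inl] at hl
      grind
  · have hk : k ∉ u := by
      have hk := congrFun h k
      rw [hw, fieldWeight_inr] at hk
      grind
    have hvu : v = insert k u := Finset.ext fun l => by
      have hl := congrFun h l
      rw [hw, fieldWeight_inr] at hl
      grind
    rw [hvu, Finset.card_insert_of_notMem hk, Nat.cast_add, ZMod.natCast_eq_one_iff_odd.2 hu] at hv
    simp [mu] at hv

theorem fieldWeight_const_ne_neg_single {v : Finset (Fin n)} {r : Idx n}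
    (hv : (v.card : ZMod 2) = mu r) (i : Fin n) : fieldWeight (0, v) r ≠ -Pi.single i 1 := by
  intro h
  have hw : ∀ k, (-Pi.single i 1 : Fin n → ℤ) k = if k = i then -1 else 0 := fun k => by
    by_cases hk : k = i <;> simp [hk]
  rcases r with k | k
  · have hi := congrFun h i
    rw [hw, fieldWeight_inl] at hi
    grind
  · obtain rfl : k = i := by
      have hi := congrFun h i
      rw [hw, fieldWeight_inr] at hi
      grind
    have hvu : v = ∅ := Finset.eq_empty_of_forall_notMem fun l => by
      have hl := congrFun h l
      rw [hw, fieldWeight_inr] at hl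
      grind
    rw [hvu] at hv
    simp [mu] at hv

theorem eq_of_fieldWeight_const_eq_neg_one {v : Finset (Fin n)} {r : Idx n} {i l : Fin n}
    (hi : fieldWeight (0, v) r i = -1) (hl : fieldWeight (0, v) r l = -1) : i = l := by
  rcases r with k | k
  · rw [fieldWeight_inl] at hi
    grind
  · rw [fieldWeight_inr] at hi hl
    grind

/-- The even vector field `∑ k, c_k x_{k'} ∂_{k'}`, a weighted Euler field in the odd variables. -/
noncomputable def oddEuler (c : Fin n → F) : Idx n → O F n :=
  Sum.elim (fun _ => 0) fun k => c k • mono F (0, {k})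

@[simp] theorem oddEuler_inl (c : Fin n → F) (k : Fin n) : oddEuler c (Sum.inl k) = 0 := rfl

@[simp] theorem oddEuler_inr (c : Fin n → F) (k : Fin n) :
    oddEuler c (Sum.inr k) = c k • mono F (0, {k}) := rfl

theorem oddEuler_mem (c : Fin n → F) : oddEuler c ∈ evenFields F n := by
  rw [mem_evenFields]
  rintro (k | k)
  · exact zero_mem _
  · exact Submodule.smul_mem _ _ (mono_mem_parityPart (by simp [mu]))

theorem vectorField_oddEuler (c : Fin n → F) (α : Fin n → ℕ) (u : Finset (Fin n)) :
    vectorField F (oddEuler c) (mono F (α, u)) = (∑ k ∈ u, c k) • mono F (α, u) := by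
  rw [vectorField_apply, Fintype.sum_sum_type]
  simp only [oddEuler_inl, oddEuler_inr, map_zero, LinearMap.zero_apply, Finset.sum_const_zero,
    zero_add, map_smul, LinearMap.smul_apply]
  rw [Finset.sum_smul, ← Finset.sum_subset (Finset.subset_univ u)]
  · refine Finset.sum_congr rfl fun k hk => ?_
    rw [mul_singleton_pd_inr hk, binom_zero_left, zero_add, Nat.cast_one, one_smul]
  · intro k _ hk
    rw [pd_inr_mono_of_notMem hk, map_zero, smul_zero]

theorem bracket_oddEuler_inl (c : Fin n → F) (α : Fin n → ℕ) (u : Finset (Fin n)) (i : Fin n) :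
    bracket (oddEuler c) (ham (mono F (α, u))) (Sum.inl i) =
      (∑ k ∈ u.erase i, c k) • ham (mono F (α, u)) (Sum.inl i) := by
  rw [bracket_apply, oddEuler_inl, map_zero, sub_zero, ham_inl, map_neg, smul_neg]
  by_cases h : i ∈ u
  · rw [pd_inr_mono_of_mem h, map_smul, vectorField_oddEuler, smul_comm]
  · rw [pd_inr_mono_of_notMem h, map_zero, smul_zero]

theorem bracket_oddEuler_inr (c : Fin n → F) (α : Fin n → ℕ) (u : Finset (Fin n)) (i : Fin n) :
    bracket (oddEuler c) (ham (mono F (α, u))) (Sum.inr i) =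
      (∑ k ∈ u, c k - c i) • ham (mono F (α, u)) (Sum.inr i) := by
  have hgen : vectorField F (ham (mono F (α, u))) (mono F (0, {i})) =
      ham (mono F (α, u)) (Sum.inr i) := vectorField_gen _ (Sum.inr i)
  rw [bracket_apply, oddEuler_inr, map_smul, hgen, sub_smul, ham_inr, sub_left_inj]
  obtain hα | hα := Nat.eq_zero_or_pos (α i)
  · rw [pd_inl_mono_of_apply_eq_zero hα, map_zero, smul_zero]
  · obtain ⟨β, rfl⟩ := exists_eq_add_single (c := 1) hα
    rw [pd_inl_mono_add_single_one, vectorField_oddEuler]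

theorem pdField_oddEuler (c : Fin n → F) (i : Fin n) : pdField i (oddEuler c) = 0 := by
  ext r : 1
  rw [pdField_apply]
  rcases r with k | k
  · rw [oddEuler_inl, map_zero, Pi.zero_apply]
  · rw [oddEuler_inr, map_smul, pd_inl_mono_of_apply_eq_zero rfl, smul_zero, Pi.zero_apply]

theorem coeff_eq_zero_of_pdField {z : Idx n → O F n} (h : ∀ i, pdField i z = 0) {r : Idx n}
    {a : Mono n} (ha : a.1 ≠ 0) : coeff a (z r) = 0 := by
  obtain ⟨i, hi⟩ := Function.ne_iff.1 ha
  exact coeff_eq_zero_of_pd_inl (congrFun (h i) r) hi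

theorem exists_eq_oddEuler {p : ℕ} [Fact p.Prime] [CharP F p] (hp : 3 < p) {z : Idx n → O F n}
    (hconst : ∀ i, pdField i z = 0)
    (htoral : ∀ i, bracket (ham (mono F (elem i i))) z = 0) : ∃ c, z = oddEuler c := by
  have hsupp : ∀ r a, coeff a (z r) ≠ 0 → ∃ k, r = Sum.inr k ∧ a = (0, {k}) := by
    rintro r ⟨α, v⟩ ha
    obtain rfl : α = 0 := by_contra fun hα => ha (coeff_eq_zero_of_pdField hconst hα)
    have hweight : fieldWeight (0, v) r = 0 := funext fun i => by
      refine fieldWeight_const_eq_of_cast (F := F) hp (x := 0) (by simp) ?_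
      have hcoeff := coeff_bracket_toral i z r (0, v)
      rw [htoral, Pi.zero_apply, map_zero] at hcoeff
      rw [Int.cast_zero, (mul_eq_zero.1 hcoeff.symm).resolve_right ha]
    obtain ⟨k, rfl, rfl⟩ := eq_inr_of_fieldWeight_eq_zero hweight
    exact ⟨k, rfl, rfl⟩
  refine ⟨fun k => coeff (0, {k}) (z (Sum.inr k)), funext fun r => ?_⟩
  rcases r with k | k
  · refine coeff_ext fun a => ?_
    rw [oddEuler_inl, map_zero]
    by_contra hne
    obtain ⟨l, hl, -⟩ := hsupp _ _ hne
    cases hl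
  · refine eq_coeff_smul_mono fun a hne => ?_
    obtain ⟨l, hl, rfl⟩ := hsupp _ _ hne
    cases hl
    rfl

theorem eq_zero_of_bracket_oddEuler (htwo : (2 : F) ≠ 0) (hn : 3 ≤ n) {c : Fin n → F}
    (hcubic : ∀ u : Finset (Fin n), u.card = 3 →
      bracket (oddEuler c) (ham (mono F (0, u))) = 0) : c = 0 := by
  ext k
  obtain ⟨u, hku, hu⟩ := Finset.exists_superset_card_eq (s := {k}) (n := 3) (by simp) (by simpa)
  rw [Finset.singleton_subset_iff] at hku
  have hdiff : ∀ i ∈ u, ∑ l ∈ u, c l - c i = 0 := by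
    intro i hi
    have hinl := congrFun (hcubic u hu) (Sum.inl i)
    rw [bracket_oddEuler_inl, ham_inl, pd_inr_mono_of_mem hi, Pi.zero_apply, smul_neg, neg_eq_zero,
      smul_smul] at hinl
    have hcoeff := congrArg (coeff (0, u.erase i)) hinl
    rw [map_smul, coeff_mono, if_pos rfl, map_zero, smul_eq_mul, mul_one] at hcoeff
    rw [← Finset.sum_erase_eq_sub hi]
    exact (mul_eq_zero.1 hcoeff).resolve_right (pow_ne_zero _ (by simp))
  -- Summing the relations `∑ c = c_i` over the three elements `i` of `u` gives `2 ∑ c = 0`.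
  have hsum : ∑ l ∈ u, c l = 0 := by
    have htotal := Finset.sum_eq_zero hdiff
    rw [Finset.sum_sub_distrib, Finset.sum_const, hu, nsmul_eq_mul] at htotal
    refine (mul_eq_zero.1 (?_ : (2 : F) * ∑ l ∈ u, c l = 0)).resolve_left htwo
    push_cast at htotal
    linear_combination htotal
  simpa [hsum] using hdiff k hku

theorem eq_zero_of_centralizes {p : ℕ} [Fact p.Prime] [CharP F p] (hp : 3 < p) (hn : 3 ≤ n)
    {z : Idx n → O F n} (hconst : ∀ i, pdField i z = 0)
    (htoral : ∀ i, bracket (ham (mono F (elem i i))) z = 0)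
    (hcubic : ∀ u : Finset (Fin n), u.card = 3 → bracket (ham (mono F (0, u))) z = 0) : z = 0 := by
  have htwo : (2 : F) ≠ 0 := two_ne_zero_of_three_lt hp
  obtain ⟨c, rfl⟩ := exists_eq_oddEuler hp hconst htoral
  obtain rfl := eq_zero_of_bracket_oddEuler htwo hn fun u hu => by
    rw [bracket_swap, hcubic u hu, neg_zero]
  ext r : 1
  rcases r <;> simp

/-! ### Derivations on odd functions -/

/-- The derivations `HO → W` on even parts, as maps of the odd functions `a` rather than of the
fields `T_H(a)`; the values may have arbitrary exponents, and only the odd part of `𝒪(n,n;t)`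
matters. -/
structure IsHamDer (p : ℕ) (t : Fin n → ℕ) (D : O F n →ₗ[F] (Idx n → O F n)) : Prop where
  map_mem : ∀ a ∈ oddTrunc F p t, D a ∈ evenFields F n
  leibniz : ∀ a ∈ oddTrunc F p t, ∀ b ∈ oddTrunc F p t,
    D (poisson a b) = bracket (ham a) (D b) - bracket (ham b) (D a)

/-- The inner derivation `a ↦ [w, T_H(a)]`. -/
noncomputable def innerDer : (Idx n → O F n) →ₗ[F] O F n →ₗ[F] (Idx n → O F n) :=
  bracket.compl₂ ham

theorem innerDer_apply (w : Idx n → O F n) (a : O F n) : innerDer w a = bracket w (ham a) := rfl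

theorem innerDer_const (w : Idx n → O F n) (i : Fin n) :
    innerDer w (mono F (0, {i})) = pdField i w := by
  rw [innerDer_apply, bracket_swap, bracket_ham_const, neg_neg]

/-- The map `(ad ∂_i) ^ k` on Hamiltonian fields. -/
noncomputable def adPartialPow (i : Fin n) (k : ℕ) : O F n →ₗ[F] (Idx n → O F n) :=
  (pdField i ^ k) ∘ₗ ham

theorem adPartialPow_apply (i : Fin n) (k : ℕ) (a : O F n) :
    adPartialPow i k a = (pdField i ^ k) (ham a) := rfl

theorem adPartialPow_mono_of_lt {i : Fin n} {k : ℕ} {α : Fin n → ℕ} (h : α i < k)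
    (u : Finset (Fin n)) : adPartialPow i k (mono F (α, u)) = 0 := by
  have hpd : (pd F (Sum.inl i) ^ k) (mono F (α, u)) = 0 := coeff_ext fun ⟨β, v⟩ => by
    rw [coeff_pd_inl_pow, coeff_mono, if_neg, map_zero]
    rintro ⟨⟩
    simp at h
  rw [adPartialPow_apply, pdField_pow_ham, hpd, map_zero]

theorem coeff_adPartialPow_power {p : ℕ} [Fact p.Prime] (i l : Fin n) (k m : ℕ) :
    coeff (0, ∅) (adPartialPow l (p ^ m) (mono F (Pi.single i (p ^ k), {i})) (Sum.inl i)) =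
      if l = i ∧ m = k then -1 else 0 := by
  have hp := (Fact.out : p.Prime)
  have hmono : ((Pi.single i (p ^ k), ∅) : Mono n) = (0 + Pi.single l (p ^ m), ∅) ↔
      l = i ∧ m = k := by
    rw [zero_add, Prod.mk.injEq, and_iff_left rfl]
    refine ⟨fun h => ?_, by rintro ⟨rfl, rfl⟩; rfl⟩
    have hl := congrFun h l
    rw [Pi.single_eq_same] at hl
    obtain rfl | hli := eq_or_ne l i
    · rw [Pi.single_eq_same] at hl
      exact ⟨rfl, (Nat.pow_right_injective hp.two_le hl).symm⟩
    · rw [Pi.single_eq_of_ne hli] at hl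
      exact absurd hl.symm (pow_ne_zero _ hp.ne_zero)
  rw [adPartialPow_apply, pdField_pow_apply, coeff_pd_inl_pow, ham_inl, pd_inr_mono_singleton,
    map_neg, coeff_mono, if_congr hmono rfl rfl]
  split_ifs
  · rfl
  · exact neg_zero

/-- The combination `∑ c_{ik} (ad ∂_i) ^ (p ^ k)` over `1 ≤ k < t_i`. -/
noncomputable def adPartialSum (p : ℕ) (t : Fin n → ℕ) (c : Fin n → ℕ → F) :
    O F n →ₗ[F] (Idx n → O F n) :=
  ∑ i, ∑ k ∈ Finset.Ico 1 (t i), c i k • adPartialPow i (p ^ k)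

theorem adPartialSum_apply (p : ℕ) (t : Fin n → ℕ) (c : Fin n → ℕ → F) (a : O F n) :
    adPartialSum p t c a = ∑ i, ∑ k ∈ Finset.Ico 1 (t i), c i k • adPartialPow i (p ^ k) a := by
  simp only [adPartialSum, LinearMap.sum_apply, LinearMap.smul_apply]

theorem adPartialSum_mono_of_lt {p : ℕ} [Fact p.Prime] (t : Fin n → ℕ) (c : Fin n → ℕ → F)
    {α : Fin n → ℕ} (h : ∀ i, α i < p) (u : Finset (Fin n)) :
    adPartialSum p t c (mono F (α, u)) = 0 := by
  rw [adPartialSum_apply]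
  refine Finset.sum_eq_zero fun i _ => Finset.sum_eq_zero fun k hk => ?_
  have hk1 : k ≠ 0 := Nat.one_le_iff_ne_zero.1 (Finset.mem_Ico.1 hk).1
  rw [adPartialPow_mono_of_lt ((h i).trans_le (Nat.le_self_pow hk1 p)), smul_zero]

theorem coeff_adPartialSum_power {p : ℕ} [Fact p.Prime] {t : Fin n → ℕ} (c : Fin n → ℕ → F)
    {i : Fin n} {k : ℕ} (hk : k ∈ Finset.Ico 1 (t i)) :
    coeff (0, ∅) (adPartialSum p t c (mono F (Pi.single i (p ^ k), {i})) (Sum.inl i)) =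
      -c i k := by
  simp only [adPartialSum_apply, Finset.sum_apply, map_sum, Pi.smul_apply, map_smul,
    coeff_adPartialPow_power, smul_eq_mul]
  rw [Finset.sum_eq_single i, Finset.sum_eq_single k]
  · simp
  · intro m _ hm
    simp [hm]
  · exact fun h => absurd hk h
  · intro l _ hl
    simp [hl]
  · exact fun h => absurd (Finset.mem_univ _) h

section

variable {p : ℕ} {t : Fin n → ℕ} {D E : O F n →ₗ[F] (Idx n → O F n)}

theorem IsHamDer.sub (hD : IsHamDer p t D) (hE : IsHamDer p t E) : IsHamDer p t (D - E) where
  map_mem a ha := sub_mem (hD.map_mem a ha) (hE.map_mem a ha)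
  leibniz a ha b hb := by
    simp only [LinearMap.sub_apply, hD.leibniz a ha b hb, hE.leibniz a ha b hb, map_sub]
    abel

theorem IsHamDer.smul (c : F) (hD : IsHamDer p t D) : IsHamDer p t (c • D) where
  map_mem a ha := Submodule.smul_mem _ _ (hD.map_mem a ha)
  leibniz a ha b hb := by
    simp only [LinearMap.smul_apply, hD.leibniz a ha b hb, map_smul, smul_sub]

theorem IsHamDer.sum {ι : Type*} {s : Finset ι} {E : ι → O F n →ₗ[F] (Idx n → O F n)}
    (hE : ∀ i ∈ s, IsHamDer p t (E i)) : IsHamDer p t (∑ i ∈ s, E i) where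
  map_mem a ha := by
    rw [LinearMap.sum_apply]
    exact sum_mem fun i hi => (hE i hi).map_mem a ha
  leibniz a ha b hb := by
    simp only [LinearMap.sum_apply, map_sum, ← Finset.sum_sub_distrib]
    exact Finset.sum_congr rfl fun i hi => (hE i hi).leibniz a ha b hb

theorem isHamDer_innerDer {w : Idx n → O F n} (hw : w ∈ evenFields F n) :
    IsHamDer p t (innerDer w) where
  map_mem a ha := bracket_mem hw (ham_mem ha.2)
  leibniz a ha b hb := by
    rw [innerDer_apply, ham_poisson ha.2 hb.2, bracket_bracket hw (ham_mem ha.2) (ham_mem hb.2),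
      innerDer_apply, innerDer_apply, bracket_swap (bracket w (ham a))]
    abel

variable [Fact p.Prime] [CharP F p]

theorem isHamDer_adPartialPow (i : Fin n) (k : ℕ) :
    IsHamDer p t (adPartialPow (F := F) i (p ^ k)) where
  map_mem a ha := pdField_pow_mem i _ (ham_mem ha.2)
  leibniz a ha b hb := by
    rw [adPartialPow_apply, ham_poisson ha.2 hb.2,
      pdField_pow_bracket p i k (ham_mem ha.2) (ham_mem hb.2), adPartialPow_apply,
      adPartialPow_apply, bracket_swap _ (ham b)]
    abel

theorem isHamDer_adPartialSum (c : Fin n → ℕ → F) : IsHamDer p t (adPartialSum p t c) :=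
  IsHamDer.sum fun i _ => IsHamDer.sum fun k _ => (isHamDer_adPartialPow i k).smul _

end

theorem const_mem {p : ℕ} {t : Fin n → ℕ} {u : Finset (Fin n)} (hu : Odd u.card) :
    mono F (0, u) ∈ oddTrunc F p t := mono_mem_oddTrunc ⟨fun _ => Nat.zero_le _, hu⟩

theorem elem_mem {p : ℕ} [Fact p.Prime] {t : Fin n → ℕ} (ht : ∀ i, 1 ≤ t i) (i j : Fin n) :
    mono F (elem i j) ∈ oddTrunc F p t := by
  refine mono_mem_oddTrunc ⟨fun l => ?_, by simp⟩
  change (Pi.single i 1 : Fin n → ℕ) l ≤ p ^ t l - 1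
  obtain rfl | hl := eq_or_ne l i
  · rw [Pi.single_eq_same]
    exact Nat.le_sub_one_of_lt (Nat.one_lt_pow (Nat.one_le_iff_ne_zero.1 (ht l))
      (Fact.out : p.Prime).one_lt)
  · rw [Pi.single_eq_of_ne hl]
    exact Nat.zero_le _

section

variable {p : ℕ} {t : Fin n → ℕ} {D : O F n →ₗ[F] (Idx n → O F n)}

theorem IsHamDer.map_pd (hD : IsHamDer p t D) (hconst : ∀ i, D (mono F (0, {i})) = 0) (i : Fin n)
    {a : O F n} (ha : a ∈ oddTrunc F p t) : D (pd F (Sum.inl i) a) = pdField i (D a) := by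
  have hleibniz := hD.leibniz _ (const_mem (u := {i}) (by simp)) a ha
  rwa [poisson_const, hconst, map_zero, sub_zero, bracket_ham_const, map_neg, neg_inj] at hleibniz

theorem IsHamDer.exists_kill_const (hD : IsHamDer p t D) :
    ∃ w ∈ evenFields F n, ∀ i, (D - innerDer w) (mono F (0, {i})) = 0 := by
  have hmem (i : Fin n) : mono F (0, {i}) ∈ oddTrunc F p t := const_mem (by simp)
  obtain ⟨w, hw, hpd⟩ := exists_pdField_eq (fun i => D (mono F (0, {i})))
    (fun i => hD.map_mem _ (hmem i)) fun i j => by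
      have hleibniz := hD.leibniz _ (hmem i) _ (hmem j)
      rw [poisson_const, pd_inl_mono_of_apply_eq_zero rfl, neg_zero, map_zero, bracket_ham_const,
        bracket_ham_const, sub_neg_eq_add, eq_comm, neg_add_eq_zero] at hleibniz
      exact hleibniz
  exact ⟨w, hw, fun i => by rw [LinearMap.sub_apply, innerDer_const, hpd, sub_self]⟩

theorem abs_monoWeight_le_two {a : Mono n} {i : Fin n} (h : a.1 i ≤ 2) : |monoWeight a i| ≤ 2 := by
  rw [monoWeight, abs_le]
  split_ifs <;> omega

theorem eq_zero_of_bracket_toral {i : Fin n} {c : F} {f y : Idx n → O F n}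
    (hf : bracket (ham (mono F (elem i i))) f - c • f = y)
    (hy : bracket (ham (mono F (elem i i))) y = c • y) : y = 0 := by
  refine funext fun r => coeff_ext fun a => ?_
  have hfa := congrArg (coeff a) (congrFun hf r)
  have hya := congrArg (coeff a) (congrFun hy r)
  rw [Pi.sub_apply, map_sub, coeff_bracket_toral, Pi.smul_apply, map_smul, smul_eq_mul] at hfa
  rw [coeff_bracket_toral, Pi.smul_apply, map_smul, smul_eq_mul] at hya
  rw [Pi.zero_apply, map_zero]
  by_cases hc : (fieldWeight a r i : F) = c
  · rw [← hfa, hc, sub_self]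
  · by_contra hne
    exact hc (mul_right_cancel₀ hne hya)

theorem poisson_toral_mono (i : Fin n) (a : Mono n) :
    poisson (mono F (elem i i)) (mono F a) = (monoWeight a i : F) • mono F a := by
  rw [poisson_toral, diagonal_mono]

theorem vectorField_const (f : Idx n → O F n) (j : Fin n) :
    vectorField F f (mono F (0, {j})) = f (Sum.inr j) := vectorField_gen f (Sum.inr j)

theorem ham_elem_inr (i j : Fin n) : ham (mono F (elem i j)) (Sum.inr i) = mono F (0, {j}) := by
  rw [ham_inr, pd_inl_elem]

theorem ham_elem_inr_of_ne {i k : Fin n} (h : k ≠ i) (j : Fin n) :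
    ham (mono F (elem i j)) (Sum.inr k) = 0 := by
  rw [ham_inr, pd_inl_elem_of_ne h]

theorem poisson_elem_elem (i j k : Fin n) : poisson (mono F (elem i j)) (mono F (elem j k)) =
    (if k = i then mono F (elem j j) else 0) - mono F (elem i k) := by
  rw [poisson_elem, pd_inl_elem, mul_mono_empty_left, binom_zero_right, Nat.cast_one, one_smul,
    add_zero]
  obtain rfl | h := eq_or_ne k i
  · rw [pd_inr_mono_singleton, mul_mono_empty_right, binom_zero_left, Nat.cast_one, one_smul,
      zero_add, if_pos rfl]
  · rw [pd_inr_mono_singleton_of_ne h.symm, map_zero, if_neg h]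

theorem ham_const_inl_ne_zero {u : Finset (Fin n)} {k : Fin n} (hk : k ∈ u) :
    ham (mono F (0, u)) (Sum.inl k) ≠ 0 := by
  intro h
  rw [ham_inl, pd_inr_mono_of_mem hk, neg_eq_zero] at h
  have hcoeff := congrArg (coeff (0, u.erase k)) h
  rw [map_smul, coeff_mono, if_pos rfl, smul_eq_mul, mul_one, map_zero] at hcoeff
  exact pow_ne_zero _ (neg_ne_zero.2 one_ne_zero) hcoeff

theorem bracket_ham_elem_inl (r s : Fin n) (f : Idx n → O F n) :
    bracket (ham (mono F (elem r s))) f (Sum.inl s) =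
      vectorField F (ham (mono F (elem r s))) (f (Sum.inl s)) + f (Sum.inl r) := by
  have hgen : vectorField F f (mono F (Pi.single r 1, ∅)) = f (Sum.inl r) :=
    vectorField_gen f (Sum.inl r)
  rw [bracket_apply, ham_inl, pd_inr_mono_singleton, map_neg, hgen, sub_neg_eq_add]

theorem eq_single_of_coeff_ne_zero {f : Idx n → O F n} {s : Idx n} {a : Mono n}
    (h : ∀ r b, coeff b (f r) ≠ 0 → r = s ∧ b = a) :
    f = Pi.single s (coeff a (f s) • mono F a) := by
  refine funext fun r => ?_
  obtain rfl | hr := eq_or_ne r s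
  · rw [Pi.single_eq_same]
    exact eq_coeff_smul_mono fun b hb => (h _ b hb).2
  · rw [Pi.single_eq_of_ne hr]
    refine coeff_ext fun b => ?_
    rw [map_zero]
    exact by_contra fun hb => hr (h r b hb).1

theorem innerDer_oddEuler_elem (c : Fin n → F) (i j : Fin n) :
    innerDer (oddEuler c) (mono F (elem i j)) =
      Pi.single (Sum.inr i) ((c j - c i) • mono F (0, {j})) := by
  rw [innerDer_apply]
  refine funext fun r => ?_
  rcases r with k | k
  · rw [bracket_oddEuler_inl, Pi.single_eq_of_ne (by simp)]
    obtain rfl | h := eq_or_ne k j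
    · simp
    · rw [ham_inl, pd_inr_mono_singleton_of_ne h, neg_zero, smul_zero]
  · rw [bracket_oddEuler_inr, Finset.sum_singleton]
    obtain rfl | h := eq_or_ne k i
    · rw [Pi.single_eq_same, ham_elem_inr]
    · rw [Pi.single_eq_of_ne (by simpa using h), ham_elem_inr_of_ne h, smul_zero]

theorem innerDer_oddEuler_const (c : F) (u : Finset (Fin n)) :
    innerDer (oddEuler fun _ => c) (mono F (0, u)) =
      (((u.card - 1 : ℕ) : F) * c) • ham (mono F (0, u)) := by
  rw [innerDer_apply]
  refine funext fun r => ?_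
  rw [Pi.smul_apply]
  rcases r with k | k
  · rw [bracket_oddEuler_inl]
    by_cases h : k ∈ u
    · rw [Finset.sum_const, Finset.card_erase_of_mem h, nsmul_eq_mul]
    · rw [ham_inl, pd_inr_mono_of_notMem h, neg_zero, smul_zero, smul_zero]
  · rw [bracket_oddEuler_inr, ham_inr, pd_inl_mono_of_apply_eq_zero rfl, smul_zero, smul_zero]

variable [Fact p.Prime]

theorem IsHamDer.pdField_elem (hD : IsHamDer p t D) (ht : ∀ i, 1 ≤ t i)
    (hconst : ∀ i, D (mono F (0, {i})) = 0) (i j l : Fin n) :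
    pdField l (D (mono F (elem i j))) = 0 := by
  rw [← hD.map_pd hconst l (elem_mem ht i j)]
  obtain rfl | h := eq_or_ne l i
  · rw [pd_inl_elem, hconst]
  · rw [pd_inl_elem_of_ne h, map_zero]

theorem IsHamDer.fieldWeight_eq (hD : IsHamDer p t D) (ht : ∀ i, 1 ≤ t i)
    (htoral : ∀ i, D (mono F (elem i i)) = 0) {a b : Mono n} (ha : mono F a ∈ oddTrunc F p t)
    {r : Idx n} (hb : coeff b (D (mono F a) r) ≠ 0) (i : Fin n) :
    (fieldWeight b r i : F) = monoWeight a i := by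
  have hleibniz := hD.leibniz _ (elem_mem ht i i) _ ha
  rw [htoral, map_zero, sub_zero, poisson_toral_mono, map_smul] at hleibniz
  have hcoeff := congrArg (coeff b) (congrFun hleibniz r)
  rw [coeff_bracket_toral, Pi.smul_apply, map_smul, smul_eq_mul] at hcoeff
  exact (mul_right_cancel₀ hb hcoeff).symm

theorem IsHamDer.exists_const_of_coeff_ne_zero (hD : IsHamDer p t D) (ht : ∀ i, 1 ≤ t i)
    (htoral : ∀ i, D (mono F (elem i i)) = 0) {a b : Mono n} (ha : mono F a ∈ oddTrunc F p t)
    (hpd : ∀ i, pdField i (D (mono F a)) = 0) {r : Idx n} (hb : coeff b (D (mono F a) r) ≠ 0) :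
    ∃ v, b = (0, v) ∧ (v.card : ZMod 2) = mu r ∧
      ∀ i, (fieldWeight (0, v) r i : F) = monoWeight a i := by
  obtain ⟨β, v⟩ := b
  obtain rfl : β = 0 := by_contra fun hβ => hb (coeff_eq_zero_of_pdField hpd hβ)
  exact ⟨v, rfl, mem_parityPart_iff.1 (mem_evenFields.1 (hD.map_mem _ ha) r) _ hb,
    hD.fieldWeight_eq ht htoral ha hb⟩

theorem IsHamDer.bracket_map_toral_eq_zero (hD : IsHamDer p t D) (ht : ∀ i, 1 ≤ t i) {i : Fin n}
    (hi : bracket (ham (mono F (elem i i))) (D (mono F (elem i i))) = 0) {a : Mono n}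
    (ha : mono F a ∈ oddTrunc F p t) : bracket (ham (mono F a)) (D (mono F (elem i i))) = 0 := by
  have htoral := elem_mem (F := F) (p := p) ht i i
  have hleibniz := hD.leibniz _ htoral _ ha
  have hjacobi := bracket_bracket (ham_mem htoral.2) (ham_mem ha.2) (hD.map_mem _ htoral)
  rw [poisson_toral_mono, map_smul] at hleibniz
  rw [hi, map_zero, add_zero, ← ham_poisson htoral.2 ha.2, poisson_toral_mono, map_smul, map_smul,
    LinearMap.smul_apply] at hjacobi
  exact eq_zero_of_bracket_toral (by rw [hleibniz, sub_sub_cancel]) hjacobi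

theorem IsHamDer.elem_cocycle (hD : IsHamDer p t D) (ht : ∀ i, 1 ≤ t i)
    (htoral : ∀ i, D (mono F (elem i i)) = 0) {d : Fin n → Fin n → F}
    (hd : ∀ i j, D (mono F (elem i j)) = Pi.single (Sum.inr i) (d i j • mono F (0, {j})))
    (i j k : Fin n) : d i k = d i j + d j k := by
  obtain rfl | hij := eq_or_ne i j
  · have hii := congrArg (coeff (0, {i})) (congrFun (hd i i) (Sum.inr i))
    rw [htoral, Pi.single_eq_same, map_smul, coeff_mono, if_pos rfl, smul_eq_mul, mul_one,
      Pi.zero_apply, map_zero] at hii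
    rw [← hii, zero_add]
  have hleibniz := hD.leibniz _ (elem_mem ht i j) _ (elem_mem ht j k)
  have hpoisson : D (poisson (mono F (elem i j)) (mono F (elem j k))) = -D (mono F (elem i k)) := by
    rw [poisson_elem_elem, map_sub, apply_ite D, htoral, map_zero, ite_self, zero_sub]
  rw [hpoisson] at hleibniz
  have hinr := congrFun hleibniz (Sum.inr i)
  rw [Pi.sub_apply, bracket_apply, bracket_apply, ham_elem_inr, vectorField_const,
    ham_elem_inr_of_ne hij, hd i j, hd j k, Pi.single_eq_of_ne (by simpa using hij),
    Pi.single_eq_same, Pi.single_eq_same, map_smul, vectorField_const, ham_elem_inr, Pi.neg_apply,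
    hd i k, Pi.single_eq_same] at hinr
  have hcoeff := congrArg (coeff (0, {k})) hinr
  simp only [map_neg, map_sub, map_smul, map_zero, coeff_mono, if_true, smul_eq_mul,
    mul_one] at hcoeff
  linear_combination -hcoeff

theorem IsHamDer.map_const_of_card_eq (hD : IsHamDer p t D) (ht : ∀ i, 1 ≤ t i)
    (helem : ∀ i j, D (mono F (elem i j)) = 0) {u₀ : Finset (Fin n)} (hodd : Odd u₀.card)
    (h₀ : D (mono F (0, u₀)) = 0) {u : Finset (Fin n)} (hu : u.card = u₀.card) :
    D (mono F (0, u)) = 0 := by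
  refine exchange_induction (P := fun u => D (mono F (0, u)) = 0) h₀ (fun v hv r hr s hs h => ?_)
    u hu
  have hleibniz := hD.leibniz _ (elem_mem ht r s) _ (const_mem (hv ▸ hodd))
  obtain ⟨ε, hε, hpoisson⟩ := exists_poisson_single_const (F := F) hr (v := {s}) (by simp [hs])
  rw [h, helem, map_zero, map_zero, sub_zero, hpoisson, map_smul] at hleibniz
  exact (smul_eq_zero.1 hleibniz).resolve_left hε

theorem IsHamDer.eq_of_map_const (hD : IsHamDer p t D) (ht : ∀ i, 1 ≤ t i)
    (helem : ∀ i j, D (mono F (elem i j)) = 0) {u : Finset (Fin n)} (hu : Odd u.card)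
    {c : Idx n → F} (hc : ∀ r, D (mono F (0, u)) r = c r • ham (mono F (0, u)) r) {r s : Fin n}
    (hr : r ∈ u) (hs : s ∈ u) : c (Sum.inl r) = c (Sum.inl s) := by
  obtain rfl | hrs := eq_or_ne r s
  · rfl
  have hmem : mono F (0, u) ∈ oddTrunc F p t := const_mem hu
  have hpoisson : poisson (mono F (elem r s)) (mono F (0, u)) = 0 := by
    rw [poisson_singleton_of_mem hs, pd_inl_mono_of_apply_eq_zero (Pi.single_eq_of_ne hrs.symm _),
      pd_inl_mono_of_apply_eq_zero rfl, map_zero, map_zero, LinearMap.zero_apply, sub_zero]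
  have hleibniz := congrFun (hD.leibniz _ (elem_mem ht r s) _ hmem) (Sum.inl s)
  have hham := congrFun (ham_poisson (elem_mem (F := F) (p := p) ht r s).2 hmem.2) (Sum.inl s)
  rw [hpoisson, map_zero, helem, map_zero, sub_zero, bracket_ham_elem_inl, hc, hc, map_smul]
    at hleibniz
  rw [hpoisson, map_zero, bracket_ham_elem_inl, Pi.zero_apply, eq_comm,
    add_eq_zero_iff_eq_neg] at hham
  rw [hham, smul_neg, Pi.zero_apply, eq_comm, neg_add_eq_zero] at hleibniz
  exact smul_left_injective F (ham_const_inl_ne_zero hr) hleibniz.symm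

theorem IsHamDer.exists_map_const_eq [CharP F p] (hD : IsHamDer p t D) (hp : 3 < p)
    (ht : ∀ i, 1 ≤ t i) (hconst : ∀ i, D (mono F (0, {i})) = 0)
    (htoral : ∀ i, D (mono F (elem i i)) = 0) {u : Finset (Fin n)} (hu : Odd u.card) :
    ∃ c : Idx n → F, ∀ r, D (mono F (0, u)) r = c r • ham (mono F (0, u)) r := by
  have hmem : mono F (0, u) ∈ oddTrunc F p t := const_mem hu
  have hsupp : ∀ r b, coeff b (D (mono F (0, u)) r) ≠ 0 →
      ∃ k ∈ u, r = Sum.inl k ∧ b = (0, u.erase k) := by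
    intro r b hb
    obtain ⟨v, rfl, hv, hweight⟩ := hD.exists_const_of_coeff_ne_zero ht htoral hmem
      (fun i => by rw [← hD.map_pd hconst i hmem, pd_inl_mono_of_apply_eq_zero rfl, map_zero]) hb
    obtain ⟨k, hk, rfl, rfl⟩ := eq_inl_of_fieldWeight_eq_const hu hv <| funext fun i =>
      fieldWeight_const_eq_of_cast hp (abs_monoWeight_le_two (Nat.zero_le 2)) (hweight i)
    exact ⟨k, hk, rfl, rfl⟩
  suffices h : ∀ r, ∃ c : F, D (mono F (0, u)) r = c • ham (mono F (0, u)) r from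
    ⟨fun r => (h r).choose, fun r => (h r).choose_spec⟩
  have hzero : ∀ r, (∀ k ∈ u, r ≠ Sum.inl k) → D (mono F (0, u)) r = 0 := fun r hr =>
    coeff_ext fun b => by
      rw [map_zero]
      by_contra hb
      obtain ⟨k, hk, h, -⟩ := hsupp r b hb
      exact hr k hk h
  rintro (k | k)
  · by_cases hk : k ∈ u
    · have hsign : ((-1) ^ (u.filter (· < k)).card : F) ≠ 0 :=
        pow_ne_zero _ (neg_ne_zero.2 one_ne_zero)
      refine ⟨-coeff (0, u.erase k) (D (mono F (0, u)) (Sum.inl k)) *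
        ((-1) ^ (u.filter (· < k)).card)⁻¹, ?_⟩
      rw [ham_inl, pd_inr_mono_of_mem hk, ← smul_neg, smul_smul, inv_mul_cancel_right₀ hsign,
        neg_smul_neg]
      refine eq_coeff_smul_mono fun b hb => ?_
      obtain ⟨l, -, h, rfl⟩ := hsupp _ b hb
      rw [Sum.inl.inj h]
    · exact ⟨0, (hzero _ fun l hl h => hk (by rwa [Sum.inl.inj h])).trans (zero_smul _ _).symm⟩
  · exact ⟨0, (hzero _ fun l _ => Sum.inr_ne_inl).trans (zero_smul _ _).symm⟩

theorem IsHamDer.map_const_eq_smul [CharP F p] (hD : IsHamDer p t D) (hp : 3 < p)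
    (ht : ∀ i, 1 ≤ t i) (hconst : ∀ i, D (mono F (0, {i})) = 0)
    (helem : ∀ i j, D (mono F (elem i j)) = 0) {u : Finset (Fin n)} (hu : Odd u.card) :
    ∃ c : F, D (mono F (0, u)) = c • ham (mono F (0, u)) := by
  obtain ⟨c, hc⟩ := hD.exists_map_const_eq hp ht hconst (fun i => helem i i) hu
  obtain ⟨k₀, hk₀⟩ := Finset.card_pos.1 hu.pos
  refine ⟨c (Sum.inl k₀), funext fun r => ?_⟩
  rw [hc, Pi.smul_apply]
  rcases r with k | k
  · by_cases hk : k ∈ u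
    · rw [hD.eq_of_map_const ht helem hu hc hk hk₀]
    · rw [ham_inl, pd_inr_mono_of_notMem hk, neg_zero, smul_zero, smul_zero]
  · rw [ham_inr, pd_inl_mono_of_apply_eq_zero rfl, smul_zero, smul_zero]

variable [CharP F p]

theorem IsHamDer.exists_kill_toral (hD : IsHamDer p t D) (hp : 3 < p) (hn : 3 ≤ n)
    (ht : ∀ i, 1 ≤ t i) (hconst : ∀ i, D (mono F (0, {i})) = 0) :
    ∃ w ∈ evenFields F n, (∀ i, (D - innerDer w) (mono F (0, {i})) = 0) ∧
      ∀ i, (D - innerDer w) (mono F (elem i i)) = 0 := by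
  obtain ⟨w, hw, hsupp, hinv⟩ := exists_toral_primitive (z := fun i => D (mono F (elem i i)))
    (fun i => hD.map_mem _ (elem_mem ht i i)) fun i j => by
      have hleibniz := hD.leibniz _ (elem_mem ht i i) _ (elem_mem ht j j)
      have hweight : monoWeight (elem j j) i = 0 := by
        simp [monoWeight, Pi.single_apply]
      rwa [poisson_toral_mono, hweight, Int.cast_zero, zero_smul, map_zero, eq_comm,
        sub_eq_zero] at hleibniz
  have hpd : ∀ i, pdField i w = 0 := fun i => funext fun r => coeff_ext fun a => by
    rw [pdField_apply, coeff_pd_inl, Pi.zero_apply, map_zero]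
    refine hsupp _ _ fun j => coeff_eq_zero_of_pdField (hD.pdField_elem ht hconst j j) fun h => ?_
    simpa using congrFun h i
  have hE := hD.sub (isHamDer_innerDer hw)
  have hEconst : ∀ i, (D - innerDer w) (mono F (0, {i})) = 0 := fun i => by
    rw [LinearMap.sub_apply, innerDer_const, hconst, hpd, sub_zero]
  have hEinv (i j) :
      bracket (ham (mono F (elem j j))) ((D - innerDer w) (mono F (elem i i))) = 0 := by
    rw [LinearMap.sub_apply, innerDer_apply, bracket_swap w, sub_neg_eq_add, hinv]
  exact ⟨w, hw, hEconst, fun i => eq_zero_of_centralizes hp hn (hE.pdField_elem ht hEconst i i)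
    (hEinv i) fun u hu => hE.bracket_map_toral_eq_zero ht (hEinv i i)
      (const_mem (by rw [hu]; decide))⟩

theorem IsHamDer.map_elem (hD : IsHamDer p t D) (hp : 3 < p) (ht : ∀ i, 1 ≤ t i)
    (hconst : ∀ i, D (mono F (0, {i})) = 0) (htoral : ∀ i, D (mono F (elem i i)) = 0)
    (i j : Fin n) : D (mono F (elem i j)) = Pi.single (Sum.inr i)
      (coeff (0, {j}) (D (mono F (elem i j)) (Sum.inr i)) • mono F (0, {j})) := by
  refine eq_single_of_coeff_ne_zero fun r b hb => ?_
  obtain rfl | hij := eq_or_ne i j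
  · rw [htoral, Pi.zero_apply, map_zero] at hb
    exact absurd rfl hb
  obtain ⟨v, rfl, -, hweight⟩ := hD.exists_const_of_coeff_ne_zero ht htoral (elem_mem ht i j)
    (hD.pdField_elem ht hconst i j) hb
  have hle (k) : (elem i j).1 k ≤ 2 := by
    change (Pi.single i 1 : Fin n → ℕ) k ≤ 2
    rw [Pi.single_apply]
    split_ifs <;> omega
  obtain ⟨rfl, rfl⟩ := eq_inr_of_fieldWeight_eq_elem hij <| funext fun k =>
    fieldWeight_const_eq_of_cast hp (abs_monoWeight_le_two (hle k)) (hweight k)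
  exact ⟨rfl, rfl⟩

theorem IsHamDer.exists_kill_elem (hD : IsHamDer p t D) (hp : 3 < p) (hn : 3 ≤ n)
    (ht : ∀ i, 1 ≤ t i) (hconst : ∀ i, D (mono F (0, {i})) = 0)
    (htoral : ∀ i, D (mono F (elem i i)) = 0) :
    ∃ w ∈ evenFields F n, (∀ i, (D - innerDer w) (mono F (0, {i})) = 0) ∧
      ∀ i j, (D - innerDer w) (mono F (elem i j)) = 0 := by
  obtain ⟨d, hd⟩ : ∃ d : Fin n → Fin n → F, ∀ i j,
      D (mono F (elem i j)) = Pi.single (Sum.inr i) (d i j • mono F (0, {j})) :=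
    ⟨_, hD.map_elem hp ht hconst htoral⟩
  let o : Fin n := ⟨0, by omega⟩
  refine ⟨oddEuler (d o), oddEuler_mem _, fun i => ?_, fun i j => ?_⟩
  · rw [LinearMap.sub_apply, innerDer_const, hconst, pdField_oddEuler, sub_zero]
  · rw [LinearMap.sub_apply, innerDer_oddEuler_elem, hd, hD.elem_cocycle ht htoral hd o i j,
      add_sub_cancel_left, sub_self]

theorem IsHamDer.exists_kill_cubic (hD : IsHamDer p t D) (hp : 3 < p) (hn : 3 ≤ n)
    (ht : ∀ i, 1 ≤ t i) (hconst : ∀ i, D (mono F (0, {i})) = 0)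
    (helem : ∀ i j, D (mono F (elem i j)) = 0) :
    ∃ w ∈ evenFields F n, (∀ i, (D - innerDer w) (mono F (0, {i})) = 0) ∧
      (∀ i j, (D - innerDer w) (mono F (elem i j)) = 0) ∧
      ∀ u : Finset (Fin n), u.card = 3 → (D - innerDer w) (mono F (0, u)) = 0 := by
  have htwo : (2 : F) ≠ 0 := two_ne_zero_of_three_lt hp
  obtain ⟨u₀, hu₀⟩ : ∃ u : Finset (Fin n), u.card = 3 :=
    (Finset.exists_subset_card_eq (s := .univ) (by simpa)).imp fun _ h => h.2
  have hodd : Odd u₀.card := by rw [hu₀]; decide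
  obtain ⟨c, hc⟩ := hD.map_const_eq_smul hp ht hconst helem hodd
  have hE := hD.sub (isHamDer_innerDer (oddEuler_mem fun _ : Fin n => c / 2))
  have hEelem (i j) :
      (D - innerDer (oddEuler fun _ : Fin n => c / 2)) (mono F (elem i j)) = 0 := by
    rw [LinearMap.sub_apply, helem, innerDer_oddEuler_elem, sub_self, zero_smul, Pi.single_zero,
      sub_zero]
  refine ⟨_, oddEuler_mem fun _ : Fin n => c / 2, fun i => ?_, hEelem, fun u hu =>
    hE.map_const_of_card_eq ht hEelem hodd ?_ (hu.trans hu₀.symm)⟩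
  · rw [LinearMap.sub_apply, innerDer_const, hconst, pdField_oddEuler, sub_zero]
  · rw [LinearMap.sub_apply, innerDer_oddEuler_const, hc, hu₀, show 3 - 1 = 2 from rfl,
      Nat.cast_ofNat, mul_div_cancel₀ c htwo, sub_self]

theorem IsHamDer.exists_kill_low_degree (hD : IsHamDer p t D) (hp : 3 < p) (hn : 3 ≤ n)
    (ht : ∀ i, 1 ≤ t i) :
    ∃ w ∈ evenFields F n, (∀ i, (D - innerDer w) (mono F (0, {i})) = 0) ∧
      (∀ i j, (D - innerDer w) (mono F (elem i j)) = 0) ∧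
      ∀ u : Finset (Fin n), u.card = 3 → (D - innerDer w) (mono F (0, u)) = 0 := by
  obtain ⟨w₁, hw₁, hconst₁⟩ := hD.exists_kill_const
  have hD₁ := hD.sub (isHamDer_innerDer hw₁)
  obtain ⟨w₂, hw₂, hconst₂, htoral₂⟩ := hD₁.exists_kill_toral hp hn ht hconst₁
  have hD₂ := hD₁.sub (isHamDer_innerDer hw₂)
  obtain ⟨w₃, hw₃, hconst₃, helem₃⟩ := hD₂.exists_kill_elem hp hn ht hconst₂ htoral₂
  have hD₃ := hD₂.sub (isHamDer_innerDer hw₃)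
  obtain ⟨w₄, hw₄, h⟩ := hD₃.exists_kill_cubic hp hn ht hconst₃ helem₃
  refine ⟨w₁ + w₂ + w₃ + w₄, add_mem (add_mem (add_mem hw₁ hw₂) hw₃) hw₄, ?_⟩
  simpa only [map_add, sub_sub] using h

end

/-- A derivation normalized by subtracting inner derivations and multiples of the
`(ad ∂_i) ^ (p ^ k)`: it vanishes on the `x_{i'}`, the `x_i x_{j'}` and the cubic `x^u`, and maps
`x_i^(p^k) x_{i'}` to a field without constant term `∂_i`. -/
structure IsNormal (p : ℕ) (t : Fin n → ℕ) (D : O F n →ₗ[F] (Idx n → O F n)) : Prop where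
  isHamDer : IsHamDer p t D
  map_const : ∀ i, D (mono F (0, {i})) = 0
  map_elem : ∀ i j, D (mono F (elem i j)) = 0
  map_cubic : ∀ u : Finset (Fin n), u.card = 3 → D (mono F (0, u)) = 0
  coeff_power : ∀ i k, 1 ≤ k → k < t i →
    coeff (0, ∅) (D (mono F (Pi.single i (p ^ k), {i})) (Sum.inl i)) = 0

theorem IsHamDer.exists_isNormal {p : ℕ} [Fact p.Prime] [CharP F p] {t : Fin n → ℕ}
    {D : O F n →ₗ[F] (Idx n → O F n)} (hD : IsHamDer p t D) (hp : 3 < p) (hn : 3 ≤ n)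
    (ht : ∀ i, 1 ≤ t i) :
    ∃ w ∈ evenFields F n, ∃ c, IsNormal p t (D - innerDer w - adPartialSum p t c) := by
  obtain ⟨w, hw, hconst, helem, hcubic⟩ := hD.exists_kill_low_degree hp hn ht
  have hp0 : 0 < p := by omega
  refine ⟨w, hw, fun i k =>
    -coeff (0, ∅) ((D - innerDer w) (mono F (Pi.single i (p ^ k), {i})) (Sum.inl i)), ?_⟩
  refine ⟨(hD.sub (isHamDer_innerDer hw)).sub (isHamDer_adPartialSum _), fun i => ?_,
    fun i j => ?_, fun u hu => ?_, fun i k hk hkt => ?_⟩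
  · rw [LinearMap.sub_apply, hconst, adPartialSum_mono_of_lt (α := 0) _ _ fun _ => hp0, sub_zero]
  · rw [LinearMap.sub_apply, helem, adPartialSum_mono_of_lt, sub_zero]
    intro l
    rw [Pi.single_apply]
    split_ifs <;> omega
  · rw [LinearMap.sub_apply, hcubic u hu, adPartialSum_mono_of_lt (α := 0) _ _ fun _ => hp0,
      sub_zero]
  · rw [LinearMap.sub_apply, Pi.sub_apply, map_sub,
      coeff_adPartialSum_power _ (Finset.mem_Ico.2 ⟨hk, hkt⟩), neg_neg, sub_self]

/-! ### Vanishing of normalized derivations -/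

theorem sum_add_single (α : Fin n → ℕ) (i : Fin n) (c : ℕ) :
    ∑ k, (α + Pi.single i c : Fin n → ℕ) k = ∑ k, α k + c := by
  simp only [Pi.add_apply, Finset.sum_add_distrib, Fintype.sum_pi_single']

theorem add_single_le {α m : Fin n → ℕ} {i : Fin n} {c : ℕ} (hα : α ≤ m) (h : α i + c ≤ m i) :
    α + Pi.single i c ≤ m := fun k => by
  obtain rfl | hk := eq_or_ne k i
  · simpa using h
  · simpa [hk] using hα k

theorem single_le {m : Fin n → ℕ} {i : Fin n} {c : ℕ} (h : c ≤ m i) : Pi.single i c ≤ m := by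
  simpa using add_single_le (α := 0) (fun _ => Nat.zero_le _) (by simpa using h)

theorem two_le_maxExp {p : ℕ} {t : Fin n → ℕ} (hp : 3 < p) (ht : ∀ i, 1 ≤ t i) (i : Fin n) :
    2 ≤ maxExp p t i := by
  have := Nat.le_self_pow (Nat.one_le_iff_ne_zero.1 (ht i)) p
  rw [maxExp]
  omega

theorem singleton_mem_oddMonos {p : ℕ} {t : Fin n → ℕ} {α : Fin n → ℕ} (h : α ≤ maxExp p t)
    (j : Fin n) : (α, {j}) ∈ oddMonos p t :=
  ⟨h, by simp⟩

/-- The standard degree of a monomial `x^(α) x^u`. -/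
def deg (a : Mono n) : ℕ := ∑ i, a.1 i + a.2.card

/-- The linear map `D` vanishes on the odd monomials of `𝒪(n,n;t)` of degree less than `N`. -/
def KillsBelow (p : ℕ) (t : Fin n → ℕ) (D : O F n →ₗ[F] (Idx n → O F n)) (N : ℕ) : Prop :=
  ∀ a ∈ oddMonos p t, deg a < N → D (mono F a) = 0

section

variable {p : ℕ} {t : Fin n → ℕ} {D : O F n →ₗ[F] (Idx n → O F n)}

theorem KillsBelow.map_of_poisson_eq_smul {N : ℕ} (hK : KillsBelow p t D N) (hD : IsHamDer p t D)
    {a b e : Mono n} {c : F} (h : poisson (mono F a) (mono F b) = c • mono F e) (hc : c ≠ 0)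
    (ha : a ∈ oddMonos p t) (hb : b ∈ oddMonos p t) (hdega : deg a < N) (hdegb : deg b < N) :
    D (mono F e) = 0 := by
  have hleibniz := hD.leibniz _ (mono_mem_oddTrunc ha) _ (mono_mem_oddTrunc hb)
  rw [h, hK a ha hdega, hK b hb hdegb, map_zero, map_zero, sub_zero, map_smul] at hleibniz
  exact (smul_eq_zero.1 hleibniz).resolve_left hc

theorem KillsBelow.map_of_choose {α : Fin n → ℕ} {i j l : Fin n} {c : ℕ}
    (hK : KillsBelow p t D (deg (α, {j}))) (hD : IsHamDer p t D) (hij : i ≠ j)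
    (hα : α ≤ maxExp p t) (hc : 2 ≤ c) (hcα : c < ∑ k, α k)
    (hl : l = i ∨ α l + 1 ≤ maxExp p t l) (h : ((α i).choose c : F) ≠ 0) :
    D (mono F (α, {j})) = 0 := by
  have hci : c ≤ α i := Nat.le_of_not_lt fun hlt =>
    h (by rw [Nat.choose_eq_zero_of_lt hlt, Nat.cast_zero])
  obtain ⟨β, rfl⟩ := exists_eq_add_single hci
  have hβl : β + Pi.single l 1 ≤ maxExp p t := by
    obtain rfl | hl := hl
    · exact (add_le_add le_rfl (Pi.single_mono _ (by omega))).trans hα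
    · exact add_single_le (le_self_add.trans hα)
        ((Nat.add_le_add_right (le_self_add (a := β l)) 1).trans hl)
  refine hK.map_of_poisson_eq_smul hD (poisson_single_add_single hij l c β)
    (neg_ne_zero.2 (by simpa using h)) (singleton_mem_oddMonos (le_add_self.trans hα) l)
    (singleton_mem_oddMonos hβl j) ?_ ?_ <;>
  simp only [deg, sum_add_single, Fintype.sum_pi_single', Finset.card_singleton] at hcα ⊢ <;>
  omega

theorem KillsBelow.map_of_choose_sub_choose {α : Fin n → ℕ} {u : Finset (Fin n)} {j : Fin n}
    {c : ℕ} (hK : KillsBelow p t D (deg (α, u))) (hD : IsHamDer p t D) (hu : Odd u.card)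
    (hj : j ∈ u) (hα : α ≤ maxExp p t) (hc : 1 ≤ c) (hcj : c + 1 ≤ maxExp p t j)
    (hdeg : c + 2 < deg (α, u)) (h : ((α j).choose c : F) - (α j).choose (c + 1) ≠ 0) :
    D (mono F (α, u)) = 0 := by
  have hcα : c ≤ α j := Nat.le_of_not_lt fun hlt => h (by
    rw [Nat.choose_eq_zero_of_lt hlt, Nat.choose_eq_zero_of_lt (by omega), Nat.cast_zero, sub_zero])
  obtain ⟨β, rfl⟩ := exists_eq_add_single hcα
  refine hK.map_of_poisson_eq_smul hD (poisson_single_of_mem hj c β) (by simpa using h)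
    (singleton_mem_oddMonos (single_le hcj) j) ⟨le_self_add.trans hα, hu⟩ ?_ ?_ <;>
  simp only [deg, sum_add_single, Fintype.sum_pi_single', Finset.card_singleton] at hdeg ⊢ <;>
  omega

theorem KillsBelow.pdField_map {a : Mono n} (hK : KillsBelow p t D (deg a))
    (hD : IsNormal p t D) (ha : a ∈ oddMonos p t) (i : Fin n) : pdField i (D (mono F a)) = 0 := by
  rw [← hD.isHamDer.map_pd hD.map_const i (mono_mem_oddTrunc ha)]
  obtain ⟨α, u⟩ := a
  obtain hα | hα := Nat.eq_zero_or_pos (α i)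
  · rw [pd_inl_mono_of_apply_eq_zero hα, map_zero]
  · obtain ⟨β, rfl⟩ := exists_eq_add_single (c := 1) hα
    rw [pd_inl_mono_add_single_one]
    refine hK _ ⟨le_self_add.trans ha.1, ha.2⟩ ?_
    simp only [deg, sum_add_single]
    omega

theorem KillsBelow.exists_fieldWeight_eq [Fact p.Prime] [CharP F p] {a : Mono n}
    (hK : KillsBelow p t D (deg a)) (hD : IsNormal p t D) (ht : ∀ i, 1 ≤ t i)
    (ha : a ∈ oddMonos p t) (h : D (mono F a) ≠ 0) :
    ∃ r v, coeff (0, v) (D (mono F a) r) ≠ 0 ∧ (v.card : ZMod 2) = mu r ∧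
      ∀ i, (fieldWeight (0, v) r i : F) = monoWeight a i := by
  obtain ⟨r, hr⟩ := Function.ne_iff.1 h
  obtain ⟨b, hb⟩ : ∃ b, coeff b (D (mono F a) r) ≠ 0 := not_forall.1 fun hz =>
    hr (coeff_ext fun b => by rw [hz, Pi.zero_apply, map_zero])
  obtain ⟨v, rfl, hv⟩ := hD.isHamDer.exists_const_of_coeff_ne_zero ht
    (fun i => hD.map_elem i i) (mono_mem_oddTrunc ha) (hK.pdField_map hD ha) hb
  exact ⟨r, v, hb, hv⟩

end

theorem choose_two_eq_one_of_cast_eq_neg_one {p : ℕ} [CharP F p] (hp : 3 < p) {a : ℕ}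
    (h : (a : F) = -1) : (a.choose 2 : F) = 1 := by
  have hchoose := two_mul_cast_choose_two (R := F) a
  rw [h] at hchoose
  exact mul_left_cancel₀ (two_ne_zero_of_three_lt hp) (by linear_combination hchoose)

section

variable {p : ℕ} {t : Fin n → ℕ} {D : O F n →ₗ[F] (Idx n → O F n)}

theorem KillsBelow.map_const (hp : 3 < p) (ht : ∀ i, 1 ≤ t i) {u : Finset (Fin n)}
    (hK : KillsBelow p t D (deg (0, u))) (hD : IsNormal p t D) (hu : Odd u.card)
    (hu₃ : 3 ≤ u.card) : D (mono F (0, u)) = 0 := by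
  obtain hu₃' | hu₅ : u.card = 3 ∨ 5 ≤ u.card := by
    obtain ⟨q, hq⟩ := hu
    omega
  · exact hD.map_cubic u hu₃'
  obtain ⟨v, hvu, hv⟩ := Finset.exists_subset_card_eq hu₃
  obtain ⟨i, hi⟩ : v.Nonempty := Finset.card_pos.1 (by omega)
  have hiw : i ∈ u \ v.erase i := Finset.mem_sdiff.2 ⟨hvu hi, Finset.notMem_erase i v⟩
  have herase : (u \ v.erase i).erase i = u \ v := by
    rw [← Finset.sdiff_insert, Finset.insert_erase hi]
  have hcard : (u \ v.erase i).card + 2 = u.card := by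
    have hsdiff := Finset.card_sdiff_add_card_eq_card ((Finset.erase_subset i v).trans hvu)
    rw [Finset.card_erase_of_mem hi, hv] at hsdiff
    exact hsdiff
  obtain ⟨ε, hε, hpoisson⟩ := exists_poisson_single_const (F := F) hiw (v := v)
    (by rw [herase]; exact Finset.disjoint_sdiff)
  rw [herase, Finset.union_sdiff_of_subset hvu] at hpoisson
  have hone : 1 ≤ maxExp p t i := (two_le_maxExp hp ht i).trans' one_le_two
  refine hK.map_of_poisson_eq_smul hD.isHamDer hpoisson hε
    ⟨single_le hone, by rw [hv]; decide⟩
    ⟨fun _ => Nat.zero_le _, (Nat.odd_add.1 (hcard ▸ hu)).2 even_two⟩ ?_ ?_ <;>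
  simp only [deg, Fintype.sum_pi_single', Pi.zero_apply, Finset.sum_const_zero, hv] <;>
  omega

variable [Fact p.Prime] [CharP F p]

theorem add_one_le_maxExp_of_cast_ne (ht : ∀ i, 1 ≤ t i) {α : Fin n → ℕ} (hα : α ≤ maxExp p t)
    {i : Fin n} (h : (α i : F) ≠ -1) : α i + 1 ≤ maxExp p t i := by
  refine Nat.succ_le_of_lt (lt_of_le_of_ne (hα i) fun heq => h ?_)
  rw [heq, maxExp, Nat.cast_sub (Nat.one_le_pow _ _ (Fact.out : p.Prime).pos), Nat.cast_pow,
    CharP.cast_eq_zero, zero_pow (Nat.one_le_iff_ne_zero.1 (ht i)), Nat.cast_one, zero_sub]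

theorem KillsBelow.map_of_three_le_card {α : Fin n → ℕ} {u : Finset (Fin n)}
    (hK : KillsBelow p t D (deg (α, u))) (hD : IsNormal p t D) (hp : 3 < p) (ht : ∀ i, 1 ≤ t i)
    (ha : (α, u) ∈ oddMonos p t) (hu : 3 ≤ u.card) : D (mono F (α, u)) = 0 := by
  obtain rfl | hα := eq_or_ne α 0
  · exact hK.map_const hp ht hD ha.2 hu
  have hsum : 0 < ∑ i, α i := Fintype.sum_pos (pos_of_ne_zero hα)
  obtain ⟨j, hj⟩ : u.Nonempty := Finset.card_pos.1 (by omega)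
  by_cases hαj : (α j : F) = -1
  · refine hK.map_of_choose_sub_choose hD.isHamDer ha.2 hj ha.1 le_rfl (two_le_maxExp hp ht j) ?_ ?_
    · simp only [deg]
      omega
    · rw [Nat.choose_one_right, choose_two_eq_one_of_cast_eq_neg_one hp hαj, hαj]
      intro h
      exact two_ne_zero_of_three_lt (R := F) hp (by linear_combination -h)
  · have hpoisson : poisson (mono F (α + Pi.single j 1, {j})) (mono F (0, u)) =
        (1 : F) • mono F (α, u) := by
      rw [poisson_singleton_of_mem hj, pd_inl_mono_add_single_one, mul_mono_empty_left,
        binom_zero_right, add_zero, pd_inl_mono_of_apply_eq_zero rfl, map_zero, sub_zero,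
        Nat.cast_one]
    refine hK.map_of_poisson_eq_smul hD.isHamDer hpoisson one_ne_zero (singleton_mem_oddMonos
      (add_single_le ha.1 (add_one_le_maxExp_of_cast_ne ht ha.1 hαj)) j)
      ⟨fun _ => Nat.zero_le _, ha.2⟩ ?_ ?_ <;>
    simp only [deg, sum_add_single, Pi.zero_apply, Finset.sum_const_zero,
      Finset.card_singleton] <;>
    omega

theorem exists_eq_single_of_sum_eq_one {α : Fin n → ℕ} (h : ∑ i, α i = 1) :
    ∃ i, α = Pi.single i 1 := by
  obtain ⟨i, -, hi⟩ := Finset.exists_ne_zero_of_sum_ne_zero (h.trans_ne one_ne_zero)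
  obtain ⟨β, rfl⟩ := exists_eq_add_single (Nat.one_le_iff_ne_zero.2 hi)
  rw [sum_add_single, Nat.add_eq_right, Fintype.sum_eq_zero_iff_of_nonneg zero_le] at h
  exact ⟨i, by rw [h, zero_add]⟩

theorem exists_eq_single_add_single_of_sum_eq_two {α : Fin n → ℕ} (h : ∑ i, α i = 2) :
    ∃ i l, α = Pi.single i 1 + Pi.single l 1 := by
  obtain ⟨l, -, hl⟩ := Finset.exists_ne_zero_of_sum_ne_zero (h.trans_ne two_ne_zero)
  obtain ⟨β, rfl⟩ := exists_eq_add_single (Nat.one_le_iff_ne_zero.2 hl)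
  rw [sum_add_single] at h
  obtain ⟨i, rfl⟩ := exists_eq_single_of_sum_eq_one (α := β) (by omega)
  exact ⟨i, l, rfl⟩

theorem KillsBelow.map_of_sum_eq_two {α : Fin n → ℕ} {j : Fin n}
    (hK : KillsBelow p t D (deg (α, {j}))) (hD : IsNormal p t D) (hp : 3 < p) (ht : ∀ i, 1 ≤ t i)
    (hα : α ≤ maxExp p t) (hsum : ∑ i, α i = 2) : D (mono F (α, {j})) = 0 := by
  by_contra hne
  obtain ⟨r, v, -, hv, hweight⟩ :=
    hK.exists_fieldWeight_eq hD ht (singleton_mem_oddMonos hα j) hne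
  replace hweight : fieldWeight (0, v) r = monoWeight (α, {j}) := funext fun i =>
    fieldWeight_const_eq_of_cast hp (abs_monoWeight_le_two
      (hsum ▸ Finset.single_le_sum (fun _ _ => Nat.zero_le _) (Finset.mem_univ i))) (hweight i)
  obtain ⟨i, l, rfl⟩ := exists_eq_single_add_single_of_sum_eq_two hsum
  have hw (k) : fieldWeight (0, v) r k =
      (if k = j then 1 else 0) - ((if k = i then 1 else 0) + (if k = l then 1 else 0)) := by
    simp [hweight, monoWeight, Pi.single_apply]
  obtain rfl | hij := eq_or_ne i j
  · exact fieldWeight_const_ne_neg_single hv l (funext fun k => by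
      simp [hw, Pi.single_apply])
  obtain rfl | hlj := eq_or_ne l j
  · exact fieldWeight_const_ne_neg_single hv i (funext fun k => by
      simp [hw, Pi.single_apply])
  obtain rfl | hil := eq_or_ne i l
  · have hbounds := fieldWeight_const_bounds v r i
    rw [hw, if_neg hij, if_pos rfl] at hbounds
    omega
  · exact hil (eq_of_fieldWeight_const_eq_neg_one (v := v) (r := r) (by simp [hw, hij, hil])
      (by simp [hw, hlj, hil.symm]))

end

section

variable {p : ℕ} [Fact p.Prime] [CharP F p] {t : Fin n → ℕ} {D : O F n →ₗ[F] (Idx n → O F n)}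

theorem KillsBelow.map_single_prime_pow_self {i : Fin n} {k : ℕ}
    (hK : KillsBelow p t D (deg (Pi.single i (p ^ k), {i}))) (hD : IsNormal p t D) (hp : 3 < p)
    (ht : ∀ i, 1 ≤ t i) (hk : 1 ≤ k) (hkt : k < t i)
    (hle : (Pi.single i (p ^ k) : Fin n → ℕ) ≤ maxExp p t) :
    D (mono F (Pi.single i (p ^ k), {i})) = 0 := by
  by_contra hne
  obtain ⟨r, v, hcoeff, hv, hweight⟩ :=
    hK.exists_fieldWeight_eq hD ht (singleton_mem_oddMonos hle i) hne
  have hzero : fieldWeight (0, v) r = monoWeight (0, {i}) := funext fun l =>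
    fieldWeight_const_eq_of_cast hp (abs_monoWeight_le_two (Nat.zero_le 2)) <| by
      rw [hweight, monoWeight, monoWeight]
      obtain rfl | hl := eq_or_ne l i
      · simp [Nat.one_le_iff_ne_zero.1 hk]
      · simp [hl]
  obtain ⟨l, hl, rfl, rfl⟩ := eq_inl_of_fieldWeight_eq_const (by simp) hv hzero
  obtain rfl := Finset.mem_singleton.1 hl
  rw [Finset.erase_singleton] at hcoeff
  exact hcoeff (hD.coeff_power l k hk hkt)

theorem KillsBelow.map_single_prime_pow {i j : Fin n} {k : ℕ}
    (hK : KillsBelow p t D (deg (Pi.single i (p ^ k), {j}))) (hD : IsNormal p t D) (hp : 3 < p)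
    (ht : ∀ i, 1 ≤ t i) (hk : 1 ≤ k) (hle : p ^ k ≤ maxExp p t i) :
    D (mono F (Pi.single i (p ^ k), {j})) = 0 := by
  have hprime : p.Prime := Fact.out
  have hkt : k < t i := (Nat.pow_lt_pow_iff_right hprime.one_lt).1
    (hle.trans_lt (Nat.sub_lt (Nat.pow_pos hprime.pos) one_pos))
  have hself : D (mono F (Pi.single i (p ^ k), {i})) = 0 :=
    KillsBelow.map_single_prime_pow_self hK hD hp ht hk hkt (single_le hle)
  obtain rfl | hij := eq_or_ne i j
  · exact hself
  have hleibniz := hD.isHamDer.leibniz _ (elem_mem ht i j) _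
    (mono_mem_oddTrunc (singleton_mem_oddMonos (single_le hle) i))
  rw [hself, hD.map_elem, map_zero, map_zero, sub_zero, poisson_elem, pd_inr_mono_singleton,
    pd_inl_mono_of_apply_eq_zero (Pi.single_eq_of_ne hij.symm _), map_zero, sub_zero,
    mul_mono_empty_right, binom_zero_left, zero_add, Nat.cast_one, one_smul] at hleibniz
  exact hleibniz

theorem KillsBelow.map_single_of_dvd {i j : Fin n} {a : ℕ}
    (hK : KillsBelow p t D (deg (Pi.single i a, {j}))) (hD : IsNormal p t D) (hp : 3 < p)
    (ht : ∀ i, 1 ≤ t i) (ha₀ : a ≠ 0) (hpa : p ∣ a) (hle : a ≤ maxExp p t i) :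
    D (mono F (Pi.single i a, {j})) = 0 := by
  by_cases hpow : ∃ k, a = p ^ k
  · obtain ⟨k, rfl⟩ := hpow
    refine hK.map_single_prime_pow hD hp ht (Nat.one_le_iff_ne_zero.2 ?_) hle
    rintro rfl
    exact (Fact.out : p.Prime).not_dvd_one hpa
  obtain ⟨b, hb₀, hba, hchoose, hpb⟩ := exists_not_dvd_choose ha₀ (not_exists.1 hpow)
  have hpb' := Nat.le_of_dvd hb₀ (hpb hpa)
  rw [← CharP.cast_eq_zero_iff F p] at hchoose
  obtain rfl | hij := eq_or_ne i j
  · have hzero : (a.choose (b - 1) : F) = 0 := by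
      have hsucc := congrArg (Nat.cast (R := F)) (Nat.choose_succ_right_eq a (b - 1))
      rw [Nat.sub_add_cancel hb₀, Nat.cast_mul, Nat.cast_mul, Nat.cast_sub (by omega),
        Nat.cast_sub hb₀, (CharP.cast_eq_zero_iff F p a).2 hpa,
        (CharP.cast_eq_zero_iff F p b).2 (hpb hpa)] at hsucc
      simpa using hsucc.symm
    refine hK.map_of_choose_sub_choose (c := b - 1) hD.isHamDer (by simp)
      (Finset.mem_singleton_self i) (single_le hle) (by omega) (by omega) ?_ ?_
    · simp only [deg, Fintype.sum_pi_single', Finset.card_singleton]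
      omega
    · rwa [Pi.single_eq_same, hzero, Nat.sub_add_cancel hb₀, zero_sub, neg_ne_zero]
  · refine hK.map_of_choose (c := b) hD.isHamDer hij (single_le hle) (by omega) ?_ (Or.inl rfl)
      (by rwa [Pi.single_eq_same])
    rwa [Fintype.sum_pi_single']

theorem KillsBelow.map_of_cast_eq_zero {α : Fin n → ℕ} {j : Fin n}
    (hK : KillsBelow p t D (deg (α, {j}))) (hD : IsNormal p t D) (hp : 3 < p) (ht : ∀ i, 1 ≤ t i)
    (hα : α ≤ maxExp p t) (hα₀ : α ≠ 0) (hcast : ∀ i, (α i : F) = 0) :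
    D (mono F (α, {j})) = 0 := by
  by_cases htwo : ∃ i l, i ≠ j ∧ l ≠ i ∧ α i ≠ 0 ∧ α l ≠ 0
  · obtain ⟨i, l, hij, hli, hi, hl⟩ := htwo
    have hpi := Nat.le_of_dvd (Nat.pos_of_ne_zero hi) ((CharP.cast_eq_zero_iff F p _).1 (hcast i))
    have hlt : α i < ∑ k, α k := Finset.single_lt_sum hli (Finset.mem_univ i) (Finset.mem_univ l)
      (Nat.pos_of_ne_zero hl) fun _ _ _ => Nat.zero_le _
    exact hK.map_of_choose (l := l) hD.isHamDer hij hα (by omega) hlt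
      (Or.inr (add_one_le_maxExp_of_cast_ne (F := F) ht hα (by simp [hcast])))
      (by simp)
  · push Not at htwo
    obtain ⟨i, hi⟩ : ∃ i, α = Pi.single i (α i) := by
      simp only [funext_iff]
      by_cases h : ∃ i, i ≠ j ∧ α i ≠ 0
      · obtain ⟨i, hij, hi⟩ := h
        refine ⟨i, fun l => ?_⟩
        obtain rfl | hl := eq_or_ne l i
        · rw [Pi.single_eq_same]
        · rw [Pi.single_eq_of_ne hl, htwo i l hij hl hi]
      · push Not at h
        refine ⟨j, fun l => ?_⟩
        obtain rfl | hl := eq_or_ne l j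
        · rw [Pi.single_eq_same]
        · rw [Pi.single_eq_of_ne hl, h l hl]
    rw [hi] at hK hα₀ ⊢
    exact hK.map_single_of_dvd hD hp ht (by simpa using hα₀)
      ((CharP.cast_eq_zero_iff F p _).1 (hcast i)) (hα i)

end

section

variable {p : ℕ} {t : Fin n → ℕ} {D : O F n →ₗ[F] (Idx n → O F n)}

theorem IsNormal.map_of_sum_le_one {α : Fin n → ℕ} {j : Fin n} (hD : IsNormal p t D)
    (hsum : ∑ k, α k ≤ 1) : D (mono F (α, {j})) = 0 := by
  obtain hsum | hsum := Nat.le_one_iff_eq_zero_or_eq_one.1 hsum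
  · rw [(Fintype.sum_eq_zero_iff_of_nonneg zero_le).1 hsum]
    exact hD.map_const j
  · obtain ⟨i, rfl⟩ := exists_eq_single_of_sum_eq_one hsum
    exact hD.map_elem i j

variable [CharP F p]

theorem KillsBelow.map_mul_pd_of_cast_eq_zero {β : Fin n → ℕ} {i j : Fin n}
    (hK : KillsBelow p t D (deg (β + Pi.single i 1, {j}))) (hD : IsNormal p t D) (hp : 3 < p)
    (hβ : β ≤ maxExp p t) (hi : β i + 2 ≤ maxExp p t i) (hij : i ≠ j) (hj : (β j : F) = 0) :
    D (mul F (pd F (Sum.inl j) (mono F (β, {i}))) (mono F (Pi.single i 2, ∅))) = 0 := by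
  obtain hβj | hβj := Nat.eq_zero_or_pos (β j)
  · rw [pd_inl_mono_of_apply_eq_zero hβj, map_zero, LinearMap.zero_apply, map_zero]
  obtain ⟨γ, rfl⟩ := exists_eq_add_single (c := 1) hβj
  have hγj : (γ j : F) = -1 := by
    rw [Pi.add_apply, Pi.single_eq_same, Nat.cast_add, Nat.cast_one] at hj
    exact eq_neg_of_add_eq_zero_left hj
  have hγi : (γ + Pi.single j 1 : Fin n → ℕ) i = γ i := by simp [hij]
  have hsum : 0 < ∑ k, γ k := Finset.sum_pos' (fun _ _ => Nat.zero_le _)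
    ⟨j, Finset.mem_univ j, Nat.pos_of_ne_zero fun h => by simp [h] at hγj⟩
  rw [pd_inl_mono_add_single_one, mul_mono_empty_right, map_smul]
  have hdeg : deg (γ + Pi.single j 1 + Pi.single i 1, {j}) = deg (γ + Pi.single i 2, {i}) := by
    simp only [deg, sum_add_single, Finset.card_singleton]
  rw [hdeg] at hK
  rw [hK.map_of_choose (c := 2) hD.isHamDer hij.symm
    (add_single_le (le_self_add.trans hβ) (hγi ▸ hi)) le_rfl ?_ (Or.inl rfl) ?_, smul_zero]
  · rw [sum_add_single]
    omega
  · rw [Pi.add_apply, Pi.single_eq_of_ne hij.symm, add_zero,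
      choose_two_eq_one_of_cast_eq_neg_one hp hγj]
    exact one_ne_zero

variable [Fact p.Prime]

theorem KillsBelow.map_of_cast_eq_one {α : Fin n → ℕ} {i j : Fin n}
    (hK : KillsBelow p t D (deg (α, {j}))) (hD : IsNormal p t D) (hp : 3 < p) (ht : ∀ i, 1 ≤ t i)
    (hα : α ≤ maxExp p t) (hsum : 3 ≤ ∑ k, α k) (hij : i ≠ j) (hi : (α i : F) = 1)
    (hj : (α j : F) = 0) : D (mono F (α, {j})) = 0 := by
  have htwo : (2 : F) ≠ 0 := two_ne_zero_of_three_lt hp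
  have hbox := add_one_le_maxExp_of_cast_ne (F := F) ht hα (i := i) fun h =>
    htwo (by linear_combination h - hi)
  obtain ⟨β, rfl⟩ := exists_eq_add_single (α := α) (i := i) (c := 1)
    (Nat.one_le_iff_ne_zero.2 fun h => by simp [h] at hi)
  rw [Pi.add_apply, Pi.single_eq_same] at hi hbox
  rw [Pi.add_apply, Pi.single_eq_of_ne hij.symm, add_zero] at hj
  have hβ : β ≤ maxExp p t := le_self_add.trans hα
  have hdiv : pd F (Sum.inl i) (mono F (Pi.single i 2, {j})) = mono F (Pi.single i 1, {j}) := by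
    simpa using pd_inl_mono_add_single (F := F) i 0 1 {j}
  have hpoisson : poisson (mono F (β, {i})) (mono F (Pi.single i 2, {j})) =
      mul F (pd F (Sum.inl j) (mono F (β, {i}))) (mono F (Pi.single i 2, ∅)) -
        mono F (β + Pi.single i 1, {j}) := by
    rw [poisson_singleton_singleton, hdiv, mul_mono_empty_left, binom_single_right,
      Nat.choose_one_right, hi, one_smul]
  have hleibniz := hD.isHamDer.leibniz _ (mono_mem_oddTrunc (singleton_mem_oddMonos hβ i)) _
    (mono_mem_oddTrunc (singleton_mem_oddMonos (single_le (two_le_maxExp hp ht i)) j))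
  rw [sum_add_single] at hsum
  rw [hpoisson, map_sub, hK.map_mul_pd_of_cast_eq_zero hD hp hβ hbox hij hj, zero_sub,
    hK _ (singleton_mem_oddMonos hβ i) ?_,
    hK _ (singleton_mem_oddMonos (single_le (two_le_maxExp hp ht i)) j) ?_, map_zero, map_zero,
    sub_zero, neg_eq_zero] at hleibniz
  · exact hleibniz
  all_goals
    simp only [deg, sum_add_single, Fintype.sum_pi_single', Finset.card_singleton]
    omega

theorem KillsBelow.cast_eq_zero_of_map_ne_zero {α : Fin n → ℕ} {j : Fin n}
    (hK : KillsBelow p t D (deg (α, {j}))) (hD : IsNormal p t D) (hp : 3 < p) (ht : ∀ i, 1 ≤ t i)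
    (hα : α ≤ maxExp p t) (hsum : 3 ≤ ∑ k, α k) (hne : D (mono F (α, {j})) ≠ 0) :
    (α j : F) = 0 := by
  by_contra hj
  have hchoose : ((α j).choose 1 : F) - (α j).choose 2 = 0 := not_not.1 fun h =>
    hne <| hK.map_of_choose_sub_choose hD.isHamDer (by simp) (Finset.mem_singleton_self j) hα le_rfl
      (two_le_maxExp hp ht j) (by simp only [deg, Finset.card_singleton]; omega) h
  rw [Nat.choose_one_right] at hchoose
  have hthree : (α j : F) = 3 := mul_left_cancel₀ hj <| by
    linear_combination -2 * hchoose - two_mul_cast_choose_two (R := F) (α j)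
  obtain ⟨r, v, -, -, hweight⟩ := hK.exists_fieldWeight_eq hD ht (singleton_mem_oddMonos hα j) hne
  have hbounds := fieldWeight_const_bounds v r j
  have hneg : fieldWeight (0, v) r j = -2 := fieldWeight_const_eq_of_cast hp (by norm_num) <| by
    rw [hweight, monoWeight, if_pos (Finset.mem_singleton_self j), Int.cast_sub, Int.cast_natCast,
      hthree]
    norm_num
  omega

theorem KillsBelow.map_of_three_le_sum {α : Fin n → ℕ} {j : Fin n}
    (hK : KillsBelow p t D (deg (α, {j}))) (hD : IsNormal p t D) (hp : 3 < p) (ht : ∀ i, 1 ≤ t i)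
    (hα : α ≤ maxExp p t) (hsum : 3 ≤ ∑ k, α k) : D (mono F (α, {j})) = 0 := by
  by_contra hne
  have hj := hK.cast_eq_zero_of_map_ne_zero hD hp ht hα hsum hne
  have hzero_or_one (i) (hij : i ≠ j) : (α i : F) = 0 ∨ (α i : F) = 1 := by
    have hchoose : ((α i).choose 2 : F) = 0 := not_not.1 fun h =>
      hne (hK.map_of_choose hD.isHamDer hij hα le_rfl (by omega) (Or.inl rfl) h)
    have htwo := two_mul_cast_choose_two (R := F) (α i)
    rwa [hchoose, mul_zero, eq_comm, mul_eq_zero, sub_eq_zero] at htwo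
  by_cases hone : ∃ i, i ≠ j ∧ (α i : F) = 1
  · obtain ⟨i, hij, hi⟩ := hone
    exact hne (hK.map_of_cast_eq_one hD hp ht hα hsum hij hi hj)
  · push Not at hone
    refine hne (hK.map_of_cast_eq_zero hD hp ht hα ?_ fun i => ?_)
    · rintro rfl
      simp at hsum
    · obtain rfl | hij := eq_or_ne i j
      · exact hj
      · exact (hzero_or_one i hij).resolve_right (hone i hij)

theorem IsNormal.killsBelow (hD : IsNormal p t D) (hp : 3 < p) (ht : ∀ i, 1 ≤ t i) (N : ℕ) :
    KillsBelow p t D N := by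
  induction N with
  | zero => exact fun a _ h => absurd h (Nat.not_lt_zero _)
  | succ N ih =>
    rintro ⟨α, u⟩ ha hdeg
    obtain hlt | rfl := Nat.lt_succ_iff_lt_or_eq.1 hdeg
    · exact ih _ ha hlt
    obtain hu | hu : u.card = 1 ∨ 3 ≤ u.card := by
      obtain ⟨q, hq⟩ : Odd u.card := ha.2
      omega
    · obtain ⟨j, rfl⟩ := Finset.card_eq_one.1 hu
      obtain hsum | hsum | hsum : ∑ k, α k ≤ 1 ∨ ∑ k, α k = 2 ∨ 3 ≤ ∑ k, α k := by omega
      · exact hD.map_of_sum_le_one hsum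
      · exact ih.map_of_sum_eq_two hD hp ht ha.1 hsum
      · exact ih.map_of_three_le_sum hD hp ht ha.1 hsum
    · exact ih.map_of_three_le_card hD hp ht ha hu

theorem IsNormal.eq_zero (hD : IsNormal p t D) (hp : 3 < p) (ht : ∀ i, 1 ≤ t i) {a : O F n}
    (ha : a ∈ oddTrunc F p t) : D a = 0 := by
  rw [oddTrunc_eq_span] at ha
  refine LinearMap.eqOn_span (g := 0) ?_ ha
  rintro _ ⟨b, hb, rfl⟩
  exact hD.killsBelow hp ht (deg b + 1) b hb (Nat.lt_succ_self _)

theorem IsHamDer.exists_eq_innerDer_add (hD : IsHamDer p t D) (hp : 3 < p) (hn : 3 ≤ n)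
    (ht : ∀ i, 1 ≤ t i) : ∃ w ∈ evenFields F n, ∃ c, ∀ a ∈ oddTrunc F p t,
      D a = innerDer w a + adPartialSum p t c a := by
  obtain ⟨w, hw, c, hnormal⟩ := hD.exists_isNormal hp hn ht
  refine ⟨w, hw, c, fun a ha => ?_⟩
  have hzero := hnormal.eq_zero hp ht ha
  rwa [LinearMap.sub_apply, LinearMap.sub_apply, sub_sub, sub_eq_zero] at hzero

end

/-! ### Derivations of `ℋ𝒪` -/

theorem restrictTo_mem_derSpace {R L : Type*} [CommRing R] [LieRing L] [LieAlgebra R L]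
    (H : LieSubalgebra R L) {φ : Module.End R L} (hφ : ∀ x y, φ ⁅x, y⁆ = ⁅φ x, y⁆ + ⁅x, φ y⁆) :
    restrictTo H φ ∈ derSpace R H L := by
  refine ⟨⟨restrictTo H φ, fun x y => ?_⟩, rfl⟩
  change φ ⁅(x : L), (y : L)⁆ = ⁅(x : L), φ y⁆ - ⁅(y : L), φ x⁆
  rw [hφ, ← lie_skew (φ x) (y : L)]
  abel

section

variable {p : ℕ} {t : Fin n → ℕ}

theorem mem_trunc_of_pdField_pow_eq_zero {f : Idx n → O F n}
    (hf : ∀ j, (pdField j ^ p ^ t j) f = 0) (r : Idx n) : f r ∈ trunc F p t := by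
  refine mem_trunc_iff.2 fun ⟨α, u⟩ hcoeff j => ?_
  by_contra hlt
  obtain ⟨β, rfl⟩ := exists_eq_add_single (α := α) (i := j) (c := p ^ t j) (by grind)
  rw [← coeff_pd_inl_pow, ← pdField_pow_apply, hf, Pi.zero_apply, map_zero] at hcoeff
  exact hcoeff rfl

theorem adPartialSum_mem_trunc (c : Fin n → ℕ → F) {a : O F n} (ha : a ∈ trunc F p t) (r : Idx n) :
    adPartialSum p t c a r ∈ trunc F p t := by
  simp only [adPartialSum_apply, Finset.sum_apply]
  exact sum_mem fun i _ => sum_mem fun k _ =>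
    Submodule.smul_mem _ _ (pdField_pow_mem_trunc i _ (ham_mem_trunc ha) r)

theorem mem_wittPart_zero {X : Module.End F (O F n)} :
    X ∈ wittPart F p t 0 ↔
      ∃ f ∈ evenFields F n, (∀ r, f r ∈ trunc F p t) ∧ vectorField F f = X := by
  simp only [mem_wittPart, mem_evenFields, zero_add, forall_and, and_assoc, and_left_comm]

variable [Fact p.Prime]

theorem pdField_pow_eq_zero {f : Idx n → O F n} (hf : ∀ r, f r ∈ trunc F p t) (j : Fin n) :
    (pdField j ^ p ^ t j) f = 0 := by
  ext r : 1
  refine coeff_ext fun ⟨β, v⟩ => ?_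
  rw [pdField_pow_apply, coeff_pd_inl_pow, Pi.zero_apply, map_zero]
  by_contra hcoeff
  have hle := mem_trunc_iff.1 (hf r) _ hcoeff j
  have hpos : 0 < p ^ t j := pow_pos (Fact.out : p.Prime).pos _
  change (β + Pi.single j (p ^ t j) : Fin n → ℕ) j ≤ p ^ t j - 1 at hle
  rw [Pi.add_apply, Pi.single_eq_same] at hle
  omega

variable [CharP F p]

theorem mem_trunc_of_bracket_ham_mem (hp : 3 < p) (hn : 3 ≤ n) (ht : ∀ i, 1 ≤ t i)
    {w : Idx n → O F n} (hw : w ∈ evenFields F n)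
    (hbracket : ∀ a ∈ oddTrunc F p t, ∀ r, bracket w (ham a) r ∈ trunc F p t) (r : Idx n) :
    w r ∈ trunc F p t := by
  refine mem_trunc_of_pdField_pow_eq_zero (fun j => ?_) r
  have hcentral (a) (ha : a ∈ oddTrunc F p t) :
      bracket (ham a) ((pdField j ^ p ^ t j) w) = 0 := by
    have hleibniz := pdField_pow_bracket p j (t j) hw (ham_mem ha.2)
    rw [pdField_pow_eq_zero (hbracket a ha), pdField_pow_eq_zero (ham_mem_trunc ha.1), map_zero,
      add_zero] at hleibniz
    rw [bracket_swap, ← hleibniz, neg_zero]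
  refine eq_zero_of_centralizes hp hn (fun i => ?_) (fun i => hcentral _ (elem_mem ht i i))
    fun u hu => hcentral _ (const_mem (by rw [hu]; decide))
  rw [← neg_eq_zero, ← bracket_ham_const]
  exact hcentral _ (const_mem (by simp))

/-- The coefficient vector of a field in `𝒲`, recovered from its values on the generators. -/
noncomputable def fieldCoeffs : W F p t →ₗ[F] (Idx n → O F n) :=
  (LinearMap.pi fun r => LinearMap.applyₗ (mono F (gen r))) ∘ₗ (W F p t).toSubmodule.subtype

theorem fieldCoeffs_of_eq_vectorField {x : W F p t} {f : Idx n → O F n}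
    (h : x.1 = vectorField F f) : fieldCoeffs x = f :=
  funext fun r => (LinearMap.congr_fun h _).trans (vectorField_gen f r)

theorem vectorField_fieldCoeffs (x : W F p t) : vectorField F (fieldCoeffs x) = x := by
  obtain ⟨f, -, -, hfx⟩ := mem_wittPart_zero.1 x.2
  rw [fieldCoeffs_of_eq_vectorField hfx.symm, hfx]

theorem fieldCoeffs_mem (x : W F p t) : fieldCoeffs x ∈ evenFields F n := by
  obtain ⟨f, hf, -, hfx⟩ := mem_wittPart_zero.1 x.2
  rwa [fieldCoeffs_of_eq_vectorField hfx.symm]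

theorem fieldCoeffs_mem_trunc (x : W F p t) (r : Idx n) : fieldCoeffs x r ∈ trunc F p t := by
  obtain ⟨f, -, hf, hfx⟩ := mem_wittPart_zero.1 x.2
  rw [fieldCoeffs_of_eq_vectorField hfx.symm]
  exact hf r

theorem fieldCoeffs_injective : Function.Injective (fieldCoeffs (F := F) (p := p) (t := t)) :=
  fun x y h => Subtype.ext <| by
    rw [← vectorField_fieldCoeffs x, h, vectorField_fieldCoeffs]

theorem exists_fieldCoeffs_eq {f : Idx n → O F n} (hf : f ∈ evenFields F n)
    (hftrunc : ∀ r, f r ∈ trunc F p t) : ∃ x : W F p t, fieldCoeffs x = f :=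
  ⟨⟨vectorField F f, mem_wittPart_zero.2 ⟨f, hf, hftrunc, rfl⟩⟩, fieldCoeffs_of_eq_vectorField rfl⟩

theorem fieldCoeffs_lie (x y : W F p t) :
    fieldCoeffs ⁅x, y⁆ = bracket (fieldCoeffs x) (fieldCoeffs y) := by
  refine fieldCoeffs_of_eq_vectorField ?_
  rw [vectorField_bracket (fieldCoeffs_mem x) (fieldCoeffs_mem y), vectorField_fieldCoeffs,
    vectorField_fieldCoeffs, LieSubalgebra.coe_bracket]

theorem fieldCoeffs_partialW (i : Fin n) :
    fieldCoeffs (partialW F p t i) = Pi.single (Sum.inl i) (mono F (0, ∅)) :=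
  fieldCoeffs_of_eq_vectorField (vectorField_single i).symm

theorem fieldCoeffs_ad_partialW_pow (i : Fin n) (k : ℕ) (x : W F p t) :
    fieldCoeffs ((LieAlgebra.ad F (W F p t) (partialW F p t i) ^ k) x) =
      (pdField i ^ k) (fieldCoeffs x) := by
  induction k generalizing x with
  | zero => rfl
  | succ k ih =>
    rw [pow_succ, Module.End.mul_apply, ih, LieAlgebra.ad_apply, fieldCoeffs_lie,
      fieldCoeffs_partialW, bracket_single, pow_succ, Module.End.mul_apply]

variable (p t) in
/-- The map `T_H` from the odd part of `𝒪(n,n;t)` onto `ℋ𝒪`. -/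
noncomputable def hamHO : oddTrunc F p t →ₗ[F] HO F p t :=
  LinearMap.codRestrict (HO F p t).toSubmodule
    (LinearMap.codRestrict (W F p t).toSubmodule ((vectorField F ∘ₗ ham).domRestrict _)
      fun a => mem_wittPart_zero.2 ⟨_, ham_mem a.2.2, ham_mem_trunc a.2.1, rfl⟩)
    fun a => ⟨a.1, a.2.1, TH_eq_vectorField_ham a.2.2⟩

theorem fieldCoeffs_hamHO (a : oddTrunc F p t) :
    fieldCoeffs (hamHO p t a : W F p t) = ham (a : O F n) :=
  fieldCoeffs_of_eq_vectorField rfl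

theorem hamHO_surjective : Function.Surjective (hamHO (F := F) p t) := by
  intro x
  obtain ⟨a, hatrunc, haodd, hax⟩ := exists_odd_of_mem x.2 x.1.2
  exact ⟨⟨a, hatrunc, haodd⟩,
    Subtype.ext (Subtype.ext ((TH_eq_vectorField_ham haodd).symm.trans hax))⟩

theorem hamHO_poisson (a b : oddTrunc F p t) :
    hamHO p t ⟨poisson a.1 b.1, poisson_mem a.2 b.2⟩ = ⁅hamHO p t a, hamHO p t b⁆ := by
  refine Subtype.ext (fieldCoeffs_injective ?_)
  rw [fieldCoeffs_hamHO, ham_poisson a.2.2 b.2.2, LieSubalgebra.coe_bracket, fieldCoeffs_lie,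
    fieldCoeffs_hamHO, fieldCoeffs_hamHO]

theorem exists_isHamDer (D : LieDerivation F (HO F p t) (W F p t)) :
    ∃ E : O F n →ₗ[F] (Idx n → O F n), IsHamDer p t E ∧
      ∀ a : oddTrunc F p t, E a = fieldCoeffs (D (hamHO p t a)) := by
  obtain ⟨E, hE⟩ := LinearMap.exists_extend
    (fieldCoeffs ∘ₗ (D : HO F p t →ₗ[F] W F p t) ∘ₗ hamHO p t)
  replace hE (a : oddTrunc F p t) : E a = fieldCoeffs (D (hamHO p t a)) := LinearMap.congr_fun hE a
  refine ⟨E, ⟨fun a ha => ?_, fun a ha b hb => ?_⟩, hE⟩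
  · rw [hE ⟨a, ha⟩]
    exact fieldCoeffs_mem _
  · rw [hE ⟨a, ha⟩, hE ⟨b, hb⟩, hE ⟨poisson a b, poisson_mem ha hb⟩, hamHO_poisson ⟨a, ha⟩ ⟨b, hb⟩,
      LieDerivation.apply_lie_eq_sub, map_sub, LieSubalgebra.coe_bracket_of_module,
      LieSubalgebra.coe_bracket_of_module, fieldCoeffs_lie, fieldCoeffs_lie, fieldCoeffs_hamHO,
      fieldCoeffs_hamHO]

theorem eq_restrictTo_of_fieldCoeffs {D : LieDerivation F (HO F p t) (W F p t)} {w : W F p t}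
    {c : Fin n → ℕ → F} (h : ∀ a : oddTrunc F p t, fieldCoeffs (D (hamHO p t a)) =
      innerDer (fieldCoeffs w) a + adPartialSum p t c a) :
    (D : HO F p t →ₗ[F] W F p t) = restrictTo (HO F p t) (LieAlgebra.ad F (W F p t) w) +
      ∑ i, ∑ k ∈ Finset.Ico 1 (t i), c i k • restrictTo (HO F p t)
        (LieAlgebra.ad F (W F p t) (partialW F p t i) ^ p ^ k) := by
  refine LinearMap.ext fun x => ?_
  obtain ⟨a, rfl⟩ := hamHO_surjective x
  refine fieldCoeffs_injective ((h a).trans ?_)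
  have had : fieldCoeffs (restrictTo (HO F p t) (LieAlgebra.ad F (W F p t) w) (hamHO p t a)) =
      innerDer (fieldCoeffs w) a :=
    (fieldCoeffs_lie _ _).trans (congrArg _ (fieldCoeffs_hamHO a))
  have hpow (i : Fin n) (k : ℕ) : fieldCoeffs (restrictTo (HO F p t)
      (LieAlgebra.ad F (W F p t) (partialW F p t i) ^ k) (hamHO p t a)) = adPartialPow i k a :=
    (fieldCoeffs_ad_partialW_pow i k _).trans (congrArg _ (fieldCoeffs_hamHO a))
  simp only [LinearMap.add_apply, LinearMap.sum_apply, LinearMap.smul_apply, map_add, map_sum,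
    map_smul, had, hpow, adPartialSum_apply]

theorem exists_eq_restrictTo_ad_add (hp : 3 < p) (hn : 3 ≤ n) (ht : ∀ i, 1 ≤ t i)
    (D : LieDerivation F (HO F p t) (W F p t)) : ∃ (w : W F p t) (c : Fin n → ℕ → F),
      (D : HO F p t →ₗ[F] W F p t) = restrictTo (HO F p t) (LieAlgebra.ad F (W F p t) w) +
        ∑ i, ∑ k ∈ Finset.Ico 1 (t i), c i k • restrictTo (HO F p t)
          (LieAlgebra.ad F (W F p t) (partialW F p t i) ^ p ^ k) := by
  obtain ⟨E, hE, hED⟩ := exists_isHamDer D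
  obtain ⟨w, hw, c, hEw⟩ := hE.exists_eq_innerDer_add hp hn ht
  have hwtrunc : ∀ r, w r ∈ trunc F p t := mem_trunc_of_bracket_ham_mem hp hn ht hw fun a ha r => by
    rw [← innerDer_apply, ← add_sub_cancel_right (innerDer w a) (adPartialSum p t c a),
      ← hEw a ha, hED ⟨a, ha⟩]
    exact sub_mem (fieldCoeffs_mem_trunc _ r) (adPartialSum_mem_trunc c ha.1 r)
  obtain ⟨x, rfl⟩ := exists_fieldCoeffs_eq hw hwtrunc
  exact ⟨x, c, eq_restrictTo_of_fieldCoeffs fun a => (hED a).symm.trans (hEw a a.2)⟩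

theorem restrictTo_ad_partialW_pow_mem_derSpace (i : Fin n) (k : ℕ) :
    restrictTo (HO F p t) (LieAlgebra.ad F (W F p t) (partialW F p t i) ^ p ^ k) ∈
      derSpace F (HO F p t) (W F p t) :=
  restrictTo_mem_derSpace _ fun x y => fieldCoeffs_injective <| by
    simp only [map_add, fieldCoeffs_lie, fieldCoeffs_ad_partialW_pow,
      pdField_pow_bracket p i k (fieldCoeffs_mem x) (fieldCoeffs_mem y)]

end

end OddHamiltonian

theorem mainTheorem2 {F : Type*} [Field F] (p : ℕ) [Fact p.Prime] [CharP F p] (hp : 3 < p)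
    (n : ℕ) (hn : 3 ≤ n) (t : Fin n → ℕ) (ht : ∀ i, 1 ≤ t i) :
    OddHamiltonian.derSpace F (OddHamiltonian.HO F p t) (OddHamiltonian.W F p t) =
      OddHamiltonian.adSpace (OddHamiltonian.HO F p t) ⊔
      Submodule.span F {φ | ∃ (i : Fin n) (k : ℕ), 1 ≤ k ∧ k < t i ∧
        φ = OddHamiltonian.restrictTo (OddHamiltonian.HO F p t)
          (LieAlgebra.ad F (OddHamiltonian.W F p t) (OddHamiltonian.partialW F p t i) ^ p ^ k)} := by
  refine le_antisymm ?_ (sup_le ?_ (Submodule.span_le.2 ?_))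
  · rintro _ ⟨D, rfl⟩
    obtain ⟨w, c, hD⟩ := OddHamiltonian.exists_eq_restrictTo_ad_add hp hn ht D
    refine Submodule.mem_sup.2 ⟨_, ⟨w, rfl⟩, _, ?_, hD.symm⟩
    refine sum_mem fun i _ => sum_mem fun k hk => Submodule.smul_mem _ _ (Submodule.subset_span ?_)
    exact ⟨i, k, (Finset.mem_Ico.1 hk).1, (Finset.mem_Ico.1 hk).2, rfl⟩
  · rintro _ ⟨w, rfl⟩
    exact OddHamiltonian.restrictTo_mem_derSpace _ (leibniz_lie w)
  · rintro _ ⟨i, k, -, -, rfl⟩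
    exact OddHamiltonian.restrictTo_ad_partialW_pow_mem_derSpace i k
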